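/- **Setting.** Let $C_0,\dots,C_{n-1}$ be pairwise disjoint unit circles in the plane and let $\epsilon<\tfrac12$. A communication graph $G$ is a connected graph on $\{0,\dots,n-1\}$ in which $\{i,j\}$ may be an edge only if the centres of $C_i$ and $C_j$ are at distance at most $2+\epsilon$. For an edge $\{i,j\}$, the link position $\phi_{ij}$ is the angular position of the point of $C_i$ closest to $C_j$. A schedule assigns to each circle a starting angle $f_i\in[0,2\pi)$ and a direction $g_i\in\{1,-1\}$; its prescribed position in $C_i$ at time $\tau$ is $f_i+2\pi g_i\tau$ (mod $2\pi$). A *synchronized communication system* (SCS) consists of such circles, a communication graph and a schedule such that, for every edge $\{i,j\}$, $g_i=-g_j$ and, at all times, the prescribed position in $C_i$ is $\phi_{ij}$ if and only if the prescribed position in $C_j$ is $\phi_{ji}$. Robot $i$ starts in $C_i$ at time $0$. After the removal of a set of robots at time $0$, every surviving robot moves according to the schedule of the circle that it is in; whenever a robot in $C_i$ arrives at $\phi_{ij}$, $\{i,j\}$ an edge, and no surviving robot is at $\phi_{ji}$, it shifts to $C_j$ (instantaneously); otherwise it stays in $C_i$. A surviving robot *starves* if every time it arrives at a link position there is no robot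 at the other side of the link. The *$k$-resilience* of the SCS is the minimum number of robots whose removal makes at least $k$ surviving robots starve, or $\infty$ if no removal does so. A *ring* is the closed path of a point that follows the directions $g_i$ and shifts to the neighbouring circle at every link position. A *tie* is a closed path along a ring that starts and ends at a crossing point of the ring with itself (a link traversed by the ring in both directions), entering the link in one direction and returning in the other, without passing through this crossing point in between; its length is the total length of the circle arcs traversed. Let $t$ be the number of distinct tie lengths. **Theorem.** There are a single program for a random access machine and a constant $C$ with the following property. Let $k\ge 3$, and consider an SCS of $n\geq 1$ robots whose communication graph is a tree. Given $n$, $k$ and a list of the edges of the communication graph (in any order), the program halts and outputs the $k$-resilience of the SCS, and, if $n\ge 2$, the number $T$ of its steps satisfies $$T\le C\, n^{k-2}\,t\,\min(n,kt)\qquad\text{and}\qquad T\le C\,t\,n^{k-1}.$$ The constant $C$ does not depend on $n$, $k$ or the SCS. The machine has arrays of words of $O(\log(n+k))$ bits and unit-cost memory access, addition, truncated subtraction and comparison. -/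

import Mathlib

open scoped Real

namespace MultiRobot

/-! ### Trajectories, schedules, synchronized communication systems -/

/-- The graph of potential links of the unit circles with the given centres: two circles are
adjacent if their centres are at distance at most `2 + ε`. -/
def potentialLinks {n : ℕ} (center : Fin n → ℂ) (ε : ℝ) : SimpleGraph (Fin n) where
  Adj i j := i ≠ j ∧ dist (center i) (center j) ≤ 2 + ε
  symm := ⟨fun _ _ h => ⟨h.1.symm, by rw [dist_comm]; exact h.2⟩⟩
  loopless := ⟨fun _ h => h.1 rfl⟩

/-- The link position of circle `i` with respect to circle `j`: the angle, seen from the centre of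
circle `i`, of the point of circle `i` that is closest to circle `j`. -/
noncomputable def linkAngle {n : ℕ} (center : Fin n → ℂ) (i j : Fin n) : ℝ :=
  Complex.arg (center j - center i)

/-- A schedule: starting positions in `[0, 2π)` and movement directions (`1` is counterclockwise,
`-1` is clockwise). -/
structure Schedule (n : ℕ) where
  start : Fin n → ℝ
  start_mem : ∀ i, start i ∈ Set.Ico 0 (2 * π)
  dir : Fin n → ℤˣ

/-- The position (an angle modulo `2π`) prescribed by the schedule in circle `i` at time `t`. A
circle is covered in one unit of time. -/
noncomputable def Schedule.position {n : ℕ} (σ : Schedule n) (i : Fin n) (t : ℝ) : Real.Angle :=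
  ((σ.start i + 2 * π * ((σ.dir i : ℤ) : ℝ) * t : ℝ) : Real.Angle)

/-- The schedule is `G`-synchronized: for every edge, the two circles' prescribed positions are at
the common link at the same times. -/
def Schedule.IsSynchronized {n : ℕ} (σ : Schedule n) (center : Fin n → ℂ)
    (G : SimpleGraph (Fin n)) : Prop :=
  ∀ i j, G.Adj i j → ∀ t : ℝ,
    σ.position i t = (linkAngle center i j : Real.Angle) ↔
      σ.position j t = (linkAngle center j i : Real.Angle)

/-- A synchronized communication system of `n` robots; robot `i` starts in circle `i`. -/
structure SCS (n : ℕ) where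
  /-- centres of the unit circles -/
  center : Fin n → ℂ
  circles_disjoint : ∀ i j, i ≠ j →
    Disjoint (Metric.sphere (center i) 1) (Metric.sphere (center j) 1)
  /-- communication range -/
  range : ℝ
  range_lt : range < 1 / 2
  /-- communication graph -/
  graph : SimpleGraph (Fin n)
  graph_le : graph ≤ potentialLinks center range
  graph_connected : graph.Connected
  schedule : Schedule n
  synchronized : schedule.IsSynchronized center graph
  opposite : ∀ i j, graph.Adj i j → schedule.dir i = -schedule.dir j

namespace SCS

variable {n : ℕ} (S : SCS n)

/-- The position prescribed in circle `i` at time `t` is the link position with respect to `j`. -/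
def AtLink (i j : Fin n) (t : ℝ) : Prop :=
  S.schedule.position i t = (linkAngle S.center i j : Real.Angle)

/-- The times in `[0, t)` at which some link of the communication graph is passed. -/
def linkTimes (t : ℝ) : Set ℝ :=
  {s | 0 ≤ s ∧ s < t ∧ ∃ i j, S.graph.Adj i j ∧ S.AtLink i j s}

theorem linkTimes_finite (t : ℝ) : (S.linkTimes t).Finite := by
  have key : ∀ i j : Fin n, {s : ℝ | 0 ≤ s ∧ s < t ∧ S.AtLink i j s}.Finite := by
    intro i j
    set a : ℝ := (S.schedule.start i - linkAngle S.center i j) / (2 * π) with ha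
    set g : ℤ := (S.schedule.dir i : ℤ) with hg
    have hgg : (g : ℝ) * g = 1 := by
      have h : g * g = 1 := by
        rw [hg]
        rcases Int.units_eq_one_or (S.schedule.dir i) with h | h <;> simp [h]
      exact_mod_cast h
    have hg1 : |(g : ℝ)| = 1 := by
      have h : |(g : ℝ)| * |(g : ℝ)| = 1 := by rw [abs_mul_abs_self]; exact hgg
      nlinarith [abs_nonneg (g : ℝ)]
    refine ((Set.finite_Icc (-⌈|a| + |t|⌉) ⌈|a| + |t|⌉).image
      (fun m : ℤ => (g : ℝ) * (m - a))).subset ?_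
    rintro s ⟨h0, h1, h2⟩
    obtain ⟨m, hm⟩ := Real.Angle.angle_eq_iff_two_pi_dvd_sub.1 h2
    have hpi : (2 * π) ≠ 0 := by positivity
    have hm' : a + (g : ℝ) * s = m := by
      rw [ha]
      field_simp
      linarith
    have hms : |(m : ℝ)| ≤ |a| + |t| := by
      rw [← hm']
      refine (abs_add_le _ _).trans ?_
      rw [abs_mul, hg1, one_mul, abs_of_nonneg h0]
      linarith [le_abs_self t]
    have hc := Int.le_ceil (|a| + |t|)
    refine ⟨m, ⟨?_, ?_⟩, ?_⟩
    · have : -((⌈|a| + |t|⌉ : ℤ) : ℝ) ≤ m := by linarith [neg_abs_le (m : ℝ)]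
      exact_mod_cast this
    · have : (m : ℝ) ≤ ((⌈|a| + |t|⌉ : ℤ) : ℝ) := by linarith [le_abs_self (m : ℝ)]
      exact_mod_cast this
    · have : (m : ℝ) - a = g * s := by linarith
      simp only [this, ← mul_assoc, hgg, one_mul]
  refine (Set.finite_iUnion fun i => Set.finite_iUnion fun j => key i j).subset ?_
  rintro s ⟨h0, h1, i, j, -, h⟩
  exact Set.mem_iUnion.2 ⟨i, Set.mem_iUnion.2 ⟨j, h0, h1, h⟩⟩

/-! ### Partial systems, the shifting protocol, starvation, resilience

A partial system is given by the set `A` of surviving robots. A configuration `c : A → Fin n`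
records in which circle each surviving robot currently is; at time `t`, a robot in circle `i` is at
the position that the schedule prescribes in circle `i` at time `t`. -/

/-- At time `t`, in configuration `c`, some surviving robot is at the link position of circle `j`
with respect to circle `i`. -/
def RobotAt {A : Finset (Fin n)} (c : A → Fin n) (t : ℝ) (j i : Fin n) : Prop :=
  ∃ v : A, c v = j ∧ S.AtLink j i t

open Classical in
/-- The shifting protocol at time `t`: each surviving robot that is at the link position of its
circle `i` with respect to a neighbouring circle `j` shifts to `j` if there is no robot at the
other side of the link. All other robots stay in their circles. -/
noncomputable def shift {A : Finset (Fin n)} (c : A → Fin n) (t : ℝ) : A → Fin n := fun u =>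
  if h : ∃ j, S.graph.Adj (c u) j ∧ S.AtLink (c u) j t ∧ ¬ S.RobotAt c t j (c u) then h.choose
  else c u

/-- The configuration of the partial system with surviving robots `A` on arrival at time `t`: the
shifts at all link times in `[0, t)` have been carried out, in chronological order. -/
noncomputable def config (A : Finset (Fin n)) (t : ℝ) : A → Fin n :=
  (((S.linkTimes_finite t).toFinset).sort (· ≤ ·)).foldl (fun c s => S.shift c s) (fun u => u)

/-- The surviving robot `u` starves: every time that it arrives at a link position, the
corresponding neighbour is not there. -/
def Starves (A : Finset (Fin n)) (u : A) : Prop :=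
  ∀ t : ℝ, 0 ≤ t → ∀ j, S.graph.Adj (S.config A t u) j → S.AtLink (S.config A t u) j t →
    ¬ S.RobotAt (S.config A t) t j (S.config A t u)

/-- The `k`-resilience: the least number of robots whose removal makes at least `k` surviving
robots starve, and `⊤` if there is no such set of robots. -/
noncomputable def resilience (k : ℕ) : ℕ∞ :=
  sInf {m : ℕ∞ | ∃ R : Finset (Fin n), m = R.card ∧ k ≤ {u : (Rᶜ : Finset (Fin n)) |
    S.Starves Rᶜ u}.ncard}

/-! ### Rings and ties

A ring passes through crossing points, from circle `i` to circle `j`; such a passage is the dart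
`(i, j)` of the communication graph. -/

/-- The length, in `(0, 2π]`, of the arc that is traversed in circle `j`, in the movement direction
of that circle, from the link position with respect to `i` to the next occurrence of the link
position with respect to `k`. -/
noncomputable def arcLength (i j k : Fin n) : ℝ :=
  toIocMod Real.two_pi_pos 0
    (((S.schedule.dir j : ℤ) : ℝ) * (linkAngle S.center j k - linkAngle S.center j i))

/-- After the passage `d`, the ring's next passage is `d'`: it leaves the circle that `d` enters at
the first link position met in its movement direction. -/
def RingStep (d d' : S.graph.Dart) : Prop :=
  d'.fst = d.snd ∧ ∀ k, S.graph.Adj d.snd k →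
    S.arcLength d.fst d.snd d'.snd ≤ S.arcLength d.fst d.snd k

/-- The lengths of ties: the closed paths along a ring that start with one passage `p 0` of a
crossing point and end with the passage of the same crossing point in the other direction, without
passing through this crossing point in between. -/
def tieLengths : Set ℝ :=
  {l | ∃ (m : ℕ) (p : ℕ → S.graph.Dart),
    (∀ i < m, S.RingStep (p i) (p (i + 1))) ∧ p m = (p 0).symm ∧
    (∀ i, 0 < i → i < m → (p i).edge ≠ (p 0).edge) ∧
    l = ∑ i ∈ Finset.range m, S.arcLength (p i).fst (p i).snd (p (i + 1)).snd}

/-- The number of distinct tie lengths. -/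
noncomputable def numTieLengths : ℕ := S.tieLengths.ncard

end SCS

/-! ### Random access machine programs with a step count

Programs use finitely many random access arrays of natural numbers, addition, truncated subtraction
and comparison. Every operation costs one step. Addresses and values that are written must not
exceed the word bound `W`; there is no execution that violates this. -/

/-- Memory: the content of every cell of every array. -/
abbrev Mem := ℕ → ℕ → ℕ

inductive Expr where
  | lit (v : ℕ)
  | read (arr : ℕ) (idx : Expr)
  | add (a b : Expr)
  | sub (a b : Expr)

namespace Expr

def eval (M : Mem) : Expr → ℕ
  | lit v => v
  | read arr idx => M arr (idx.eval M)
  | add a b => a.eval M + b.eval M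
  | sub a b => a.eval M - b.eval M

def cost : Expr → ℕ
  | lit _ => 1
  | read _ idx => idx.cost + 1
  | add a b => a.cost + b.cost + 1
  | sub a b => a.cost + b.cost + 1

end Expr

inductive Test where
  | lt (a b : Expr)
  | eq (a b : Expr)
  | not (p : Test)
  | and (p q : Test)

namespace Test

def Holds (M : Mem) : Test → Prop
  | lt a b => a.eval M < b.eval M
  | eq a b => a.eval M = b.eval M
  | not p => ¬ p.Holds M
  | and p q => p.Holds M ∧ q.Holds M

def cost : Test → ℕ
  | lt a b => a.cost + b.cost + 1
  | eq a b => a.cost + b.cost + 1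
  | not p => p.cost + 1
  | and p q => p.cost + q.cost + 1

end Test

inductive Prog where
  | skip
  | write (arr : ℕ) (idx val : Expr)
  | seq (P Q : Prog)
  | branch (b : Test) (P Q : Prog)
  | loop (b : Test) (P : Prog)

/-- `Run W P M M' T`: with word bound `W`, the program `P` started in memory `M` halts in memory
`M'` after exactly `T` steps. -/
inductive Run (W : ℕ) : Prog → Mem → Mem → ℕ → Prop
  | skip (M : Mem) : Run W Prog.skip M M 1
  | write (M : Mem) (arr : ℕ) (idx val : Expr) (h1 : idx.eval M ≤ W) (h2 : val.eval M ≤ W) :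
      Run W (Prog.write arr idx val) M
        (Function.update M arr (Function.update (M arr) (idx.eval M) (val.eval M)))
        (idx.cost + val.cost + 1)
  | seq {P Q : Prog} {M M' M'' : Mem} {T T' : ℕ} (h1 : Run W P M M' T) (h2 : Run W Q M' M'' T') :
      Run W (Prog.seq P Q) M M'' (T + T')
  | branchTrue {b : Test} {P Q : Prog} {M M' : Mem} {T : ℕ} (hb : b.Holds M)
      (h : Run W P M M' T) : Run W (Prog.branch b P Q) M M' (b.cost + 1 + T)
  | branchFalse {b : Test} {P Q : Prog} {M M' : Mem} {T : ℕ} (hb : ¬ b.Holds M)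
      (h : Run W Q M M' T) : Run W (Prog.branch b P Q) M M' (b.cost + 1 + T)
  | loopTrue {b : Test} {P : Prog} {M M' M'' : Mem} {T T' : ℕ} (hb : b.Holds M)
      (h1 : Run W P M M' T) (h2 : Run W (Prog.loop b P) M' M'' T') :
      Run W (Prog.loop b P) M M'' (b.cost + 1 + T + T')
  | loopFalse {b : Test} {P : Prog} {M : Mem} (hb : ¬ b.Holds M) :
      Run W (Prog.loop b P) M M (b.cost + 1)

/-- `es` lists every edge of `G` exactly once, in any order and with any order of the endpoints. -/
def ListsEdges {n : ℕ} (G : SimpleGraph (Fin n)) (es : List (Fin n × Fin n)) : Prop :=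
  (es.map fun e => s(e.1, e.2)).Nodup ∧ ∀ i j, G.Adj i j ↔ s(i, j) ∈ es.map fun e => s(e.1, e.2)

/-- The input: array `0` holds `n` and `k`, arrays `1` and `2` hold the first and the second
endpoints of the listed edges; all other cells are `0`. -/
def inputMem {n : ℕ} (k : ℕ) (es : List (Fin n × Fin n)) : Mem
  | 0, 0 => n
  | 0, 1 => k
  | 1, i => (es.map fun e => (e.1 : ℕ)).getD i 0
  | 2, i => (es.map fun e => (e.2 : ℕ)).getD i 0
  | _, _ => 0

/-- The output: cell `0` of array `3` tells whether the result is finite, cell `1` of array `3`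
is then its value. -/
def outputOf (M : Mem) : ℕ∞ := if M 3 0 = 0 then ⊤ else (M 3 1 : ℕ∞)

end MultiRobot

/-! Imagine a token in every circle that shifts at every link. On a tree all tokens run along a
single ring, and they can be labelled by `ZMod n` in such a way that a period lowers the label seen
in a fixed circle by one, while the tokens facing each other across an edge `{i, j}` differ by the
number of vertices on one side of that edge. The labels come from three facts: the two sides of an
edge add up to `n`, the sides at a vertex add up to `n - 1`, which is `-1` modulo `n`, and an
antisymmetric function of the edges of a tree is a potential difference (`sideCard_add`,
`sum_sideCard`, `exists_potential`).

A robot facing a gap shifts and keeps its token; two robots that meet stay and exchange tokens. So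
the set of occupied tokens never changes, and a starving robot keeps its token forever. Every token
visits every link, hence a robot with token `x` starves exactly if no survivor holds a token in `x +
L`, where `L` is the set of side sizes (`starves_iff`). The `k`-resilience is therefore the minimum
of `|N(K)|` over independent sets `K` of size `k` in the circulant graph on `ZMod n` with connection
set `L` (`resilience_eq`). The same labels show that a tie starting with the passage from `i` to `j`
lasts as many periods as the side of `j` has vertices, so `t = |L|` (`tieLengths_eq`).

For the algorithm, `L` is found in linear time by peeling leaves. By translation invariance `K` may
be assumed to contain `0`, and one further element `z` is left open, so that only `k - 2` elements
have to be enumerated (`sInf_eq_sInf_candidates`). For the `k - 1` fixed elements `K'`, adding `z`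
costs `|N(K')| + |L| - |N(K') ∩ N(z)|`. All these overlaps are counted together by running through
the pairs of an element of `N(K')` and an element of `L`. This takes `O(min(n, kt) t)` steps per
tuple, since `|N(K')|` is at most `min(n, kt)`, and the arrays are cleaned within the same bound by
visiting only the cells that were used. The linear preprocessing is absorbed because `k ≥ 3` gives
`n ≤ n ^ (k - 2)`. -/

namespace MultiRobot

/-! ### Sides of the edges of a tree -/

section Tree

variable {V : Type*} [Fintype V] {G : SimpleGraph V}

/-- The number of vertices that are closer to `j` than to `i`. For an edge `{i, j}` of a tree, this
is the size of the component of `j` after the removal of the edge. -/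
noncomputable def sideCard (G : SimpleGraph V) (i j : V) : ℕ :=
  (Finset.univ.filter fun v => G.dist v j < G.dist v i).card

-- Prolonging a geodesic from such a neighbour to `v` by the edge at `i` gives a geodesic from `i`
-- to `v`, and a tree has only one path between two vertices.
omit [Fintype V] in
theorem existsUnique_adj_dist_lt (hG : G.IsTree) {v i : V} (h : v ≠ i) :
    ∃! j, G.Adj i j ∧ G.dist v j < G.dist v i := by
  obtain ⟨p, hp, hl⟩ := hG.connected.exists_path_of_dist i v
  have hnil : ¬ p.Nil := SimpleGraph.Walk.not_nil_of_ne h.symm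
  have hlt : ∀ j, G.Adj i j → G.dist v j < G.dist v i → p.snd = j := by
    intro j hij hj
    obtain ⟨q, hq, hql⟩ := hG.connected.exists_path_of_dist j v
    have hw : (SimpleGraph.Walk.cons hij q).length = G.dist i v := by
      rw [SimpleGraph.Walk.length_cons, hql]
      have := hG.connected.dist_triangle (u := i) (v := j) (w := v)
      rw [SimpleGraph.dist_eq_one_iff_adj.2 hij] at this
      rw [SimpleGraph.dist_comm (u := v), SimpleGraph.dist_comm (u := v)] at hj
      omega
    have hpath := SimpleGraph.Walk.isPath_of_length_eq_dist _ hw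
    have := (hG.isAcyclic.subsingleton_path i v).elim ⟨p, hp⟩ ⟨_, hpath⟩
    have h2 : p = SimpleGraph.Walk.cons hij q := congrArg Subtype.val this
    rw [h2]; simp
  refine ⟨p.snd, ⟨p.adj_snd hnil, ?_⟩, fun j hj => (hlt j hj.1 hj.2).symm⟩
  have h1 := SimpleGraph.dist_le p.tail
  have h2 := SimpleGraph.Walk.length_tail_add_one hnil
  rw [SimpleGraph.dist_comm (u := v), SimpleGraph.dist_comm (u := v)]
  omega

/-- In a tree no vertex is equidistant from two adjacent vertices, so every vertex lies on exactly
one side. -/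
theorem sideCard_add (hG : G.IsTree) {i j : V} (h : G.Adj i j) :
    sideCard G i j + sideCard G j i = Fintype.card V := by
  classical
  rw [sideCard, sideCard, ← Finset.card_univ,
    ← Finset.card_filter_add_card_filter_not (s := Finset.univ) (fun v => G.dist v j < G.dist v i)]
  congr 2
  ext v
  have := hG.dist_ne_of_adj v h
  simp
  omega

theorem sideCard_pos {i j : V} (h : G.Adj i j) : 0 < sideCard G i j := by
  refine Finset.card_pos.2 ⟨j, ?_⟩
  simp [SimpleGraph.dist_eq_one_iff_adj.2 h.symm]

theorem sideCard_lt (hG : G.IsTree) {i j : V} (h : G.Adj i j) :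
    sideCard G i j < Fintype.card V := by
  have := sideCard_add hG h
  have := sideCard_pos h.symm
  omega

/-- Every vertex other than `i` lies on the side of exactly one neighbour of `i`. -/
theorem sum_sideCard (hG : G.IsTree) (i : V) [DecidableRel G.Adj] :
    ∑ j ∈ G.neighborFinset i, sideCard G i j + 1 = Fintype.card V := by
  classical
  have h : (Finset.univ.erase i) =
      (G.neighborFinset i).biUnion
        fun j => Finset.univ.filter fun v => G.dist v j < G.dist v i := by
    ext v
    simp only [Finset.mem_erase, Finset.mem_univ, and_true, Finset.mem_biUnion,
      SimpleGraph.mem_neighborFinset, Finset.mem_filter, true_and]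
    refine ⟨fun h => (existsUnique_adj_dist_lt hG h).exists, ?_⟩
    rintro ⟨j, -, h⟩ rfl
    simp at h
  have h2 : (Finset.univ.erase i).card = ∑ j ∈ G.neighborFinset i, sideCard G i j := by
    rw [h, Finset.card_biUnion]
    · rfl
    · intro j hj j' hj' hne
      refine Finset.disjoint_left.2 fun v hv hv' => hne ?_
      rw [Finset.mem_coe, SimpleGraph.mem_neighborFinset] at hj hj'
      simp only [Finset.mem_filter, Finset.mem_univ, true_and] at hv hv'
      have hvi : v ≠ i := by rintro rfl; simp at hv
      exact (existsUnique_adj_dist_lt hG hvi).unique ⟨hj, hv⟩ ⟨hj', hv'⟩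
  rw [← h2, Finset.card_erase_of_mem (Finset.mem_univ i), Finset.card_univ]
  have : 0 < Fintype.card V := Fintype.card_pos_iff.2 ⟨i⟩
  omega

/-- On a tree, an antisymmetric function of the edges is a potential difference. -/
theorem exists_potential {A : Type*} [AddCommGroup A] (hG : G.IsTree) (w : V → V → A)
    (hw : ∀ i j, G.Adj i j → w j i = - w i j) :
    ∃ f : V → A, ∀ i j, G.Adj i j → f j = f i + w i j := by
  classical
  obtain ⟨r⟩ := hG.connected.nonempty
  choose! par hpar using fun (v : V) (h : v ≠ r) =>
    (existsUnique_adj_dist_lt hG (v := r) (i := v) h.symm).exists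
  -- The potential is summed up along the paths from the root `r`, one distance level at a time; at
  -- the largest distance from `r` it is correct everywhere.
  have key : ∀ d : ℕ, ∃ f : V → A, ∀ v, G.dist r v ≤ d → v ≠ r → f v = f (par v) + w (par v) v := by
    intro d
    induction d with
    | zero =>
      refine ⟨fun _ => 0, fun v hv hr => absurd ?_ hr⟩
      exact (hG.connected.dist_eq_zero_iff.1 (Nat.le_zero.1 hv)).symm
    | succ d ih =>
      obtain ⟨f, hf⟩ := ih
      refine ⟨fun v => if G.dist r v ≤ d then f v else f (par v) + w (par v) v, fun v hv hr => ?_⟩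
      have h1 := (hpar v hr).2
      have h2 : G.dist r (par v) ≤ d := by omega
      simp only [h2, if_true]
      split_ifs with h3
      · exact hf v h3 hr
      · rfl
  obtain ⟨f, hf⟩ := key (Finset.univ.sup fun v => G.dist r v)
  have hf' : ∀ v, v ≠ r → f v = f (par v) + w (par v) v := fun v hv =>
    hf v (Finset.le_sup (f := fun v => G.dist r v) (Finset.mem_univ v)) hv
  have main : ∀ i j, G.Adj i j → G.dist r i < G.dist r j → f j = f i + w i j := by
    intro i j hij hlt
    have hj : j ≠ r := by rintro rfl; simp at hlt
    have : par j = i := (existsUnique_adj_dist_lt hG hj.symm).unique (hpar j hj) ⟨hij.symm, hlt⟩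
    rw [← this]
    exact hf' j hj
  refine ⟨f, fun i j hij => ?_⟩
  rcases lt_or_gt_of_ne (hG.dist_ne_of_adj r hij) with h | h
  · exact main i j hij h
  · rw [main j i hij.symm h, hw i j hij]; abel

/-- In a set of vertices with an edge inside, some vertex has exactly one neighbour in the set. -/
theorem exists_unique_neighbor (hG : G.IsTree) (U : Set V) {a b : V} (ha : a ∈ U) (hb : b ∈ U)
    (hab : G.Adj a b) : ∃ v ∈ U, ∃! w, w ∈ U ∧ G.Adj v w := by
  classical
  -- Take a vertex farthest from `a` among those with a neighbour in `U`. All its neighbours in `U`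
  -- are closer to `a`, and only one neighbour can be.
  obtain ⟨v, hv, hmax⟩ := (Finset.univ.filter fun v => v ∈ U ∧ ∃ w ∈ U, G.Adj v w).exists_max_image
    (fun v => G.dist a v) ⟨a, by simp [ha]; exact ⟨b, hb, hab⟩⟩
  simp only [Finset.mem_filter, Finset.mem_univ, true_and, and_imp, forall_exists_index] at hv hmax
  obtain ⟨hvU, w, hwU, hvw⟩ := hv
  have hcl : ∀ w ∈ U, G.Adj v w → G.dist a w < G.dist a v := fun w hw h =>
    lt_of_le_of_ne (hmax w hw v hvU h.symm) (hG.dist_ne_of_adj a h).symm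
  have hne : a ≠ v := by
    rintro rfl
    have := hcl w hwU hvw
    simp at this
  exact ⟨v, hvU, w, ⟨hwU, hvw⟩, fun w' h =>
    (existsUnique_adj_dist_lt hG hne).unique ⟨h.2, hcl w' h.1 h.2⟩ ⟨hvw, hcl w hwU hvw⟩⟩

end Tree

/-! ### Link times -/

namespace SCS

variable {n : ℕ} (S : SCS n)

/-- Circles of equal radius cannot be nested: if the centres are at distance at most `2`, a point
above the midpoint of the centres, at height `√(1 - w²)` for half distance `w`, lies on both
circles. -/
theorem two_lt_dist {i j : Fin n} (h : i ≠ j) : 2 < dist (S.center i) (S.center j) := by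
  by_contra hle
  rw [not_lt] at hle
  have hd := S.circles_disjoint i j h
  set a := S.center i
  set b := S.center j
  -- If the centres coincide, any direction `u` serves, with `w = 0`.
  obtain ⟨u, hu, w, hw⟩ : ∃ u : ℂ, ‖u‖ = 1 ∧ ∃ w : ℝ, b - a = (2 * w : ℝ) * u := by
    by_cases hab : b - a = 0
    · exact ⟨1, by simp, 0, by simp [hab]⟩
    · refine ⟨(b - a) / (‖b - a‖ : ℝ), by simp [hab], ‖b - a‖ / 2, ?_⟩
      have : ((‖b - a‖ : ℝ) : ℂ) ≠ 0 := by simpa using hab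
      rw [mul_div_cancel₀ _ (two_ne_zero' ℝ)]
      field_simp
  have hw1 : w ^ 2 ≤ 1 := by
    have h1 : ‖b - a‖ = 2 * |w| := by rw [hw]; simp [hu]
    rw [dist_comm, dist_eq_norm, h1] at hle
    rw [← sq_abs]
    nlinarith [abs_nonneg w]
  have hs : Real.sqrt (1 - w ^ 2) ^ 2 = 1 - w ^ 2 := Real.sq_sqrt (by linarith)
  set s := Real.sqrt (1 - w ^ 2)
  have hn : ∀ e : ℝ, e ^ 2 = w ^ 2 → ‖(⟨e, s⟩ : ℂ)‖ = 1 := by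
    intro e he
    rw [Complex.norm_eq_sqrt_sq_add_sq, he, hs]
    simp
  have hd' : ∀ p, p ∈ Metric.sphere a 1 → p ∉ Metric.sphere b 1 := fun p hp =>
    Set.disjoint_left.1 hd hp
  refine hd' (a + u * ⟨w, s⟩) ?_ ?_
  · simp [hn w rfl, hu]
  · have hb : b = a + (2 * w : ℝ) * u := by rw [← hw]; ring
    have : a + u * ⟨w, s⟩ - b = u * ⟨-w, s⟩ := by
      have h2 : (⟨w, s⟩ : ℂ) = ⟨-w, s⟩ + (2 * w : ℝ) := by
        apply Complex.ext <;> simp; ring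
      rw [hb, h2]; ring
    rw [mem_sphere_iff_norm, this, norm_mul, hu, hn (-w) (by ring), one_mul]

/-- Distinct neighbours of a circle have distinct link positions. -/
theorem linkAngle_injective {i j k : Fin n} (hj : S.graph.Adj i j) (hk : S.graph.Adj i k)
    (h : (linkAngle S.center i j : Real.Angle) = (linkAngle S.center i k : Real.Angle)) :
    j = k := by
  by_contra hne
  rw [linkAngle, linkAngle, Complex.arg_coe_angle_eq_iff] at h
  -- Both neighbours would have their centres on one ray from the centre of circle `i`, at distances
  -- between `2` and `5/2`, hence much closer to each other than disjointness permits.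
  have bound : ∀ l, S.graph.Adj i l →
      2 < ‖S.center l - S.center i‖ ∧ ‖S.center l - S.center i‖ < 5 / 2 := by
    intro l hl
    have h1 := S.two_lt_dist hl.ne'
    have h2 := (S.graph_le hl).2
    rw [dist_comm] at h2
    rw [dist_eq_norm] at h1 h2
    exact ⟨h1, by linarith [S.range_lt]⟩
  have hbj := bound j hj
  have hbk := bound k hk
  have hjk := S.two_lt_dist hne
  have e : S.center j - S.center k =
      ((‖S.center j - S.center i‖ - ‖S.center k - S.center i‖ : ℝ) : ℂ) *
        Complex.exp (Complex.arg (S.center j - S.center i) * Complex.I) := by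
    have e1 := Complex.norm_mul_exp_arg_mul_I (S.center j - S.center i)
    have e2 := Complex.norm_mul_exp_arg_mul_I (S.center k - S.center i)
    rw [← h] at e2
    push_cast
    rw [sub_mul, e1, e2]
    ring
  rw [dist_eq_norm, e, norm_mul, Complex.norm_exp_ofReal_mul_I, mul_one, Complex.norm_real,
    Real.norm_eq_abs, lt_abs] at hjk
  rcases hjk with h | h <;> linarith

theorem dir_mul_self (i : Fin n) :
    ((S.schedule.dir i : ℤ) : ℝ) * ((S.schedule.dir i : ℤ) : ℝ) = 1 := by
  rcases Int.units_eq_one_or (S.schedule.dir i) with h | h <;> simp [h]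

/-- The time in `[0, 1)` at which circle `i` is at the link position with respect to `j`. -/
noncomputable def linkTime (i j : Fin n) : ℝ :=
  Int.fract (((S.schedule.dir i : ℤ) : ℝ) *
    (linkAngle S.center i j - S.schedule.start i) / (2 * π))

theorem linkTime_nonneg (i j : Fin n) : 0 ≤ S.linkTime i j := Int.fract_nonneg _

theorem linkTime_lt_one (i j : Fin n) : S.linkTime i j < 1 := Int.fract_lt_one _

/-- A circle is covered in unit time, so the times at a given link form a coset of `ℤ`. -/
theorem atLink_iff {i j : Fin n} {t : ℝ} :
    S.AtLink i j t ↔ ∃ q : ℤ, t = S.linkTime i j + q := by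
  have hpi : (2 * π) ≠ 0 := by positivity
  have hgg := S.dir_mul_self i
  have hg2 : (S.schedule.dir i : ℤ) * (S.schedule.dir i : ℤ) = 1 := by exact_mod_cast hgg
  rw [AtLink, Schedule.position, Real.Angle.angle_eq_iff_two_pi_dvd_sub, linkTime, Int.fract]
  set g : ℤ := (S.schedule.dir i : ℤ)
  set a := S.schedule.start i
  set b := linkAngle S.center i j
  set f := ⌊(g : ℝ) * (b - a) / (2 * π)⌋
  constructor
  · rintro ⟨k, hk⟩
    refine ⟨g * k + f, ?_⟩
    push_cast
    have : 2 * π * (g * (g * t)) = 2 * π * (g * k) + g * (b - a) := by linear_combination g * hk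
    rw [← mul_assoc (g : ℝ), hgg, one_mul] at this
    field_simp
    linear_combination this
  · rintro ⟨q, hq⟩
    refine ⟨g * (q - f), ?_⟩
    push_cast
    rw [hq]
    field_simp
    linear_combination (b - a) * hgg

theorem atLink_symm {i j : Fin n} (h : S.graph.Adj i j) {t : ℝ} :
    S.AtLink i j t ↔ S.AtLink j i t :=
  S.synchronized i j h t

/-- This makes the simultaneous passages at any moment a matching of circles, so each one is an
exchange between just two circles. -/
theorem eq_of_atLink {i j k : Fin n} (hj : S.graph.Adj i j) (hk : S.graph.Adj i k) {t : ℝ}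
    (h1 : S.AtLink i j t) (h2 : S.AtLink i k t) : j = k :=
  S.linkAngle_injective hj hk (h1.symm.trans h2)

theorem atLink_linkTime (i j : Fin n) : S.AtLink i j (S.linkTime i j) :=
  S.atLink_iff.2 ⟨0, by simp⟩

theorem atLink_linkTime_add (i j : Fin n) (q : ℤ) : S.AtLink i j (S.linkTime i j + q) :=
  S.atLink_iff.2 ⟨q, rfl⟩

theorem linkTime_symm {i j : Fin n} (h : S.graph.Adj i j) : S.linkTime i j = S.linkTime j i := by
  obtain ⟨q, hq⟩ := S.atLink_iff.1 ((S.atLink_symm h).1 (S.atLink_linkTime i j))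
  have h1 := S.linkTime_nonneg i j
  have h2 := S.linkTime_nonneg j i
  have h3 := S.linkTime_lt_one i j
  have h4 := S.linkTime_lt_one j i
  have h5 : (q : ℝ) < 1 := by linarith
  have h6 : (-1 : ℝ) < q := by linarith
  have : q = 0 := by
    have : q < 1 := by exact_mod_cast h5
    have : -1 < q := by exact_mod_cast h6
    omega
  simpa [this] using hq

/-! ### Token labels -/

open Classical in
/-- The sum, modulo `n`, of the jumps of the label of circle `i` in `[0, t)`. -/
noncomputable def labelJump (i : Fin n) (t : ℝ) : ZMod n :=
  -- For `t ≥ 0` the ceiling counts the passages in `[0, t)`. A passage at time `t` itself is not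
  -- counted, in agreement with `config`, which describes the arrival at time `t`.
  ∑ j ∈ S.graph.neighborFinset i, (sideCard S.graph i j : ZMod n) * (⌈t - S.linkTime i j⌉ : ℤ)

/-- The starting labels are to make the two labels at the first passage of a link differ by
`sideCard S.graph i j`. This requirement is antisymmetric modulo `n` because the two sides of an
edge add up to `n`. -/
theorem exists_labelStart (hG : S.graph.IsTree) : ∃ f : Fin n → ZMod n, ∀ i j, S.graph.Adj i j →
    f j = f i + (sideCard S.graph i j + S.labelJump i (S.linkTime i j)
      - S.labelJump j (S.linkTime i j)) := by
  refine exists_potential hG _ fun i j h => ?_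
  have := congrArg (Nat.cast (R := ZMod n)) (sideCard_add hG h)
  rw [Nat.cast_add, Fintype.card_fin, ZMod.natCast_self] at this
  rw [S.linkTime_symm h]
  linear_combination this

/-- The label in `ZMod n` of the token that is in circle `i` on arrival at time `t`. Tokens always
shift to the neighbouring circle at link positions. -/
noncomputable def label (hG : S.graph.IsTree) (i : Fin n) (t : ℝ) : ZMod n :=
  (S.exists_labelStart hG).choose i + S.labelJump i t

/-- Each link of circle `i` contributes its side once per period, and the sides at `i` add up to `n
- 1`. -/
theorem labelJump_add_int (hG : S.graph.IsTree) (i : Fin n) (t : ℝ) (q : ℤ) :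
    S.labelJump i (t + q) = S.labelJump i t - q := by
  classical
  have h := congrArg (Nat.cast (R := ZMod n)) (sum_sideCard hG i)
  rw [Nat.cast_add, Fintype.card_fin, ZMod.natCast_self, Nat.cast_sum] at h
  have e : ∀ j, (⌈t + q - S.linkTime i j⌉ : ℤ) = ⌈t - S.linkTime i j⌉ + q := by
    intro j
    rw [← Int.ceil_add_intCast]
    congr 1; ring
  simp only [labelJump, e, Int.cast_add, mul_add, Finset.sum_add_distrib]
  rw [← Finset.sum_mul]
  have h2 : ∑ j ∈ S.graph.neighborFinset i, (sideCard S.graph i j : ZMod n) = -1 := by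
    push_cast at h
    rw [eq_neg_iff_add_eq_zero]
    convert h
  have h3 : (∑ j ∈ S.graph.neighborFinset i, (sideCard S.graph i j : ZMod n)) * (q : ZMod n)
      = - (q : ZMod n) := by rw [h2]; ring
  linear_combination h3

variable (hG : S.graph.IsTree)

theorem label_add_int (i : Fin n) (t : ℝ) (q : ℤ) :
    S.label hG i (t + q) = S.label hG i t - q := by
  rw [label, S.labelJump_add_int hG, label]; ring

/-- The tokens that meet at a link differ by the size of a side of the link. -/
theorem label_of_atLink {i j : Fin n} (h : S.graph.Adj i j) {t : ℝ} (ht : S.AtLink i j t) :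
    S.label hG j t = S.label hG i t + sideCard S.graph i j := by
  obtain ⟨q, rfl⟩ := S.atLink_iff.1 ht
  rw [label_add_int, label_add_int, label, label, (S.exists_labelStart hG).choose_spec i j h]
  ring

theorem ceil_sub_linkTime_of_atLink {i j : Fin n} {s t : ℝ} (hst : s < t)
    (hs : S.AtLink i j s) (hno : ∀ r, s < r → r < t → ¬ S.AtLink i j r) :
    ⌈t - S.linkTime i j⌉ = ⌈s - S.linkTime i j⌉ + 1 := by
  obtain ⟨q, rfl⟩ := S.atLink_iff.1 hs
  have h1 := hno (S.linkTime i j + (q + 1 : ℤ)) (by push_cast; linarith)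
  have h2 : t ≤ S.linkTime i j + (q + 1 : ℤ) := by
    by_contra hlt
    exact h1 (not_le.1 hlt) (S.atLink_linkTime_add i j _)
  rw [add_sub_cancel_left, Int.ceil_intCast, Int.ceil_eq_iff]
  push_cast at *
  constructor <;> linarith

theorem ceil_sub_linkTime_of_not_atLink {i j : Fin n} {s t : ℝ} (hst : s ≤ t)
    (hno : ∀ r, s ≤ r → r < t → ¬ S.AtLink i j r) :
    ⌈t - S.linkTime i j⌉ = ⌈s - S.linkTime i j⌉ := by
  refine le_antisymm ?_ (Int.ceil_mono (by linarith))
  have h1 := Int.le_ceil (s - S.linkTime i j)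
  have h2 : t ≤ S.linkTime i j + ⌈s - S.linkTime i j⌉ := by
    by_contra hlt
    exact hno _ (by linarith) (not_le.1 hlt) (S.atLink_linkTime_add i j _)
  exact Int.ceil_le.2 (by linarith)

/-- Labels are constant while no link position is passed. -/
theorem label_eq_of_not_atLink {i : Fin n} {s t : ℝ} (hst : s ≤ t)
    (hno : ∀ j, S.graph.Adj i j → ∀ r, s ≤ r → r < t → ¬ S.AtLink i j r) :
    S.label hG i t = S.label hG i s := by
  classical
  rw [label, label]
  congr 1
  refine Finset.sum_congr rfl fun j hj => ?_
  rw [S.ceil_sub_linkTime_of_not_atLink hst (hno j (by simpa using hj))]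

/-- Tokens shift at link positions. -/
theorem label_eq_of_atLink {i k : Fin n} {s t : ℝ} (hst : s < t) (hk : S.graph.Adj i k)
    (hs : S.AtLink i k s)
    (hno : ∀ j, S.graph.Adj i j → ∀ r, s < r → r < t → ¬ S.AtLink i j r) :
    S.label hG i t = S.label hG k s := by
  classical
  rw [S.label_of_atLink hG hk hs, label, label, labelJump, labelJump, add_assoc]
  congr 1
  rw [← Finset.add_sum_erase _ _ (show k ∈ S.graph.neighborFinset i by simpa using hk),
    ← Finset.add_sum_erase (S.graph.neighborFinset i) _
      (show k ∈ S.graph.neighborFinset i by simpa using hk),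
    S.ceil_sub_linkTime_of_atLink hst hs (hno k hk)]
  have : ∀ j ∈ (S.graph.neighborFinset i).erase k,
      (sideCard S.graph i j : ZMod n) * (⌈t - S.linkTime i j⌉ : ℤ) =
        (sideCard S.graph i j : ZMod n) * (⌈s - S.linkTime i j⌉ : ℤ) := by
    intro j hj
    rw [Finset.mem_erase, SimpleGraph.mem_neighborFinset] at hj
    rw [S.ceil_sub_linkTime_of_not_atLink hst.le]
    intro r hr hrt hat
    rcases hr.eq_or_lt with rfl | hr
    · exact hj.1 (S.eq_of_atLink hj.2 hk hat hs)
    · exact hno j hj.2 r hr hrt hat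
  rw [Finset.sum_congr rfl this]
  push_cast
  ring

/-! ### Induction over the link times -/

/-- `s` is a time at which some link is passed. -/
def IsLinkTime (s : ℝ) : Prop := ∃ i j, S.graph.Adj i j ∧ S.AtLink i j s

theorem linkTimes_eq_insert {s t : ℝ} (h0 : 0 ≤ s) (hst : s < t) (hs : S.IsLinkTime s)
    (hno : ∀ r, s < r → r < t → ¬ S.IsLinkTime r) :
    S.linkTimes t = insert s (S.linkTimes s) := by
  ext r
  simp only [linkTimes, Set.mem_ofPred_eq, Set.mem_insert_iff]
  constructor
  · rintro ⟨h1, h2, h3⟩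
    rcases lt_trichotomy r s with h | h | h
    · exact Or.inr ⟨h1, h, h3⟩
    · exact Or.inl h
    · exact absurd h3 (hno r h h2)
  · rintro (rfl | ⟨h1, h2, h3⟩)
    · exact ⟨h0, hst, hs⟩
    · exact ⟨h1, h2.trans hst, h3⟩

/-- Only finitely many link times precede `t`, so induction on their number is possible, with `s`
the last of them. This replaces continuous time by a sequence of simultaneous exchanges. -/
theorem linkTime_induction {P : ℝ → Prop}
    (base : ∀ t, 0 ≤ t → (∀ r, 0 ≤ r → r < t → ¬ S.IsLinkTime r) → P t)
    (step : ∀ s t, 0 ≤ s → s < t → S.IsLinkTime s →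
      (∀ r, s < r → r < t → ¬ S.IsLinkTime r) → P s → P t) :
    ∀ t, 0 ≤ t → P t := by
  have key : ∀ m : ℕ, ∀ t, 0 ≤ t → (S.linkTimes t).ncard = m → P t := by
    intro m
    induction m using Nat.strong_induction_on with
    | _ m ih =>
      intro t ht hm
      by_cases hne : (S.linkTimes t).Nonempty
      · obtain ⟨s, hs, hmax⟩ := Set.exists_max_image _ id (S.linkTimes_finite t) hne
        have hno : ∀ r, s < r → r < t → ¬ S.IsLinkTime r := fun r hr hrt hl =>
          absurd (hmax r ⟨hs.1.trans hr.le, hrt, hl⟩) (not_le.2 hr)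
        refine step s t hs.1 hs.2.1 hs.2.2 hno (ih _ ?_ s hs.1 rfl)
        rw [← hm, S.linkTimes_eq_insert hs.1 hs.2.1 hs.2.2 hno]
        exact Set.ncard_lt_ncard
          (Set.ssubset_insert fun h => lt_irrefl s h.2.1) ((S.linkTimes_finite s).insert s)
      · exact base t ht fun r h0 hr hl => hne ⟨r, h0, hr, hl⟩
  exact fun t ht => key _ t ht rfl

theorem config_of_no_linkTime (A : Finset (Fin n)) {t : ℝ}
    (hno : ∀ r, 0 ≤ r → r < t → ¬ S.IsLinkTime r) : S.config A t = fun u : A => (u : Fin n) := by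
  have : S.linkTimes t = ∅ :=
    Set.eq_empty_of_forall_notMem fun r hr => hno r hr.1 hr.2.1 hr.2.2
  simp [config, this]

theorem config_of_isLinkTime (A : Finset (Fin n)) {s t : ℝ} (h0 : 0 ≤ s) (hst : s < t)
    (hs : S.IsLinkTime s) (hno : ∀ r, s < r → r < t → ¬ S.IsLinkTime r) :
    S.config A t = S.shift (S.config A s) s := by
  have h : ((S.linkTimes_finite t).toFinset).sort (· ≤ ·) =
      ((S.linkTimes_finite s).toFinset).sort (· ≤ ·) ++ [s] := by
    refine List.Perm.eq_of_pairwise' (r := (· ≤ ·)) (Finset.pairwise_sort _ _) ?_ ?_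
    · refine List.pairwise_append.2 ⟨Finset.pairwise_sort _ _, List.pairwise_singleton _ _, ?_⟩
      intro a ha b hb
      rw [Finset.mem_sort, Set.Finite.mem_toFinset] at ha
      rw [List.mem_singleton] at hb
      exact hb ▸ ha.2.1.le
    · refine (List.perm_ext_iff_of_nodup (Finset.sort_nodup _ _) ?_).2 ?_
      · refine List.nodup_append.2 ⟨Finset.sort_nodup _ _, List.nodup_singleton _, ?_⟩
        intro a ha b hb
        rw [Finset.mem_sort, Set.Finite.mem_toFinset] at ha
        rw [List.mem_singleton] at hb
        exact hb ▸ ha.2.1.ne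
      · intro r
        rw [List.mem_append, Finset.mem_sort, Finset.mem_sort, Set.Finite.mem_toFinset,
          Set.Finite.mem_toFinset, S.linkTimes_eq_insert h0 hst hs hno, List.mem_singleton,
          Set.mem_insert_iff, or_comm]
  rw [config, h, List.foldl_append]
  rfl

/-! ### Labels are distinct -/

/-- At a link time the circles at a common link exchange their labels, and the other labels stay. -/
theorem range_label (t : ℝ) (ht : 0 ≤ t) :
    Set.range (fun i => S.label hG i t) = Set.range (fun i => S.label hG i 0) := by
  refine S.linkTime_induction (P := fun t => Set.range (fun i => S.label hG i t) =
    Set.range (fun i => S.label hG i 0)) ?_ ?_ t ht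
  · intro t ht hno
    congr 1
    funext i
    exact S.label_eq_of_not_atLink hG ht fun j hj r h1 h2 h3 => hno r h1 h2 ⟨i, j, hj, h3⟩
  · intro s t _ hst _ hno ih
    rw [← ih]
    have hno' : ∀ i j, S.graph.Adj i j → ∀ r, s < r → r < t → ¬ S.AtLink i j r :=
      fun i j hj r h1 h2 h3 => hno r h1 h2 ⟨i, j, hj, h3⟩
    have hstay : ∀ i, (¬ ∃ k, S.graph.Adj i k ∧ S.AtLink i k s) →
        S.label hG i t = S.label hG i s := by
      intro i h
      refine S.label_eq_of_not_atLink hG hst.le fun j hj r h1 h2 h3 => ?_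
      rcases h1.eq_or_lt with rfl | h1
      · exact h ⟨j, hj, h3⟩
      · exact hno' i j hj r h1 h2 h3
    apply Set.Subset.antisymm
    · rintro _ ⟨i, rfl⟩
      by_cases h : ∃ k, S.graph.Adj i k ∧ S.AtLink i k s
      · obtain ⟨k, hk, hks⟩ := h
        exact ⟨k, (S.label_eq_of_atLink hG hst hk hks (hno' i)).symm⟩
      · exact ⟨i, (hstay i h).symm⟩
    · rintro _ ⟨i, rfl⟩
      by_cases h : ∃ k, S.graph.Adj i k ∧ S.AtLink i k s
      · obtain ⟨k, hk, hks⟩ := h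
        exact ⟨k, S.label_eq_of_atLink hG hst hk.symm ((S.atLink_symm hk).1 hks) (hno' k)⟩
      · exact ⟨i, hstay i h⟩

/-- One period preserves the set of labels but also lowers each label by one. A nonempty subset of
`ZMod n` that is closed under subtracting `1` is everything; so there is only one ring. -/
theorem label_surjective_zero : Function.Surjective fun i => S.label hG i 0 := by
  obtain ⟨i₀⟩ := hG.connected.nonempty
  have : NeZero n := ⟨by have := i₀.2; omega⟩
  have hsub : ∀ x ∈ Set.range (fun i => S.label hG i 0),
      x - 1 ∈ Set.range (fun i => S.label hG i 0) := by
    rintro _ ⟨i, rfl⟩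
    rw [← S.range_label hG 1 zero_le_one]
    refine ⟨i, ?_⟩
    have := S.label_add_int hG i 0 1
    simpa using this
  have hq : ∀ q : ℕ, S.label hG i₀ 0 - q ∈ Set.range (fun i => S.label hG i 0) := by
    intro q
    induction q with
    | zero => exact ⟨i₀, by simp⟩
    | succ q ih =>
      have := hsub _ ih
      push_cast
      rwa [← sub_sub]
  intro x
  have := hq (S.label hG i₀ 0 - x).val
  rwa [ZMod.natCast_zmod_val, sub_sub_cancel] at this

theorem label_bijective (t : ℝ) : Function.Bijective fun i => S.label hG i t := by
  obtain ⟨i₀⟩ := hG.connected.nonempty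
  have : NeZero n := ⟨by have := i₀.2; omega⟩
  rw [Fintype.bijective_iff_surjective_and_card]
  refine ⟨fun x => ?_, by simp [ZMod.card]⟩
  -- The preservation of the labels is known for nonnegative times; whole periods only translate the
  -- labels.
  have h1 := S.range_label hG (Int.fract t) (Int.fract_nonneg t)
  have h2 : x + (⌊t⌋ : ℤ) ∈ Set.range fun i => S.label hG i 0 := S.label_surjective_zero hG _
  rw [← h1] at h2
  obtain ⟨i, hi⟩ := h2
  refine ⟨i, ?_⟩
  have h3 := S.label_add_int hG i (Int.fract t) ⌊t⌋
  rw [Int.fract_add_floor] at h3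
  have h4 : S.label hG i (Int.fract t) = x + (⌊t⌋ : ℤ) := hi
  simp only
  rw [h3, h4]
  ring

end SCS

namespace SCS

/-! ### Starvation in terms of labels -/

variable {n : ℕ} (S : SCS n) (hG : S.graph.IsTree)

section Shift

variable {A : Finset (Fin n)} {c : A → Fin n} {t : ℝ}

/-- By synchronization, a robot in the neighbouring circle is automatically at the link. -/
theorem robotAt_iff {i j : Fin n} (h : S.graph.Adj i j) (ht : S.AtLink i j t) :
    S.RobotAt c t j i ↔ ∃ v, c v = j :=
  ⟨fun ⟨v, hv, _⟩ => ⟨v, hv⟩, fun ⟨v, hv⟩ => ⟨v, hv, (S.atLink_symm h).1 ht⟩⟩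

theorem shift_of_free {u : A} {j : Fin n} (h : S.graph.Adj (c u) j) (ht : S.AtLink (c u) j t)
    (hfree : ¬ ∃ v, c v = j) : S.shift c t u = j := by
  have hex : ∃ j, S.graph.Adj (c u) j ∧ S.AtLink (c u) j t ∧ ¬ S.RobotAt c t j (c u) :=
    ⟨j, h, ht, fun hr => hfree ((S.robotAt_iff h ht).1 hr)⟩
  rw [shift, dif_pos hex]
  exact S.eq_of_atLink hex.choose_spec.1 h hex.choose_spec.2.1 ht

theorem shift_of_occupied {u v : A} (h : S.graph.Adj (c u) (c v))
    (ht : S.AtLink (c u) (c v) t) : S.shift c t u = c u := by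
  rw [shift, dif_neg]
  rintro ⟨k, hk, hkt, hr⟩
  obtain rfl := S.eq_of_atLink hk h hkt ht
  exact hr ((S.robotAt_iff h ht).2 ⟨v, rfl⟩)

theorem shift_of_idle {u : A} (h : ¬ ∃ j, S.graph.Adj (c u) j ∧ S.AtLink (c u) j t) :
    S.shift c t u = c u := by
  rw [shift, dif_neg]
  rintro ⟨k, hk, hkt, -⟩
  exact h ⟨k, hk, hkt⟩

variable {s : ℝ}

theorem label_of_idle (hst : s < t) (hno : ∀ r, s < r → r < t → ¬ S.IsLinkTime r) {i : Fin n}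
    (h : ¬ ∃ k, S.graph.Adj i k ∧ S.AtLink i k s) : S.label hG i t = S.label hG i s := by
  refine S.label_eq_of_not_atLink hG hst.le fun j hj r h1 h2 h3 => ?_
  rcases h1.eq_or_lt with rfl | h1
  · exact h ⟨j, hj, h3⟩
  · exact hno r h1 h2 ⟨i, j, hj, h3⟩

theorem label_of_passage (hst : s < t) (hno : ∀ r, s < r → r < t → ¬ S.IsLinkTime r) {i j : Fin n}
    (h : S.graph.Adj i j) (hs : S.AtLink i j s) : S.label hG i t = S.label hG j s :=
  S.label_eq_of_atLink hG hst h hs fun j hj r h1 h2 h3 => hno r h1 h2 ⟨i, j, hj, h3⟩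

end Shift

/-- The labels of the tokens that are held by surviving robots do not change. -/
theorem range_label_config (A : Finset (Fin n)) (t : ℝ) (ht : 0 ≤ t) :
    Set.range (fun u : A => S.label hG (S.config A t u) t) =
      Set.range (fun u : A => S.label hG u 0) := by
  refine S.linkTime_induction (P := fun t => Set.range (fun u : A => S.label hG (S.config A t u) t)
    = Set.range (fun u : A => S.label hG u 0)) ?_ ?_ t ht
  · intro t ht hno
    rw [S.config_of_no_linkTime A hno]
    congr 1
    funext i
    exact S.label_eq_of_not_atLink hG ht fun j hj r h1 h2 h3 => hno r h1 h2 ⟨i, j, hj, h3⟩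
  · intro s t h0 hst hs hno ih
    rw [← ih, S.config_of_isLinkTime A h0 hst hs hno]
    set c := S.config A s
    -- Two robots that meet stay in their circles while the tokens shift, so they exchange tokens. A
    -- robot facing a gap shifts together with its token.
    have key : ∀ u : A, (∃ v, S.label hG (S.shift c s u) t = S.label hG (c v) s) ∧
        ∃ v, S.label hG (S.shift c s v) t = S.label hG (c u) s := by
      intro u
      by_cases h : ∃ j, S.graph.Adj (c u) j ∧ S.AtLink (c u) j s
      · obtain ⟨j, hj, hjs⟩ := h
        have hjs' := (S.atLink_symm hj).1 hjs
        by_cases hv : ∃ v, c v = j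
        · obtain ⟨v, rfl⟩ := hv
          refine ⟨⟨v, ?_⟩, v, ?_⟩
          · rw [S.shift_of_occupied hj hjs]
            exact S.label_of_passage hG hst hno hj hjs
          · rw [S.shift_of_occupied hj.symm hjs']
            exact S.label_of_passage hG hst hno hj.symm hjs'
        · have : S.label hG (S.shift c s u) t = S.label hG (c u) s := by
            rw [S.shift_of_free hj hjs hv]
            exact S.label_of_passage hG hst hno hj.symm hjs'
          exact ⟨⟨u, this⟩, u, this⟩
      · have : S.label hG (S.shift c s u) t = S.label hG (c u) s := by
          rw [S.shift_of_idle h]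
          exact S.label_of_idle hG hst hno h
        exact ⟨⟨u, this⟩, u, this⟩
    apply Set.Subset.antisymm
    · rintro _ ⟨u, rfl⟩
      obtain ⟨v, hv⟩ := (key u).1
      exact ⟨v, hv.symm⟩
    · rintro _ ⟨u, rfl⟩
      exact (key u).2

/-- A robot that never meets a robot keeps its token. -/
theorem label_config_eq (A : Finset (Fin n)) (u : A)
    (hfree : ∀ t, 0 ≤ t → S.label hG (S.config A t u) t = S.label hG u 0 → ∀ j,
      S.graph.Adj (S.config A t u) j → S.AtLink (S.config A t u) j t →
      ¬ ∃ v, S.config A t v = j) (t : ℝ) (ht : 0 ≤ t) :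
    S.label hG (S.config A t u) t = S.label hG u 0 := by
  -- The absence of meetings is assumed only at times when `u` still holds its original token, which
  -- the induction hypothesis provides.
  refine S.linkTime_induction (P := fun t => S.label hG (S.config A t u) t = S.label hG u 0)
    ?_ ?_ t ht
  · intro t ht hno
    rw [S.config_of_no_linkTime A hno]
    exact S.label_eq_of_not_atLink hG ht fun j hj r h1 h2 h3 => hno r h1 h2 ⟨u, j, hj, h3⟩
  · intro s t h0 hst hs hno ih
    rw [S.config_of_isLinkTime A h0 hst hs hno, ← ih]
    by_cases h : ∃ j, S.graph.Adj (S.config A s u) j ∧ S.AtLink (S.config A s u) j s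
    · obtain ⟨j, hj, hjs⟩ := h
      rw [S.shift_of_free hj hjs (hfree s h0 ih j hj hjs)]
      exact S.label_of_passage hG hst hno hj.symm ((S.atLink_symm hj).1 hjs)
    · rw [S.shift_of_idle h]
      exact S.label_of_idle hG hst hno h

/-- A token meets every token that differs from it by a side size, since in the course of `n`
periods it is seen at every link. Occupied tokens remain occupied, even if the robot holding them
changes, so what matters is which tokens survive at time `0`. -/
theorem starves_iff (A : Finset (Fin n)) (u : A) : S.Starves A u ↔
    ∀ i j, S.graph.Adj i j → ∀ v ∈ A,
      S.label hG v 0 ≠ S.label hG u 0 + sideCard S.graph i j := by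
  obtain ⟨i₀⟩ := hG.connected.nonempty
  have : NeZero n := ⟨by have := i₀.2; omega⟩
  constructor
  · intro hst i j hij v hv hlab
    have hkeep := S.label_config_eq hG A u fun t ht _ j hj hjt hex =>
      hst t ht j hj hjt ((S.robotAt_iff hj hjt).2 hex)
    -- Waiting for `q` periods lowers the label at the link by `q`, down to the token of `u`.
    set q : ℕ := (S.label hG i (S.linkTime i j) - S.label hG u 0).val with hq
    set t : ℝ := S.linkTime i j + (q : ℤ) with ht
    have hat : S.AtLink i j t := S.atLink_linkTime_add i j q
    have h0 : 0 ≤ t := by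
      have := S.linkTime_nonneg i j
      rw [ht]; push_cast; positivity
    have hlabi : S.label hG i t = S.label hG u 0 := by
      rw [ht, S.label_add_int, hq]
      push_cast
      rw [ZMod.natCast_zmod_val]
      ring
    have hci : S.config A t u = i :=
      (S.label_bijective hG t).1 ((hkeep t h0).trans hlabi.symm)
    have hlabj : S.label hG j t = S.label hG v 0 := by
      rw [S.label_of_atLink hG hij hat, hlabi, hlab]
    -- The token of `v` may have passed to another robot `w`, but it is still occupied.
    have hmem : S.label hG v 0 ∈ Set.range (fun u : A => S.label hG (S.config A t u) t) := by
      rw [S.range_label_config hG A t h0]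
      exact ⟨⟨v, hv⟩, rfl⟩
    obtain ⟨w, hw⟩ := hmem
    have hcw : S.config A t w = j := (S.label_bijective hG t).1 (hw.trans hlabj.symm)
    have := hst t h0 j (hci ▸ hij) (hci ▸ hat)
    rw [hci] at this
    exact this ((S.robotAt_iff hij hat).2 ⟨w, hcw⟩)
  · intro h
    have hfree : ∀ t, 0 ≤ t → S.label hG (S.config A t u) t = S.label hG u 0 → ∀ j,
        S.graph.Adj (S.config A t u) j → S.AtLink (S.config A t u) j t →
        ¬ ∃ v, S.config A t v = j := by
      rintro t ht hlab j hj hjt ⟨v, hv⟩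
      have hmem : S.label hG j t ∈ Set.range (fun u : A => S.label hG u 0) := by
        rw [← S.range_label_config hG A t ht]
        exact ⟨v, by simp only [hv]⟩
      obtain ⟨w, hw⟩ := hmem
      refine h _ j hj w w.2 (hw.trans ?_)
      rw [S.label_of_atLink hG hj hjt, hlab]
    intro t ht j hj hjt hr
    exact hfree t ht (S.label_config_eq hG A u hfree t ht) j hj hjt ((S.robotAt_iff hj hjt).1 hr)

end SCS

/-! ### Resilience in terms of labels -/

open Classical in
/-- The sizes of the sides of the edges. -/
noncomputable def sideSet {V : Type*} [Fintype V] (G : SimpleGraph V) : Finset ℕ :=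
  (Finset.univ.filter fun p : V × V => G.Adj p.1 p.2).image fun p => sideCard G p.1 p.2

theorem mem_sideSet {V : Type*} [Fintype V] {G : SimpleGraph V} {l : ℕ} :
    l ∈ sideSet G ↔ ∃ i j, G.Adj i j ∧ sideCard G i j = l := by
  simp [sideSet]

/-- The set of tokens that meet a token of `K`, if tokens with difference in `L` meet. -/
def nbhd {n : ℕ} (L : Finset ℕ) (K : Finset (ZMod n)) : Finset (ZMod n) :=
  Finset.image₂ (fun x (l : ℕ) => x + (l : ZMod n)) K L

theorem mem_nbhd {n : ℕ} {L : Finset ℕ} {K : Finset (ZMod n)} {y : ZMod n} :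
    y ∈ nbhd L K ↔ ∃ x ∈ K, ∃ l ∈ L, x + (l : ZMod n) = y := by
  simp [nbhd, Finset.mem_image₂]

/-- To starve the holders of `K` it is necessary and sufficient to remove all holders of `nbhd L K`.
Disjointness expresses that the holders of `K` themselves survive. Among more than `k` starving
robots any `k` may be selected. -/
theorem SCS.resilience_eq {n : ℕ} (S : SCS n) (hG : S.graph.IsTree) (k : ℕ) :
    S.resilience k = sInf {m : ℕ∞ | ∃ K : Finset (ZMod n), K.card = k ∧
      Disjoint K (nbhd (sideSet S.graph) K) ∧ m = (nbhd (sideSet S.graph) K).card} := by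
  classical
  set L := sideSet S.graph
  have hbij := S.label_bijective hG 0
  have hst : ∀ (A : Finset (Fin n)) (u : A), S.Starves A u ↔ ∀ l ∈ L, ∀ v ∈ A,
      S.label hG v 0 ≠ S.label hG u 0 + l := by
    intro A u
    rw [S.starves_iff hG]
    simp only [L, mem_sideSet]
    constructor
    · rintro h l ⟨i, j, hij, rfl⟩
      exact h i j hij
    · intro h i j hij
      exact h _ ⟨i, j, hij, rfl⟩
  apply le_antisymm
  · refine le_sInf ?_
    rintro _ ⟨K, hK, hd, rfl⟩
    set R : Finset (Fin n) := Finset.univ.filter fun v => S.label hG v 0 ∈ nbhd L K with hR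
    have hRK : R.card = (nbhd L K).card := by
      refine Finset.card_nbij (fun v => S.label hG v 0) (fun v hv => by simpa [hR] using hv)
        hbij.1.injOn ?_
      intro y hy
      obtain ⟨v, hv⟩ := hbij.2 y
      refine ⟨v, ?_, hv⟩
      have hv' : S.label hG v 0 = y := hv
      simpa [hR, hv'] using hy
    refine sInf_le ⟨R, by rw [hRK], ?_⟩
    rw [← hK]
    have hinv : ∀ x ∈ K, ∃ u : (Rᶜ : Finset (Fin n)), S.label hG u 0 = x := by
      intro x hx
      obtain ⟨v, hv⟩ := hbij.2 x
      have hv' : S.label hG v 0 = x := hv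
      refine ⟨⟨v, ?_⟩, hv'⟩
      simp only [hR, Finset.mem_compl, Finset.mem_filter, Finset.mem_univ, true_and, hv']
      exact Finset.disjoint_left.1 hd hx
    rw [← Set.ncard_coe_finset K]
    have himg : (K : Set (ZMod n)) ⊆ (fun u : (Rᶜ : Finset (Fin n)) => S.label hG u 0) ''
        {u | S.Starves Rᶜ u} := by
      intro x hx
      obtain ⟨u, hu⟩ := hinv x hx
      refine ⟨u, ?_, hu⟩
      refine (hst _ u).2 fun l hl v hv he => ?_
      simp only [hR, Finset.mem_compl, Finset.mem_filter, Finset.mem_univ, true_and] at hv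
      exact hv (mem_nbhd.2 ⟨x, hx, l, hl, by rw [he, hu]⟩)
    exact (Set.ncard_le_ncard himg (Set.toFinite _)).trans (Set.ncard_image_le (Set.toFinite _))
  · refine le_sInf ?_
    rintro _ ⟨R, rfl, hk⟩
    set T : Set (ZMod n) := (fun u : (Rᶜ : Finset (Fin n)) => S.label hG u 0) ''
        {u | S.Starves Rᶜ u} with hT
    have hinj : Function.Injective fun u : (Rᶜ : Finset (Fin n)) => S.label hG u 0 :=
      fun u v h => Subtype.ext (hbij.1 h)
    rw [← Set.ncard_image_of_injective _ hinj] at hk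
    have hTf : T.Finite := (Set.toFinite _).image _
    rw [Set.ncard_eq_toFinset_card _ hTf] at hk
    obtain ⟨K, hKT, hK⟩ := Finset.exists_subset_card_eq hk
    have hKT' : ∀ x ∈ K, ∃ u : (Rᶜ : Finset (Fin n)), S.Starves Rᶜ u ∧ S.label hG u 0 = x :=
      fun x hx => hTf.mem_toFinset.1 (hKT hx)
    have hnb : ∀ y ∈ nbhd L K, ∃ v ∈ R, S.label hG v 0 = y := by
      intro y hy
      obtain ⟨x, hx, l, hl, rfl⟩ := mem_nbhd.1 hy
      obtain ⟨u, hu, rfl⟩ := hKT' x hx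
      obtain ⟨v, hv⟩ := hbij.2 (S.label hG u 0 + l)
      refine ⟨v, ?_, hv⟩
      by_contra hvR
      exact (hst _ u).1 hu l hl v (by simpa using hvR) hv
    have hle : ((nbhd L K).card : ℕ∞) ≤ R.card := by
      have : nbhd L K ⊆ R.image fun v => S.label hG v 0 := by
        intro y hy
        obtain ⟨v, hv, rfl⟩ := hnb y hy
        exact Finset.mem_image_of_mem _ hv
      exact_mod_cast (Finset.card_le_card this).trans Finset.card_image_le
    refine le_trans (sInf_le (Set.mem_ofPred_eq ▸ ⟨K, hK, ?_, rfl⟩)) hle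
    -- A common token would be held both by a survivor and by a removed robot.
    refine Finset.disjoint_left.2 fun x hx hxn => ?_
    obtain ⟨v, hv, hvx⟩ := hnb x hxn
    obtain ⟨u, -, hux⟩ := hKT' x hx
    have : (u : Fin n) = v := hbij.1 (hux.trans hvx.symm)
    exact (Finset.mem_compl.1 u.2) (this ▸ hv)

namespace SCS

/-! ### Tie lengths -/

variable {n : ℕ} (S : SCS n)

/-- The time that is needed to traverse an arc. -/
noncomputable def arcTime (i j k : Fin n) : ℝ :=
  toIocMod zero_lt_one 0 (S.linkTime j k - S.linkTime j i)

theorem arcTime_pos (i j k : Fin n) : 0 < S.arcTime i j k := left_lt_toIocMod _ _ _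

theorem arcTime_le_one (i j k : Fin n) : S.arcTime i j k ≤ 1 := by
  simpa [arcTime] using
    toIocMod_le_right (zero_lt_one (α := ℝ)) 0 (S.linkTime j k - S.linkTime j i)

theorem exists_arcTime_add (i j k : Fin n) :
    ∃ z : ℤ, S.linkTime j k - S.linkTime j i = S.arcTime i j k + z := by
  obtain ⟨z, hz⟩ := ((toIocMod_eq_iff (zero_lt_one (α := ℝ))
    (a := 0) (b := S.linkTime j k - S.linkTime j i)).1 rfl).2
  exact ⟨z, by simpa [arcTime] using hz⟩

/-- Multiplying by the direction turns differences of angles into `2π` times differences of times,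
modulo `2π`. Both sides use half-open intervals without `0`, so returning to the same link takes a
full turn. -/
theorem arcLength_eq (i j k : Fin n) : S.arcLength i j k = 2 * π * S.arcTime i j k := by
  rw [arcLength, toIocMod_eq_iff]
  have hpi := Real.two_pi_pos
  refine ⟨⟨mul_pos hpi (S.arcTime_pos i j k), ?_⟩, ?_⟩
  · nlinarith [S.arcTime_le_one i j k]
  · obtain ⟨z, hz⟩ := S.exists_arcTime_add i j k
    have e : ∀ l, ∃ f : ℤ, 2 * π * S.linkTime j l = ((S.schedule.dir j : ℤ) : ℝ) *
        (linkAngle S.center j l - S.schedule.start j) - 2 * π * f := by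
      intro l
      rw [linkTime, Int.fract]
      refine ⟨⌊((S.schedule.dir j : ℤ) : ℝ) *
        (linkAngle S.center j l - S.schedule.start j) / (2 * π)⌋, ?_⟩
      rw [mul_sub, mul_div_cancel₀ _ hpi.ne']
    obtain ⟨f, hf⟩ := e k
    obtain ⟨f', hf'⟩ := e i
    refine ⟨z + f - f', ?_⟩
    simp only [zsmul_eq_mul]
    push_cast
    linear_combination (2 * π) * hz + hf' - hf

theorem atLink_add_arcTime {i j k : Fin n} {s : ℝ} (hs : S.AtLink j i s) :
    S.AtLink j k (s + S.arcTime i j k) := by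
  obtain ⟨q, rfl⟩ := S.atLink_iff.1 hs
  obtain ⟨z, hz⟩ := S.exists_arcTime_add i j k
  refine S.atLink_iff.2 ⟨q - z, ?_⟩
  push_cast
  linear_combination -hz

/-- Possible waiting times differ by integers, and `arcTime` is the one in `(0, 1]`, so it is the
least positive one. -/
theorem arcTime_le {i j k : Fin n} {s r : ℝ} (hs : S.AtLink j i s) (hr : S.AtLink j k r)
    (h : s < r) : S.arcTime i j k ≤ r - s := by
  obtain ⟨q, rfl⟩ := S.atLink_iff.1 hs
  obtain ⟨q', rfl⟩ := S.atLink_iff.1 hr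
  obtain ⟨z, hz⟩ := S.exists_arcTime_add i j k
  have h1 := S.arcTime_le_one i j k
  have h2 : (-1 : ℝ) < (z + q' - q : ℤ) := by push_cast; linarith
  have h3 : (0 : ℝ) ≤ (z + q' - q : ℤ) := by
    have : -1 < z + q' - q := by exact_mod_cast h2
    exact_mod_cast (by omega : 0 ≤ z + q' - q)
  push_cast at h3
  linarith

theorem ringStep_iff {d d' : S.graph.Dart} : S.RingStep d d' ↔ d'.fst = d.snd ∧
    ∀ k, S.graph.Adj d.snd k → S.arcTime d.fst d.snd d'.snd ≤ S.arcTime d.fst d.snd k := by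
  simp only [RingStep, arcLength_eq, mul_le_mul_iff_right₀ Real.two_pi_pos]

theorem exists_ringStep (d : S.graph.Dart) : ∃ d', S.RingStep d d' := by
  classical
  obtain ⟨k, hk, hmin⟩ := (S.graph.neighborFinset d.snd).exists_min_image
    (S.arcTime d.fst d.snd) ⟨d.fst, by simpa using d.adj.symm⟩
  exact ⟨⟨(d.snd, k), by simpa using hk⟩, S.ringStep_iff.2
    ⟨rfl, fun k' hk' => hmin k' (by simpa using hk')⟩⟩

/-- The time of the `q`-th passage of a ring path, starting in `[0, 1)`. -/
noncomputable def passageTime (p : ℕ → S.graph.Dart) (q : ℕ) : ℝ :=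
  S.linkTime (p 0).fst (p 0).snd +
    ∑ r ∈ Finset.range q, S.arcTime (p r).fst (p r).snd (p (r + 1)).snd

section RingPath

variable (hG : S.graph.IsTree) {p : ℕ → S.graph.Dart} {m : ℕ}

theorem passageTime_succ (q : ℕ) : S.passageTime p (q + 1) =
    S.passageTime p q + S.arcTime (p q).fst (p q).snd (p (q + 1)).snd := by
  rw [passageTime, Finset.sum_range_succ, ← add_assoc]
  rfl

theorem passageTime_strictMono : StrictMono (S.passageTime p) :=
  strictMono_nat_of_lt_succ fun q => by
    rw [passageTime_succ]
    linarith [S.arcTime_pos (p q).fst (p q).snd (p (q + 1)).snd]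

theorem sum_arcLength (q : ℕ) :
    ∑ i ∈ Finset.range q, S.arcLength (p i).fst (p i).snd (p (i + 1)).snd =
      2 * π * (S.passageTime p q - S.passageTime p 0) := by
  simp only [arcLength_eq, passageTime, ← Finset.mul_sum]
  simp

variable (hp : ∀ i < m, S.RingStep (p i) (p (i + 1)))
include hp

theorem atLink_passageTime {q : ℕ} (hq : q ≤ m) :
    S.AtLink (p q).fst (p q).snd (S.passageTime p q) := by
  induction q with
  | zero => simpa [passageTime] using S.atLink_linkTime _ _
  | succ q ih =>
    rw [passageTime_succ, (S.ringStep_iff.1 (hp q hq)).1]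
    exact S.atLink_add_arcTime ((S.atLink_symm (p q).adj).1 (ih (by omega)))

/-- A ring path follows one token: the next passage is at the first link met, so the token stays in
the entered circle until then. -/
theorem label_between_passages {q : ℕ} (hq : q < m) {t : ℝ} (h1 : S.passageTime p q < t)
    (h2 : t ≤ S.passageTime p (q + 1)) :
    S.label hG (p q).snd t = S.label hG (p q).fst (S.passageTime p q) := by
  have hat := (S.atLink_symm (p q).adj).1 (S.atLink_passageTime hp hq.le)
  refine S.label_eq_of_atLink hG h1 (p q).adj.symm hat fun k hk r hr hrt hkr => ?_
  have h3 := S.arcTime_le hat hkr hr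
  have h4 := (S.ringStep_iff.1 (hp q hq)).2 k hk
  rw [passageTime_succ] at h2
  linarith

theorem label_passageTime {q : ℕ} (hq : q ≤ m) :
    S.label hG (p q).fst (S.passageTime p q) = S.label hG (p 0).fst (S.passageTime p 0) := by
  induction q with
  | zero => rfl
  | succ q ih =>
    rw [← ih (by omega), (S.ringStep_iff.1 (hp q hq)).1]
    exact S.label_between_passages hG hp hq (S.passageTime_strictMono q.lt_succ_self) le_rfl

-- When a token `x` passes from `i` to `j`, it meets `x + l`, where `l` is the size of the side of
-- `j`. After `l` periods the label in circle `j` at this link is `x + l - l = x`, so the same token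
-- is there and passes back.
include hG in
theorem exists_passage_symm
    {Q : ℕ} (hQ : Q ≤ m)
    (hT : S.passageTime p 0 + sideCard S.graph (p 0).fst (p 0).snd ≤ S.passageTime p Q) :
    ∃ r, 0 < r ∧ r ≤ Q ∧ p r = (p 0).symm ∧
      S.passageTime p r = S.passageTime p 0 + sideCard S.graph (p 0).fst (p 0).snd := by
  classical
  set T := S.passageTime p 0 + sideCard S.graph (p 0).fst (p 0).snd with hTdef
  have hex : ∃ r, T ≤ S.passageTime p r := ⟨Q, hT⟩
  have hpos : (0 : ℝ) < sideCard S.graph (p 0).fst (p 0).snd := by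
    exact_mod_cast sideCard_pos (p 0).adj
  -- The first passage at or after `T` is not passage `0`, because a side is nonempty. So the token
  -- stays in one circle between passage `q` and time `T`.
  obtain ⟨q, hq⟩ : ∃ q, Nat.find hex = q + 1 := by
    refine Nat.exists_eq_succ_of_ne_zero fun h => ?_
    have := Nat.find_spec hex
    rw [h] at this
    linarith
  have hle := Nat.find_spec hex
  have hlt : S.passageTime p q < T := not_le.1 (Nat.find_min hex (by omega))
  have hqQ : q + 1 ≤ Q := hq ▸ Nat.find_min' hex hT
  rw [hq] at hle
  have h0 := S.atLink_passageTime hp (Nat.zero_le m)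
  have hlab : S.label hG (p q).snd T = S.label hG (p 0).snd T := by
    rw [S.label_between_passages hG hp (by omega) hlt hle, S.label_passageTime hG hp (by omega),
      hTdef]
    have := S.label_add_int hG (p 0).snd (S.passageTime p 0)
      (sideCard S.graph (p 0).fst (p 0).snd : ℕ)
    push_cast at this
    rw [this, S.label_of_atLink hG (p 0).adj h0]
    ring
  have hsnd : (p q).snd = (p 0).snd := (S.label_bijective hG T).1 hlab
  have hatT : S.AtLink (p 0).snd (p 0).fst T := by
    obtain ⟨z, hz⟩ := S.atLink_iff.1 ((S.atLink_symm (p 0).adj).1 h0)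
    refine S.atLink_iff.2 ⟨z + (sideCard S.graph (p 0).fst (p 0).snd : ℕ), ?_⟩
    rw [hTdef, hz]
    push_cast
    ring
  have hatq := (S.atLink_symm (p q).adj).1 (S.atLink_passageTime hp (q := q) (by omega))
  have hstep := S.ringStep_iff.1 (hp q (by omega))
  have h1 := S.arcTime_le hatq (hsnd ▸ hatT) hlt
  have h2 := hstep.2 (p 0).fst (hsnd ▸ (p 0).adj.symm)
  -- The link back is met at time `T`, and the ring leaves at the first link met, so the passage is
  -- not later than `T` either.
  have hTe : S.passageTime p (q + 1) = T := by
    rw [passageTime_succ] at hle ⊢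
    linarith
  refine ⟨q + 1, by omega, hqQ, ?_, hTe⟩
  have hfst : (p (q + 1)).fst = (p 0).snd := hstep.1.trans hsnd
  have hat := S.atLink_passageTime hp (q := q + 1) (by omega)
  have hadj := (p (q + 1)).adj
  rw [hTe, hfst] at hat
  rw [hfst] at hadj
  apply SimpleGraph.Dart.ext
  exact Prod.ext hfst (S.eq_of_atLink hadj (p 0).adj.symm hat hatT)

include hG in
/-- The time between two passages of the same crossing point, modulo `n`. -/
theorem passageTime_of_edge_eq {r : ℕ} (hr : r ≤ m) (he : (p r).edge = (p 0).edge) :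
    ∃ z : ℕ, S.passageTime p r = S.passageTime p 0 + z ∧
      (p r = p 0 ∧ (z : ZMod n) = 0 ∨
        p r = (p 0).symm ∧ (z : ZMod n) = sideCard S.graph (p 0).fst (p 0).snd) := by
  have h0 := S.atLink_passageTime hp (Nat.zero_le m)
  have hat := S.atLink_passageTime hp hr
  have hlab := S.label_passageTime hG hp hr
  have hcase := (SimpleGraph.dart_edge_eq_iff _ _).1 he
  have hat0 : S.AtLink (p 0).fst (p 0).snd (S.passageTime p r) := by
    rcases hcase with h | h
    · rwa [h] at hat
    · rw [h] at hat
      exact (S.atLink_symm (p 0).adj).2 hat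
  obtain ⟨a, ha⟩ := S.atLink_iff.1 h0
  obtain ⟨b, hb⟩ := S.atLink_iff.1 hat0
  have hmono : S.passageTime p 0 ≤ S.passageTime p r :=
    S.passageTime_strictMono.monotone (Nat.zero_le r)
  have hab : a ≤ b := by
    rw [ha, hb] at hmono
    exact_mod_cast (by linarith : (a : ℝ) ≤ b)
  obtain ⟨z, hz⟩ := Int.eq_ofNat_of_zero_le (sub_nonneg.2 hab)
  have hzr : S.passageTime p r = S.passageTime p 0 + ((z : ℤ) : ℝ) := by
    rw [← hz, ha, hb]; push_cast; ring
  refine ⟨z, by simpa using hzr, hcase.imp (fun h => ⟨h, ?_⟩) (fun h => ⟨h, ?_⟩)⟩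
  · rw [hzr, S.label_add_int, h] at hlab
    push_cast at hlab
    linear_combination -hlab
  · rw [hzr, S.label_add_int, h] at hlab
    have := S.label_of_atLink hG (p 0).adj h0
    have e : (p 0).symm.fst = (p 0).snd := rfl
    rw [e, this] at hlab
    push_cast at hlab
    linear_combination -hlab

end RingPath

/-- There are finitely many arcs, so their durations have a positive minimum. -/
theorem exists_le_passageTime (p : ℕ → S.graph.Dart) (T : ℝ) : ∃ Q, T ≤ S.passageTime p Q := by
  classical
  obtain ⟨e, -, hmin⟩ := (Finset.univ : Finset (Fin n × Fin n × Fin n)).exists_min_image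
    (fun e => S.arcTime e.1 e.2.1 e.2.2) ⟨((p 0).fst, (p 0).fst, (p 0).fst), Finset.mem_univ _⟩
  set δ := S.arcTime e.1 e.2.1 e.2.2
  have hδ : 0 < δ := S.arcTime_pos _ _ _
  have hq : ∀ q : ℕ, S.passageTime p 0 + q * δ ≤ S.passageTime p q := by
    intro q
    induction q with
    | zero => simp
    | succ q ih =>
      rw [passageTime_succ]
      have := hmin ((p q).fst, (p q).snd, (p (q + 1)).snd) (Finset.mem_univ _)
      simp only at this
      push_cast
      linarith
  obtain ⟨Q, hQ⟩ := Archimedean.arch (T - S.passageTime p 0) hδ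
  refine ⟨Q, ?_⟩
  have := hq Q
  rw [nsmul_eq_mul] at hQ
  linarith

/-- Let `l` be the size of the side that the first passage enters. The token returns over the same
link after `l` periods. Any passage of this crossing point happens after a whole number `z` of
periods with `z` equal to `0` or `l` modulo `n`; since `l < n`, none lies strictly in between. -/
theorem tieLengths_eq (hG : S.graph.IsTree) :
    S.tieLengths = (fun l : ℕ => 2 * π * (l : ℝ)) '' (sideSet S.graph : Set ℕ) := by
  have hsmall : ∀ {i j : Fin n}, S.graph.Adj i j → ∀ z : ℕ, 0 < z → z < sideCard S.graph i j →
      (z : ZMod n) ≠ 0 ∧ (z : ZMod n) ≠ sideCard S.graph i j := by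
    intro i j h z hz hzl
    have hn := sideCard_lt hG h
    rw [Fintype.card_fin] at hn
    constructor
    · rw [Ne, ZMod.natCast_eq_zero_iff]
      exact fun hd => absurd (Nat.le_of_dvd hz hd) (by omega)
    · rw [Ne, ZMod.natCast_eq_natCast_iff, Nat.ModEq, Nat.mod_eq_of_lt (by omega),
        Nat.mod_eq_of_lt hn]
      omega
  apply Set.Subset.antisymm
  · rintro _ ⟨m, p, hp, hm, hno, rfl⟩
    refine ⟨sideCard S.graph (p 0).fst (p 0).snd,
      mem_sideSet.2 ⟨_, _, (p 0).adj, rfl⟩, ?_⟩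
    rw [sum_arcLength]
    have he : (p m).edge = (p 0).edge := by rw [hm]; exact SimpleGraph.Dart.edge_symm _
    obtain ⟨z, hz, hcase⟩ := S.passageTime_of_edge_eq hG hp le_rfl he
    have hm0 : 0 < m := by
      rcases Nat.eq_zero_or_pos m with rfl | h
      · exact absurd hm.symm (SimpleGraph.Dart.symm_ne _)
      · exact h
    have hz0 : 0 < z := by
      have := S.passageTime_strictMono (p := p) hm0
      rw [hz] at this
      exact_mod_cast (by linarith : (0 : ℝ) < z)
    have hzm : (z : ZMod n) = sideCard S.graph (p 0).fst (p 0).snd := by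
      rcases hcase with h | h
      · exact absurd (hm.symm.trans h.1) (SimpleGraph.Dart.symm_ne _)
      · exact h.2
    have hle : sideCard S.graph (p 0).fst (p 0).snd ≤ z := by
      by_contra hlt
      exact (hsmall (p 0).adj z hz0 (not_le.1 hlt)).2 hzm
    obtain ⟨r, hr0, hrm, hpr, hTr⟩ := S.exists_passage_symm hG hp le_rfl (by
      rw [hz]
      have : (sideCard S.graph (p 0).fst (p 0).snd : ℝ) ≤ z := by exact_mod_cast hle
      linarith)
    -- The return after `l` periods is among the passages of the tie; a tie does not pass its
    -- crossing point in between, so it ends there.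
    obtain rfl : r = m := by
      by_contra hne
      refine hno r hr0 (lt_of_le_of_ne hrm hne) ?_
      rw [hpr]; exact SimpleGraph.Dart.edge_symm _
    simp only [hTr]
    ring
  · rintro _ ⟨l, hl, rfl⟩
    obtain ⟨i, j, hij, rfl⟩ := mem_sideSet.1 (Finset.mem_coe.1 hl)
    choose next hnext using S.exists_ringStep
    -- The tie is an initial piece of the infinite ring path that starts with the passage from `i`
    -- to `j`.
    set p : ℕ → S.graph.Dart := fun q => Nat.rec ⟨(i, j), hij⟩ (fun _ d => next d) q with hpdef
    have hp' : ∀ q, S.RingStep (p q) (p (q + 1)) := fun q => hnext (p q)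
    obtain ⟨Q, hQ⟩ := S.exists_le_passageTime p (S.passageTime p 0 + sideCard S.graph i j)
    have hp : ∀ q < Q, S.RingStep (p q) (p (q + 1)) := fun q _ => hp' q
    obtain ⟨r, hr0, hrQ, hpr, hTr⟩ := S.exists_passage_symm hG hp le_rfl hQ
    refine ⟨r, p, fun q _ => hp' q, hpr, fun q hq0 hqr he => ?_, ?_⟩
    · obtain ⟨z, hz, hcase⟩ := S.passageTime_of_edge_eq hG hp (hqr.le.trans hrQ) he
      have h1 := S.passageTime_strictMono (p := p) hq0
      have h2 := S.passageTime_strictMono (p := p) hqr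
      rw [hz] at h1 h2
      rw [hTr] at h2
      have hz0 : 0 < z := by exact_mod_cast (by linarith : (0 : ℝ) < z)
      have hzl : z < sideCard S.graph (p 0).fst (p 0).snd := by
        exact_mod_cast (by linarith : (z : ℝ) < sideCard S.graph (p 0).fst (p 0).snd)
      have := hsmall (p 0).adj z hz0 hzl
      rcases hcase with h | h
      · exact this.1 h.2
      · exact this.2 h.2
    · rw [sum_arcLength, hTr]
      simp only [add_sub_cancel_left]
      rfl

theorem numTieLengths_eq (hG : S.graph.IsTree) :
    S.numTieLengths = (sideSet S.graph).card := by
  rw [numTieLengths, S.tieLengths_eq hG, Set.ncard_image_of_injective, Set.ncard_coe_finset]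
  intro a b h
  have := mul_left_cancel₀ Real.two_pi_pos.ne' h
  exact_mod_cast this

end SCS

/-! ### Weakest preconditions for programs

The program uses twelve arrays and ten variables; a variable is cell `0` of its array. -/

/-- The contents of the variables and arrays of the program. -/
structure St where
  n : ℕ
  k : ℕ
  flag : ℕ
  val : ℕ
  ea : ℕ → ℕ
  eb : ℕ → ℕ
  deg : ℕ → ℕ
  ns : ℕ → ℕ
  sz : ℕ → ℕ
  pres : ℕ → ℕ
  lst : ℕ → ℕ
  x : ℕ → ℕ
  mark : ℕ → ℕ
  inK : ℕ → ℕ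
  nb : ℕ → ℕ
  cnt : ℕ → ℕ
  v : ℕ
  w : ℕ
  t : ℕ
  m : ℕ
  bad : ℕ
  mx : ℕ
  q : ℕ
  a : ℕ
  fin : ℕ
  z : ℕ

/-- An array with one or two cells in use. -/
def cells (a b : ℕ) : ℕ → ℕ
  | 0 => a
  | 1 => b
  | _ => 0

@[simp] theorem cells_zero (a b : ℕ) : cells a b 0 = a := rfl

@[simp] theorem cells_one (a b : ℕ) : cells a b 1 = b := rfl

theorem update_cells_zero (a b c : ℕ) : Function.update (cells a b) 0 c = cells c b := by
  funext i
  rcases i with _ | _ | i <;> rfl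

theorem update_cells_one (a b c : ℕ) : Function.update (cells a b) 1 c = cells a c := by
  funext i
  rcases i with _ | _ | i <;> rfl

namespace St

/-- The memory with these contents. -/
def mem (s : St) : Mem
  | 0 => cells s.n s.k
  | 1 => s.ea
  | 2 => s.eb
  | 3 => cells s.flag s.val
  | 4 => s.deg
  | 5 => s.ns
  | 6 => s.sz
  | 7 => s.pres
  | 8 => s.lst
  | 9 => s.x
  | 10 => s.mark
  | 11 => s.inK
  | 12 => s.nb
  | 13 => s.cnt
  | 14 => cells s.v 0
  | 15 => cells s.w 0
  | 16 => cells s.t 0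
  | 17 => cells s.m 0
  | 18 => cells s.bad 0
  | 19 => cells s.mx 0
  | 20 => cells s.q 0
  | 21 => cells s.a 0
  | 22 => cells s.fin 0
  | 23 => cells s.z 0
  | _ => fun _ => 0

@[simp] theorem mem_in (s : St) : s.mem 0 = cells s.n s.k := rfl
@[simp] theorem mem_out (s : St) : s.mem 3 = cells s.flag s.val := rfl
@[simp] theorem mem_ea (s : St) : s.mem 1 = s.ea := rfl
@[simp] theorem mem_eb (s : St) : s.mem 2 = s.eb := rfl
@[simp] theorem mem_deg (s : St) : s.mem 4 = s.deg := rfl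
@[simp] theorem mem_ns (s : St) : s.mem 5 = s.ns := rfl
@[simp] theorem mem_sz (s : St) : s.mem 6 = s.sz := rfl
@[simp] theorem mem_pres (s : St) : s.mem 7 = s.pres := rfl
@[simp] theorem mem_lst (s : St) : s.mem 8 = s.lst := rfl
@[simp] theorem mem_x (s : St) : s.mem 9 = s.x := rfl
@[simp] theorem mem_mark (s : St) : s.mem 10 = s.mark := rfl
@[simp] theorem mem_inK (s : St) : s.mem 11 = s.inK := rfl
@[simp] theorem mem_nb (s : St) : s.mem 12 = s.nb := rfl
@[simp] theorem mem_cnt (s : St) : s.mem 13 = s.cnt := rfl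
@[simp] theorem mem_v (s : St) : s.mem 14 = cells s.v 0 := rfl
@[simp] theorem mem_w (s : St) : s.mem 15 = cells s.w 0 := rfl
@[simp] theorem mem_t (s : St) : s.mem 16 = cells s.t 0 := rfl
@[simp] theorem mem_m (s : St) : s.mem 17 = cells s.m 0 := rfl
@[simp] theorem mem_bad (s : St) : s.mem 18 = cells s.bad 0 := rfl
@[simp] theorem mem_mx (s : St) : s.mem 19 = cells s.mx 0 := rfl
@[simp] theorem mem_q (s : St) : s.mem 20 = cells s.q 0 := rfl
@[simp] theorem mem_a (s : St) : s.mem 21 = cells s.a 0 := rfl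
@[simp] theorem mem_fin (s : St) : s.mem 22 = cells s.fin 0 := rfl
@[simp] theorem mem_z (s : St) : s.mem 23 = cells s.z 0 := rfl

end St

/-- Started in state `s` at time `T`, the program halts in a state and at a time that satisfy `Q`. -/
def WP (W : ℕ) (P : Prog) (Q : St → ℕ → Prop) (s : St) (T : ℕ) : Prop :=
  ∃ s' T', Run W P s.mem s'.mem T' ∧ Q s' (T + T')

namespace WP

variable {W : ℕ} {P P' : Prog} {Q Q' : St → ℕ → Prop} {s : St} {T : ℕ} {idx e : Expr} {b : Test}

theorem mono (h : WP W P Q s T) (hQ : ∀ s' T', Q s' T' → Q' s' T') : WP W P Q' s T := by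
  obtain ⟨s', T', hr, hq⟩ := h
  exact ⟨s', T', hr, hQ _ _ hq⟩

theorem skip (h : Q s (T + 1)) : WP W .skip Q s T := ⟨s, 1, Run.skip _, h⟩

theorem seq (h : WP W P (WP W P' Q) s T) : WP W (.seq P P') Q s T := by
  obtain ⟨s', T', hr, s'', T'', hr', hq⟩ := h
  exact ⟨s'', T' + T'', Run.seq hr hr', by rwa [← add_assoc]⟩

theorem branch (h1 : b.Holds s.mem → WP W P Q s (T + (b.cost + 1)))
    (h2 : ¬ b.Holds s.mem → WP W P' Q s (T + (b.cost + 1))) : WP W (.branch b P P') Q s T := by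
  by_cases hb : b.Holds s.mem
  · obtain ⟨s', T', hr, hq⟩ := h1 hb
    exact ⟨s', _, Run.branchTrue hb hr, by rwa [← add_assoc]⟩
  · obtain ⟨s', T', hr, hq⟩ := h2 hb
    exact ⟨s', _, Run.branchFalse hb hr, by rwa [← add_assoc]⟩

/-- A loop with an invariant `I` of the state and the time that bounds the time by `R`. -/
theorem loop (I : St → ℕ → Prop) (R : ℕ) (hI : I s T) (hR : ∀ s T, I s T → T ≤ R)
    (hstep : ∀ s T, I s T → b.Holds s.mem → WP W P I s (T + (b.cost + 1)))
    (hexit : ∀ s T, I s T → ¬ b.Holds s.mem → Q s (T + (b.cost + 1))) :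
    WP W (.loop b P) Q s T := by
  -- Every iteration costs at least one step, so the remaining time `R - T` is a termination
  -- measure.
  have key : ∀ f s T, R - T < f → I s T → WP W (.loop b P) Q s T := by
    intro f
    induction f with
    | zero => intro s T h; omega
    | succ f ih =>
      intro s T hf hs
      by_cases hb : b.Holds s.mem
      · obtain ⟨s', T', hr, hq⟩ := hstep s T hs hb
        have := hR _ _ hq
        have := hR _ _ hs
        obtain ⟨s'', T'', hr', hq'⟩ := ih s' _ (by omega) hq
        refine ⟨s'', _, Run.loopTrue hb hr hr', ?_⟩
        rwa [← add_assoc, ← add_assoc]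
      · exact ⟨s, _, Run.loopFalse hb, hexit s T hs hb⟩
  exact key _ s T (Nat.lt_succ_self _) hI

/-- A loop with `N` iterations, each of which takes at most `B` steps. -/
theorem loop_count (N B : ℕ) (I : ℕ → St → Prop) (h0 : I 0 s)
    (hb : ∀ i s, i ≤ N → I i s → (b.Holds s.mem ↔ i < N))
    (hstep : ∀ i s T, i < N → I i s → WP W P (fun s' T' => I (i + 1) s' ∧ T' ≤ T + B) s T) :
    WP W (.loop b P)
      (fun s' T' => I N s' ∧ T' ≤ T + N * (B + (b.cost + 1)) + (b.cost + 1)) s T := by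
  refine loop (I := fun s' T' => ∃ i ≤ N, I i s' ∧ T' ≤ T + i * (B + (b.cost + 1)))
    (T + N * (B + (b.cost + 1))) ⟨0, Nat.zero_le _, h0, by omega⟩ ?_ ?_ ?_
  · rintro s' T' ⟨i, hi, -, hT⟩
    have := Nat.mul_le_mul_right (B + (b.cost + 1)) hi
    omega
  · rintro s' T' ⟨i, hi, hs, hT⟩ hh
    have hi' := (hb i s' hi hs).1 hh
    refine (hstep i s' _ hi' hs).mono ?_
    rintro s'' T'' ⟨h1, h2⟩
    refine ⟨i + 1, hi', h1, ?_⟩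
    rw [Nat.succ_mul]
    omega
  · rintro s' T' ⟨i, hi, hs, hT⟩ hh
    have : i = N := le_antisymm hi (not_lt.1 fun h => hh ((hb i s' hi hs).2 h))
    subst this
    exact ⟨hs, by omega⟩

/-! ### Effect and cost of single assignments -/

theorem mem_update_deg (s : St) (f : ℕ → ℕ) :
    { s with deg := f }.mem = Function.update s.mem 4 f := by
  funext a
  rcases a with _ | _ | _ | _ | _ | _ | _ | _ | _ | _ | _ | _ | _ | _ | _ | _ | _ | _ | _ | _ | _ | _ | _ | _ | a <;> rfl

theorem mem_update_ns (s : St) (f : ℕ → ℕ) :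
    { s with ns := f }.mem = Function.update s.mem 5 f := by
  funext a
  rcases a with _ | _ | _ | _ | _ | _ | _ | _ | _ | _ | _ | _ | _ | _ | _ | _ | _ | _ | _ | _ | _ | _ | _ | _ | a <;> rfl

theorem mem_update_sz (s : St) (f : ℕ → ℕ) :
    { s with sz := f }.mem = Function.update s.mem 6 f := by
  funext a
  rcases a with _ | _ | _ | _ | _ | _ | _ | _ | _ | _ | _ | _ | _ | _ | _ | _ | _ | _ | _ | _ | _ | _ | _ | _ | a <;> rfl

theorem mem_update_pres (s : St) (f : ℕ → ℕ) :
    { s with pres := f }.mem = Function.update s.mem 7 f := by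
  funext a
  rcases a with _ | _ | _ | _ | _ | _ | _ | _ | _ | _ | _ | _ | _ | _ | _ | _ | _ | _ | _ | _ | _ | _ | _ | _ | a <;> rfl

theorem mem_update_lst (s : St) (f : ℕ → ℕ) :
    { s with lst := f }.mem = Function.update s.mem 8 f := by
  funext a
  rcases a with _ | _ | _ | _ | _ | _ | _ | _ | _ | _ | _ | _ | _ | _ | _ | _ | _ | _ | _ | _ | _ | _ | _ | _ | a <;> rfl

theorem mem_update_x (s : St) (f : ℕ → ℕ) :
    { s with x := f }.mem = Function.update s.mem 9 f := by
  funext a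
  rcases a with _ | _ | _ | _ | _ | _ | _ | _ | _ | _ | _ | _ | _ | _ | _ | _ | _ | _ | _ | _ | _ | _ | _ | _ | a <;> rfl

theorem mem_update_mark (s : St) (f : ℕ → ℕ) :
    { s with mark := f }.mem = Function.update s.mem 10 f := by
  funext a
  rcases a with _ | _ | _ | _ | _ | _ | _ | _ | _ | _ | _ | _ | _ | _ | _ | _ | _ | _ | _ | _ | _ | _ | _ | _ | a <;> rfl

theorem mem_update_inK (s : St) (f : ℕ → ℕ) :
    { s with inK := f }.mem = Function.update s.mem 11 f := by
  funext a
  rcases a with _ | _ | _ | _ | _ | _ | _ | _ | _ | _ | _ | _ | _ | _ | _ | _ | _ | _ | _ | _ | _ | _ | _ | _ | a <;> rfl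

theorem mem_update_nb (s : St) (f : ℕ → ℕ) :
    { s with nb := f }.mem = Function.update s.mem 12 f := by
  funext a
  rcases a with _ | _ | _ | _ | _ | _ | _ | _ | _ | _ | _ | _ | _ | _ | _ | _ | _ | _ | _ | _ | _ | _ | _ | _ | a <;> rfl

theorem mem_update_cnt (s : St) (f : ℕ → ℕ) :
    { s with cnt := f }.mem = Function.update s.mem 13 f := by
  funext a
  rcases a with _ | _ | _ | _ | _ | _ | _ | _ | _ | _ | _ | _ | _ | _ | _ | _ | _ | _ | _ | _ | _ | _ | _ | _ | a <;> rfl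

theorem mem_update_v (s : St) (c : ℕ) :
    { s with v := c }.mem = Function.update s.mem 14 (Function.update (s.mem 14) 0 c) := by
  rw [St.mem_v, update_cells_zero]
  funext a
  rcases a with _ | _ | _ | _ | _ | _ | _ | _ | _ | _ | _ | _ | _ | _ | _ | _ | _ | _ | _ | _ | _ | _ | _ | _ | a <;> rfl

theorem mem_update_w (s : St) (c : ℕ) :
    { s with w := c }.mem = Function.update s.mem 15 (Function.update (s.mem 15) 0 c) := by
  rw [St.mem_w, update_cells_zero]
  funext a
  rcases a with _ | _ | _ | _ | _ | _ | _ | _ | _ | _ | _ | _ | _ | _ | _ | _ | _ | _ | _ | _ | _ | _ | _ | _ | a <;> rfl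

theorem mem_update_t (s : St) (c : ℕ) :
    { s with t := c }.mem = Function.update s.mem 16 (Function.update (s.mem 16) 0 c) := by
  rw [St.mem_t, update_cells_zero]
  funext a
  rcases a with _ | _ | _ | _ | _ | _ | _ | _ | _ | _ | _ | _ | _ | _ | _ | _ | _ | _ | _ | _ | _ | _ | _ | _ | a <;> rfl

theorem mem_update_m (s : St) (c : ℕ) :
    { s with m := c }.mem = Function.update s.mem 17 (Function.update (s.mem 17) 0 c) := by
  rw [St.mem_m, update_cells_zero]
  funext a
  rcases a with _ | _ | _ | _ | _ | _ | _ | _ | _ | _ | _ | _ | _ | _ | _ | _ | _ | _ | _ | _ | _ | _ | _ | _ | a <;> rfl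

theorem mem_update_bad (s : St) (c : ℕ) :
    { s with bad := c }.mem = Function.update s.mem 18 (Function.update (s.mem 18) 0 c) := by
  rw [St.mem_bad, update_cells_zero]
  funext a
  rcases a with _ | _ | _ | _ | _ | _ | _ | _ | _ | _ | _ | _ | _ | _ | _ | _ | _ | _ | _ | _ | _ | _ | _ | _ | a <;> rfl

theorem mem_update_mx (s : St) (c : ℕ) :
    { s with mx := c }.mem = Function.update s.mem 19 (Function.update (s.mem 19) 0 c) := by
  rw [St.mem_mx, update_cells_zero]
  funext a
  rcases a with _ | _ | _ | _ | _ | _ | _ | _ | _ | _ | _ | _ | _ | _ | _ | _ | _ | _ | _ | _ | _ | _ | _ | _ | a <;> rfl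

theorem mem_update_q (s : St) (c : ℕ) :
    { s with q := c }.mem = Function.update s.mem 20 (Function.update (s.mem 20) 0 c) := by
  rw [St.mem_q, update_cells_zero]
  funext a
  rcases a with _ | _ | _ | _ | _ | _ | _ | _ | _ | _ | _ | _ | _ | _ | _ | _ | _ | _ | _ | _ | _ | _ | _ | _ | a <;> rfl

theorem mem_update_a (s : St) (c : ℕ) :
    { s with a := c }.mem = Function.update s.mem 21 (Function.update (s.mem 21) 0 c) := by
  rw [St.mem_a, update_cells_zero]
  funext a
  rcases a with _ | _ | _ | _ | _ | _ | _ | _ | _ | _ | _ | _ | _ | _ | _ | _ | _ | _ | _ | _ | _ | _ | _ | _ | a <;> rfl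

theorem mem_update_fin (s : St) (c : ℕ) :
    { s with fin := c }.mem = Function.update s.mem 22 (Function.update (s.mem 22) 0 c) := by
  rw [St.mem_fin, update_cells_zero]
  funext a
  rcases a with _ | _ | _ | _ | _ | _ | _ | _ | _ | _ | _ | _ | _ | _ | _ | _ | _ | _ | _ | _ | _ | _ | _ | _ | a <;> rfl

theorem mem_update_z (s : St) (c : ℕ) :
    { s with z := c }.mem = Function.update s.mem 23 (Function.update (s.mem 23) 0 c) := by
  rw [St.mem_z, update_cells_zero]
  funext a
  rcases a with _ | _ | _ | _ | _ | _ | _ | _ | _ | _ | _ | _ | _ | _ | _ | _ | _ | _ | _ | _ | _ | _ | _ | _ | a <;> rfl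

theorem mem_update_flag (s : St) (c : ℕ) :
    { s with flag := c }.mem = Function.update s.mem 3 (Function.update (s.mem 3) 0 c) := by
  rw [St.mem_out, update_cells_zero]
  funext a
  rcases a with _ | _ | _ | _ | _ | _ | _ | _ | _ | _ | _ | _ | _ | _ | _ | _ | _ | _ | _ | _ | _ | _ | _ | _ | a <;> rfl

theorem mem_update_val (s : St) (c : ℕ) :
    { s with val := c }.mem = Function.update s.mem 3 (Function.update (s.mem 3) 1 c) := by
  rw [St.mem_out, update_cells_one]
  funext a
  rcases a with _ | _ | _ | _ | _ | _ | _ | _ | _ | _ | _ | _ | _ | _ | _ | _ | _ | _ | _ | _ | _ | _ | _ | _ | a <;> rfl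

theorem write_deg (h1 : idx.eval s.mem ≤ W) (h2 : e.eval s.mem ≤ W)
    (h : Q { s with deg := Function.update s.deg (idx.eval s.mem) (e.eval s.mem) }
      (T + (idx.cost + e.cost + 1))) : WP W (.write 4 idx e) Q s T := by
  refine ⟨_, _, ?_, h⟩
  convert Run.write s.mem 4 idx e h1 h2 using 1
  exact mem_update_deg _ _

theorem write_ns (h1 : idx.eval s.mem ≤ W) (h2 : e.eval s.mem ≤ W)
    (h : Q { s with ns := Function.update s.ns (idx.eval s.mem) (e.eval s.mem) }
      (T + (idx.cost + e.cost + 1))) : WP W (.write 5 idx e) Q s T := by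
  refine ⟨_, _, ?_, h⟩
  convert Run.write s.mem 5 idx e h1 h2 using 1
  exact mem_update_ns _ _

theorem write_sz (h1 : idx.eval s.mem ≤ W) (h2 : e.eval s.mem ≤ W)
    (h : Q { s with sz := Function.update s.sz (idx.eval s.mem) (e.eval s.mem) }
      (T + (idx.cost + e.cost + 1))) : WP W (.write 6 idx e) Q s T := by
  refine ⟨_, _, ?_, h⟩
  convert Run.write s.mem 6 idx e h1 h2 using 1
  exact mem_update_sz _ _

theorem write_pres (h1 : idx.eval s.mem ≤ W) (h2 : e.eval s.mem ≤ W)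
    (h : Q { s with pres := Function.update s.pres (idx.eval s.mem) (e.eval s.mem) }
      (T + (idx.cost + e.cost + 1))) : WP W (.write 7 idx e) Q s T := by
  refine ⟨_, _, ?_, h⟩
  convert Run.write s.mem 7 idx e h1 h2 using 1
  exact mem_update_pres _ _

theorem write_lst (h1 : idx.eval s.mem ≤ W) (h2 : e.eval s.mem ≤ W)
    (h : Q { s with lst := Function.update s.lst (idx.eval s.mem) (e.eval s.mem) }
      (T + (idx.cost + e.cost + 1))) : WP W (.write 8 idx e) Q s T := by
  refine ⟨_, _, ?_, h⟩
  convert Run.write s.mem 8 idx e h1 h2 using 1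
  exact mem_update_lst _ _

theorem write_x (h1 : idx.eval s.mem ≤ W) (h2 : e.eval s.mem ≤ W)
    (h : Q { s with x := Function.update s.x (idx.eval s.mem) (e.eval s.mem) }
      (T + (idx.cost + e.cost + 1))) : WP W (.write 9 idx e) Q s T := by
  refine ⟨_, _, ?_, h⟩
  convert Run.write s.mem 9 idx e h1 h2 using 1
  exact mem_update_x _ _

theorem write_mark (h1 : idx.eval s.mem ≤ W) (h2 : e.eval s.mem ≤ W)
    (h : Q { s with mark := Function.update s.mark (idx.eval s.mem) (e.eval s.mem) }
      (T + (idx.cost + e.cost + 1))) : WP W (.write 10 idx e) Q s T := by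
  refine ⟨_, _, ?_, h⟩
  convert Run.write s.mem 10 idx e h1 h2 using 1
  exact mem_update_mark _ _

theorem write_inK (h1 : idx.eval s.mem ≤ W) (h2 : e.eval s.mem ≤ W)
    (h : Q { s with inK := Function.update s.inK (idx.eval s.mem) (e.eval s.mem) }
      (T + (idx.cost + e.cost + 1))) : WP W (.write 11 idx e) Q s T := by
  refine ⟨_, _, ?_, h⟩
  convert Run.write s.mem 11 idx e h1 h2 using 1
  exact mem_update_inK _ _

theorem write_nb (h1 : idx.eval s.mem ≤ W) (h2 : e.eval s.mem ≤ W)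
    (h : Q { s with nb := Function.update s.nb (idx.eval s.mem) (e.eval s.mem) }
      (T + (idx.cost + e.cost + 1))) : WP W (.write 12 idx e) Q s T := by
  refine ⟨_, _, ?_, h⟩
  convert Run.write s.mem 12 idx e h1 h2 using 1
  exact mem_update_nb _ _

theorem write_cnt (h1 : idx.eval s.mem ≤ W) (h2 : e.eval s.mem ≤ W)
    (h : Q { s with cnt := Function.update s.cnt (idx.eval s.mem) (e.eval s.mem) }
      (T + (idx.cost + e.cost + 1))) : WP W (.write 13 idx e) Q s T := by
  refine ⟨_, _, ?_, h⟩
  convert Run.write s.mem 13 idx e h1 h2 using 1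
  exact mem_update_cnt _ _

theorem write_v (h2 : e.eval s.mem ≤ W)
    (h : Q { s with v := e.eval s.mem } (T + (e.cost + 2))) :
    WP W (.write 14 (.lit 0) e) Q s T := by
  refine ⟨_, _, ?_, h⟩
  convert Run.write s.mem 14 (.lit 0) e (Nat.zero_le _) h2 using 1
  · exact mem_update_v _ _
  · simp only [Expr.cost]; omega

theorem write_w (h2 : e.eval s.mem ≤ W)
    (h : Q { s with w := e.eval s.mem } (T + (e.cost + 2))) :
    WP W (.write 15 (.lit 0) e) Q s T := by
  refine ⟨_, _, ?_, h⟩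
  convert Run.write s.mem 15 (.lit 0) e (Nat.zero_le _) h2 using 1
  · exact mem_update_w _ _
  · simp only [Expr.cost]; omega

theorem write_t (h2 : e.eval s.mem ≤ W)
    (h : Q { s with t := e.eval s.mem } (T + (e.cost + 2))) :
    WP W (.write 16 (.lit 0) e) Q s T := by
  refine ⟨_, _, ?_, h⟩
  convert Run.write s.mem 16 (.lit 0) e (Nat.zero_le _) h2 using 1
  · exact mem_update_t _ _
  · simp only [Expr.cost]; omega

theorem write_m (h2 : e.eval s.mem ≤ W)
    (h : Q { s with m := e.eval s.mem } (T + (e.cost + 2))) :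
    WP W (.write 17 (.lit 0) e) Q s T := by
  refine ⟨_, _, ?_, h⟩
  convert Run.write s.mem 17 (.lit 0) e (Nat.zero_le _) h2 using 1
  · exact mem_update_m _ _
  · simp only [Expr.cost]; omega

theorem write_bad (h2 : e.eval s.mem ≤ W)
    (h : Q { s with bad := e.eval s.mem } (T + (e.cost + 2))) :
    WP W (.write 18 (.lit 0) e) Q s T := by
  refine ⟨_, _, ?_, h⟩
  convert Run.write s.mem 18 (.lit 0) e (Nat.zero_le _) h2 using 1
  · exact mem_update_bad _ _
  · simp only [Expr.cost]; omega

theorem write_mx (h2 : e.eval s.mem ≤ W)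
    (h : Q { s with mx := e.eval s.mem } (T + (e.cost + 2))) :
    WP W (.write 19 (.lit 0) e) Q s T := by
  refine ⟨_, _, ?_, h⟩
  convert Run.write s.mem 19 (.lit 0) e (Nat.zero_le _) h2 using 1
  · exact mem_update_mx _ _
  · simp only [Expr.cost]; omega

theorem write_q (h2 : e.eval s.mem ≤ W)
    (h : Q { s with q := e.eval s.mem } (T + (e.cost + 2))) :
    WP W (.write 20 (.lit 0) e) Q s T := by
  refine ⟨_, _, ?_, h⟩
  convert Run.write s.mem 20 (.lit 0) e (Nat.zero_le _) h2 using 1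
  · exact mem_update_q _ _
  · simp only [Expr.cost]; omega

theorem write_a (h2 : e.eval s.mem ≤ W)
    (h : Q { s with a := e.eval s.mem } (T + (e.cost + 2))) :
    WP W (.write 21 (.lit 0) e) Q s T := by
  refine ⟨_, _, ?_, h⟩
  convert Run.write s.mem 21 (.lit 0) e (Nat.zero_le _) h2 using 1
  · exact mem_update_a _ _
  · simp only [Expr.cost]; omega

theorem write_fin (h2 : e.eval s.mem ≤ W)
    (h : Q { s with fin := e.eval s.mem } (T + (e.cost + 2))) :
    WP W (.write 22 (.lit 0) e) Q s T := by
  refine ⟨_, _, ?_, h⟩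
  convert Run.write s.mem 22 (.lit 0) e (Nat.zero_le _) h2 using 1
  · exact mem_update_fin _ _
  · simp only [Expr.cost]; omega

theorem write_z (h2 : e.eval s.mem ≤ W)
    (h : Q { s with z := e.eval s.mem } (T + (e.cost + 2))) :
    WP W (.write 23 (.lit 0) e) Q s T := by
  refine ⟨_, _, ?_, h⟩
  convert Run.write s.mem 23 (.lit 0) e (Nat.zero_le _) h2 using 1
  · exact mem_update_z _ _
  · simp only [Expr.cost]; omega

theorem write_flag (hW : 0 ≤ W) (h2 : e.eval s.mem ≤ W)
    (h : Q { s with flag := e.eval s.mem } (T + (e.cost + 2))) :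
    WP W (.write 3 (.lit 0) e) Q s T := by
  refine ⟨_, _, ?_, h⟩
  convert Run.write s.mem 3 (.lit 0) e hW h2 using 1
  · exact mem_update_flag _ _
  · simp only [Expr.cost]; omega

theorem write_val (hW : 1 ≤ W) (h2 : e.eval s.mem ≤ W)
    (h : Q { s with val := e.eval s.mem } (T + (e.cost + 2))) :
    WP W (.write 3 (.lit 1) e) Q s T := by
  refine ⟨_, _, ?_, h⟩
  convert Run.write s.mem 3 (.lit 1) e hW h2 using 1
  · exact mem_update_val _ _
  · simp only [Expr.cost]; omega

end WP

/-! ### Degrees and sums of neighbours -/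

/-- The contents of a variable. -/
def evar (a : ℕ) : Expr := .read a (.lit 0)

theorem eval_evar (M : Mem) (a : ℕ) : (evar a).eval M = M a 0 := rfl

theorem cost_evar (a : ℕ) : (evar a).cost = 2 := rfl

section EdgeSum

variable {n : ℕ}

/-- The sum of `g` over the other endpoints of the listed edges at `u`. -/
def edgeSum (g : Fin n → ℕ) (es : List (Fin n × Fin n)) (u : Fin n) : ℕ :=
  (es.map fun e => (if e.1 = u then g e.2 else 0) + (if e.2 = u then g e.1 else 0)).sum

theorem edgeSum_le {g : Fin n → ℕ} {c : ℕ} (hg : ∀ u, g u ≤ c) (es : List (Fin n × Fin n))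
    (u : Fin n) : edgeSum g es u ≤ es.length * (2 * c) := by
  induction es with
  | nil => simp [edgeSum]
  | cons e es ih =>
    simp only [edgeSum, List.map_cons, List.sum_cons, List.length_cons] at *
    have h1 := hg e.1
    have h2 := hg e.2
    rw [Nat.succ_mul]
    split_ifs <;> omega

theorem edgeSum_append (g : Fin n → ℕ) (es : List (Fin n × Fin n)) (e : Fin n × Fin n)
    (u : Fin n) : edgeSum g (es ++ [e]) u =
      edgeSum g es u + ((if e.1 = u then g e.2 else 0) + (if e.2 = u then g e.1 else 0)) := by
  simp [edgeSum]

/-- Listing each unordered edge once and having no loops ensures that every neighbour is counted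
exactly once. -/
theorem edgeSum_eq_sum_ite (g : Fin n → ℕ) (es : List (Fin n × Fin n)) (u : Fin n)
    (hnd : (es.map fun e => s(e.1, e.2)).Nodup) (hne : ∀ e ∈ es, e.1 ≠ e.2) :
    edgeSum g es u = ∑ w, if s(u, w) ∈ es.map (fun e => s(e.1, e.2)) then g w else 0 := by
  induction es with
  | nil => simp [edgeSum]
  | cons e es ih =>
    rw [List.map_cons, List.nodup_cons] at hnd
    have ih := ih hnd.2 fun e he => hne e (List.mem_cons_of_mem _ he)
    have h12 := hne e List.mem_cons_self
    have hsplit : ∀ w, (if s(u, w) ∈ (e :: es).map (fun e => s(e.1, e.2)) then g w else 0) =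
        ((if e.1 = u ∧ w = e.2 then g w else 0) + (if e.2 = u ∧ w = e.1 then g w else 0)) +
          (if s(u, w) ∈ es.map (fun e => s(e.1, e.2)) then g w else 0) := by
      intro w
      simp only [List.map_cons, List.mem_cons]
      by_cases h : s(u, w) = s(e.1, e.2)
      · have h' := hnd.1
        rw [← h] at h'
        rw [if_pos (Or.inl h), if_neg h']
        clear ih h' hnd
        rw [Sym2.eq_iff] at h
        rcases h with ⟨rfl, rfl⟩ | ⟨rfl, rfl⟩
        · simp [h12.symm]
        · simp [h12]
      · have h1 : ¬ (e.1 = u ∧ w = e.2) := by rintro ⟨rfl, rfl⟩; exact h rfl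
        have h2 : ¬ (e.2 = u ∧ w = e.1) := by rintro ⟨rfl, rfl⟩; exact h Sym2.eq_swap
        simp [h, h1, h2]
    simp only [hsplit, Finset.sum_add_distrib, ← ih]
    have e1 : ∀ (p : Prop) [Decidable p] (c : Fin n),
        (∑ w, if p ∧ w = c then g w else 0) = if p then g c else 0 := by
      intro p _ c
      by_cases hp : p <;> simp [hp]
    rw [e1, e1]
    simp only [edgeSum, List.map_cons, List.sum_cons]

open Classical in
theorem edgeSum_eq {G : SimpleGraph (Fin n)} {es : List (Fin n × Fin n)} (h : ListsEdges G es)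
    (g : Fin n → ℕ) (u : Fin n) : edgeSum g es u = ∑ w ∈ G.neighborFinset u, g w := by
  rw [edgeSum_eq_sum_ite g es u h.1, ← Finset.sum_filter]
  · congr 1
    ext w
    simp [h.2 u w]
  · intro e he
    exact ((h.2 e.1 e.2).2 (List.mem_map_of_mem he)).ne

theorem ListsEdges.length_add_one {G : SimpleGraph (Fin n)} {es : List (Fin n × Fin n)}
    (h : ListsEdges G es) (hG : G.IsTree) : es.length + 1 = n := by
  classical
  have h1 := hG.card_edgeFinset
  have h2 : G.edgeFinset = (es.map fun e => s(e.1, e.2)).toFinset := by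
    ext e
    induction e with
    | _ i j => rw [SimpleGraph.mem_edgeFinset, SimpleGraph.mem_edgeSet, h.2 i j, List.mem_toFinset]
  rw [h2, List.toFinset_card_of_nodup h.1, List.length_map, Fintype.card_fin] at h1
  exact h1

end EdgeSum

/-- Computes the degrees and the sums of the neighbours. -/
def degreeProg : Prog :=
  .loop (.lt (.add (evar 14) (.lit 1)) (evar 0))
    (.seq (.write 4 (.read 1 (evar 14)) (.add (.read 4 (.read 1 (evar 14))) (.lit 1)))
    (.seq (.write 4 (.read 2 (evar 14)) (.add (.read 4 (.read 2 (evar 14))) (.lit 1)))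
    (.seq (.write 5 (.read 1 (evar 14))
      (.add (.read 5 (.read 1 (evar 14))) (.read 2 (evar 14))))
    (.seq (.write 5 (.read 2 (evar 14))
      (.add (.read 5 (.read 2 (evar 14))) (.read 1 (evar 14))))
    (.write 14 (.lit 0) (.add (evar 14) (.lit 1)))))))

-- The sums of neighbours replace adjacency lists: at a vertex with a single remaining neighbour,
-- the sum is this neighbour. They can be collected in one pass over the edges in any order.
open Classical in
theorem wp_degreeProg {W : ℕ} (s : St) (T : ℕ) {G : SimpleGraph (Fin s.n)} (hG : G.IsTree)
    {es : List (Fin s.n × Fin s.n)} (hes : ListsEdges G es)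
    (hW : 4 * s.n * s.n + 4 * s.n + s.k + 4 ≤ W)
    (hea : s.ea = fun i => (es.map fun e => (e.1 : ℕ)).getD i 0)
    (heb : s.eb = fun i => (es.map fun e => (e.2 : ℕ)).getD i 0)
    (hdeg : s.deg = fun _ => 0) (hns : s.ns = fun _ => 0) (hv : s.v = 0) :
    WP W degreeProg (fun s' T' => (∃ v deg ns, s' = { s with v := v, deg := deg, ns := ns } ∧
      ∀ u : Fin s.n, deg u = (G.neighborFinset u).card ∧
        ns u = ∑ w ∈ G.neighborFinset u, (w : ℕ)) ∧ T' ≤ T + 100 * s.n) s T := by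
  -- A tree has `n - 1` edges, so the test `v + 1 < n` runs exactly through the list.
  have hlen := hes.length_add_one hG
  refine (WP.loop_count es.length 60
    (fun i s' => ∃ deg ns, s' = { s with v := i, deg := deg, ns := ns } ∧
      ∀ u : Fin s.n, deg u = edgeSum (fun _ => 1) (es.take i) u ∧
        ns u = edgeSum (fun w => (w : ℕ)) (es.take i) u) ?_ ?_ ?_).mono ?_
  · refine ⟨s.deg, s.ns, by rw [← hv], fun u => ?_⟩
    simp [hdeg, hns, edgeSum]
  · rintro i s' hi ⟨deg, ns, rfl, -⟩
    simp only [Test.Holds, Expr.eval, eval_evar, St.mem_v, St.mem_in, cells_zero]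
    omega
  · rintro i s' T hi ⟨deg, ns, rfl, hu⟩
    have h1 : s.ea i = es[i].1 := by simp [hea, hi]
    have h2 : s.eb i = es[i].2 := by simp [heb, hi]
    have hne : es[i].1 ≠ es[i].2 :=
      ((hes.2 es[i].1 es[i].2).2 (List.mem_map_of_mem (List.getElem_mem hi))).ne
    have hne' : (es[i].1 : ℕ) ≠ es[i].2 := fun h => hne (Fin.ext h)
    -- The crude bounds `2n` for degrees and `2n²` for sums keep the written values below the word
    -- bound.
    have hb1 := fun u => edgeSum_le (g := fun _ : Fin s.n => 1) (c := 1) (fun _ => le_rfl)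
      (es.take i) u
    have hb2 := fun u => edgeSum_le (g := fun w : Fin s.n => (w : ℕ)) (c := s.n)
      (fun w => w.2.le) (es.take i) u
    have hti : (es.take i).length ≤ s.n := by rw [List.length_take]; omega
    have hti2 := Nat.mul_le_mul_right (2 * s.n) hti
    have hassoc : s.n * (2 * s.n) = 2 * (s.n * s.n) := by ring
    have hassoc' : 4 * s.n * s.n = 4 * (s.n * s.n) := by ring
    have l1 := es[i].1.2
    have l2 := es[i].2.2
    have hd1 := hu es[i].1
    have hd2 := hu es[i].2
    have b11 := hb1 es[i].1
    have b12 := hb1 es[i].2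
    have b21 := hb2 es[i].1
    have b22 := hb2 es[i].2
    refine .seq (.write_deg ?_ ?_ (.seq (.write_deg ?_ ?_ (.seq (.write_ns ?_ ?_
      (.seq (.write_ns ?_ ?_ (.write_v ?_ ?_))))))))
    all_goals simp only [Expr.eval, Expr.cost, eval_evar, cost_evar, St.mem_v, St.mem_ea, St.mem_eb,
      St.mem_deg, St.mem_ns, cells_zero, h1, h2, Function.update_of_ne hne'.symm]
    · omega
    · omega
    · omega
    · omega
    · omega
    · omega
    · omega
    · omega
    · omega
    · refine ⟨⟨_, _, rfl, fun u => ?_⟩, by omega⟩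
      rw [← List.take_append_getElem hi, edgeSum_append, edgeSum_append, ← (hu u).1, ← (hu u).2]
      have e1 : ((u : ℕ) = es[i].1) ↔ es[i].1 = u := by rw [Fin.ext_iff, eq_comm]
      have e2 : ((u : ℕ) = es[i].2) ↔ es[i].2 = u := by rw [Fin.ext_iff, eq_comm]
      simp only [Function.update_apply, e1, e2]
      by_cases c1 : es[i].1 = u
      · have c2 : es[i].2 ≠ u := fun h => hne (c1.trans h.symm)
        simp [c1, c2]
      · by_cases c2 : es[i].2 = u <;> simp [c1, c2]
  · rintro s' T' ⟨⟨deg, ns, rfl, hu⟩, hT⟩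
    refine ⟨⟨_, deg, ns, rfl, fun u => ?_⟩, ?_⟩
    · rw [(hu u).1, (hu u).2, List.take_length, edgeSum_eq hes, edgeSum_eq hes]
      simp
    · simp only [Test.cost, Expr.cost, cost_evar] at hT
      omega

/-! ### Peeling off leaves -/

open Classical in
/-- The state of the peeling of a tree: `U` is the set of remaining vertices, `deg` and `ns` are the
degrees and the sums of neighbours in the remaining tree, `sz u + 1` is the number of vertices that
have been merged into `u`, and `pres` marks the sizes of sides of the edges that are gone. -/
structure PeelInv {n : ℕ} (G : SimpleGraph (Fin n)) (U : Finset (Fin n))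
    (deg ns sz pres : ℕ → ℕ) : Prop where
  deg_live : ∀ u ∈ U, deg u = (G.neighborFinset u ∩ U).card
  ns_live : ∀ u ∈ U, ns u = ∑ w ∈ G.neighborFinset u ∩ U, (w : ℕ)
  sz_live : ∀ u ∈ U, sz u + 1 + ∑ w ∈ G.neighborFinset u ∩ U, sideCard G u w = n
  deg_dead : ∀ u : Fin n, u ∉ U → deg u = 0
  pres_iff : ∀ l, pres l = 1 ↔ ∃ i j, G.Adj i j ∧ ¬ (i ∈ U ∧ j ∈ U) ∧ sideCard G i j = l

namespace PeelInv

variable {n : ℕ} {G : SimpleGraph (Fin n)} {U : Finset (Fin n)} {deg ns sz pres : ℕ → ℕ}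

/-- If an edge remained within `U`, some vertex of `U` would have exactly one neighbour there, that
is, degree `1`. -/
theorem pres_iff_of_done (h : PeelInv G U deg ns sz pres) (hG : G.IsTree)
    (hd : ∀ u : Fin n, deg u ≠ 1) (l : ℕ) : pres l = 1 ↔ l ∈ sideSet G := by
  classical
  rw [h.pres_iff, mem_sideSet]
  refine ⟨fun ⟨i, j, h1, _, h2⟩ => ⟨i, j, h1, h2⟩, fun ⟨i, j, h1, h2⟩ => ⟨i, j, h1, ?_, h2⟩⟩
  rintro ⟨hi, hj⟩
  obtain ⟨v, hv, w, hw, huniq⟩ := exists_unique_neighbor hG (U : Set (Fin n)) hi hj h1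
  refine hd v ?_
  rw [h.deg_live v hv, Finset.card_eq_one]
  refine ⟨w, ?_⟩
  ext w'
  simp only [Finset.mem_inter, SimpleGraph.mem_neighborFinset, Finset.mem_singleton]
  exact ⟨fun h => huniq w' ⟨h.2, h.1⟩, fun h => h ▸ ⟨hw.2, hw.1⟩⟩

/-- Once the rest of its branch has been merged into the leaf `x`, the edge to its last neighbour
`p` has a side of size `sz x + 1`, and the other side is the complement. Removing `x` affects the
data of `p` only. -/
theorem step (h : PeelInv G U deg ns sz pres) (hG : G.IsTree) {x : Fin n} (hx : deg x = 1) :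
    ∃ p : Fin n, ns x = p ∧ x ∈ U ∧ (p : ℕ) ≠ x ∧ sz x + 1 < n ∧ sz p + (sz x + 1) ≤ n ∧
      ns p ≤ n * n ∧ deg p ≤ n ∧
      PeelInv G (U.erase x) (Function.update (Function.update deg x 0) p (deg p - 1))
        (Function.update ns p (ns p - x)) (Function.update sz p (sz p + (sz x + 1)))
        (Function.update (Function.update pres (sz x + 1) 1) (n - (sz x + 1)) 1) := by
  classical
  have hxU : x ∈ U := by
    by_contra hxU
    rw [h.deg_dead x hxU] at hx
    omega
  have hcard := h.deg_live x hxU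
  rw [hx] at hcard
  obtain ⟨p, hp⟩ := Finset.card_eq_one.1 hcard.symm
  have hpm : p ∈ G.neighborFinset x ∩ U := by rw [hp]; exact Finset.mem_singleton_self p
  rw [Finset.mem_inter, SimpleGraph.mem_neighborFinset] at hpm
  obtain ⟨hxp, hpU⟩ := hpm
  have hpx : p ≠ x := hxp.ne'
  have hns := h.ns_live x hxU
  have hsz := h.sz_live x hxU
  rw [hp, Finset.sum_singleton] at hns hsz
  have hadd := sideCard_add hG hxp
  rw [Fintype.card_fin] at hadd
  have hs1 : sz x + 1 = sideCard G p x := by omega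
  have hs2 : n - (sz x + 1) = sideCard G x p := by omega
  have hpos := sideCard_pos hxp
  have hmem : x ∈ G.neighborFinset p ∩ U := by simp [hxp.symm, hxU]
  have hera : G.neighborFinset p ∩ U.erase x = (G.neighborFinset p ∩ U).erase x := by
    ext w; simp only [Finset.mem_inter, Finset.mem_erase]; tauto
  have hother : ∀ u ∈ U.erase x, u ≠ p → G.neighborFinset u ∩ U.erase x = G.neighborFinset u ∩ U := by
    intro u hu hup
    ext w
    simp only [Finset.mem_inter, Finset.mem_erase, SimpleGraph.mem_neighborFinset]
    refine ⟨fun h => ⟨h.1, h.2.2⟩, fun h => ⟨h.1, ?_, h.2⟩⟩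
    rintro rfl
    have : u ∈ G.neighborFinset w ∩ U := by
      simp [h.1.symm, (Finset.mem_erase.1 hu).2]
    rw [hp, Finset.mem_singleton] at this
    exact hup this
  have hszp := h.sz_live p hpU
  rw [← Finset.add_sum_erase _ _ hmem] at hszp
  have hnsp := h.ns_live p hpU
  have hdegp := h.deg_live p hpU
  have hv : ∀ {u : Fin n}, u ≠ p → (u : ℕ) ≠ p := fun h h' => h (Fin.ext h')
  refine ⟨p, hns, hxU, fun h => hpx (Fin.ext h), by omega, by omega, ?_, ?_, ?_⟩
  · rw [hnsp]
    calc ∑ w ∈ G.neighborFinset p ∩ U, (w : ℕ) ≤ ∑ w : Fin n, n :=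
          (Finset.sum_le_sum_of_subset (Finset.subset_univ _)).trans
            (Finset.sum_le_sum fun w _ => w.2.le)
      _ = n * n := by simp
  · rw [hdegp]
    exact (Finset.card_le_univ _).trans_eq (Fintype.card_fin n)
  · constructor
    · intro u hu
      rcases eq_or_ne u p with rfl | hup
      · rw [Function.update_self, hera, Finset.card_erase_of_mem hmem, hdegp]
      · rw [Function.update_of_ne (hv hup), Function.update_of_ne, hother u hu hup,
          h.deg_live u (Finset.mem_erase.1 hu).2]
        exact fun h => (Finset.mem_erase.1 hu).1 (Fin.ext h)
    · intro u hu
      rcases eq_or_ne u p with rfl | hup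
      · rw [Function.update_self, hera, hnsp, ← Finset.add_sum_erase _ _ hmem,
          Nat.add_sub_cancel_left]
      · rw [Function.update_of_ne (hv hup), hother u hu hup,
          h.ns_live u (Finset.mem_erase.1 hu).2]
    · intro u hu
      rcases eq_or_ne u p with rfl | hup
      · rw [Function.update_self, hera]
        omega
      · rw [Function.update_of_ne (hv hup), hother u hu hup,
          h.sz_live u (Finset.mem_erase.1 hu).2]
    · intro u hu
      have hup : u ≠ p := by
        rintro rfl
        exact hu (Finset.mem_erase.2 ⟨hpx, hpU⟩)
      rw [Function.update_of_ne (hv hup)]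
      rcases eq_or_ne u x with rfl | hux
      · rw [Function.update_self]
      · rw [Function.update_of_ne fun h => hux (Fin.ext h), h.deg_dead u]
        exact fun h => hu (Finset.mem_erase.2 ⟨hux, h⟩)
    · intro l
      rw [hs1] at *
      rw [hs2]
      have hl : Function.update (Function.update pres (sideCard G p x) 1) (sideCard G x p) 1 l = 1 ↔
          l = sideCard G x p ∨ l = sideCard G p x ∨ pres l = 1 := by
        rw [Function.update_apply, Function.update_apply]
        grind
      rw [hl, h.pres_iff]
      constructor
      · rintro (rfl | rfl | ⟨i, j, hij, hU, rfl⟩)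
        · exact ⟨x, p, hxp, by simp, rfl⟩
        · exact ⟨p, x, hxp.symm, by simp, rfl⟩
        · exact ⟨i, j, hij, fun h => hU ⟨(Finset.mem_erase.1 h.1).2, (Finset.mem_erase.1 h.2).2⟩, rfl⟩
      · rintro ⟨i, j, hij, hU, rfl⟩
        by_cases hU' : i ∈ U ∧ j ∈ U
        · have huniq : ∀ w, G.Adj x w → w ∈ U → w = p := by
            intro w h1 h2
            have : w ∈ G.neighborFinset x ∩ U := by simp [h1, h2]
            rwa [hp, Finset.mem_singleton] at this
          rcases eq_or_ne i x with rfl | hix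
          · rw [huniq j hij hU'.2]; exact Or.inl rfl
          · rcases eq_or_ne j x with rfl | hjx
            · rw [huniq i hij.symm hU'.1]; exact Or.inr (Or.inl rfl)
            · exact absurd ⟨Finset.mem_erase.2 ⟨hix, hU'.1⟩, Finset.mem_erase.2 ⟨hjx, hU'.2⟩⟩ hU
        · exact Or.inr (Or.inr ⟨i, j, hij, hU', rfl⟩)

end PeelInv

/-- Removes leaves as long as vertex `w` is a leaf, moving `w` to the neighbour of the leaf. -/
def peelFromProg : Prog :=
  .loop (.eq (.read 4 (evar 15)) (.lit 1))
    (.seq (.write 23 (.lit 0) (.read 5 (evar 15)))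
    (.seq (.write 17 (.lit 0) (.add (.read 6 (evar 15)) (.lit 1)))
    (.seq (.write 7 (evar 17) (.lit 1))
    (.seq (.write 7 (.sub (evar 0) (evar 17)) (.lit 1))
    (.seq (.write 6 (evar 23) (.add (.read 6 (evar 23)) (evar 17)))
    (.seq (.write 4 (evar 15) (.lit 0))
    (.seq (.write 4 (evar 23) (.sub (.read 4 (evar 23)) (.lit 1)))
    (.seq (.write 5 (evar 23) (.sub (.read 5 (evar 23)) (evar 15)))
    (.write 15 (.lit 0) (evar 23))))))))))

/-- Marks the sizes of all sides of edges of a tree by peeling off leaves. -/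
def peelProg : Prog :=
  .seq (.write 14 (.lit 0) (.lit 0))
    (.loop (.lt (evar 14) (evar 0))
      (.seq (.write 15 (.lit 0) (evar 14))
      (.seq peelFromProg
      (.write 14 (.lit 0) (.add (evar 14) (.lit 1))))))

theorem wp_peelFromProg {W : ℕ} (s : St) (T : ℕ) {G : SimpleGraph (Fin s.n)} (hG : G.IsTree)
    (hW : 4 * s.n * s.n + 4 * s.n + s.k + 4 ≤ W) {U : Finset (Fin s.n)} {i : ℕ} (hi : i < s.n)
    (hp : PeelInv G U s.deg s.ns s.sz s.pres) (hw : s.w = i)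
    (hdone : ∀ u : Fin s.n, (u : ℕ) < i → s.deg u ≠ 1) :
    WP W peelFromProg (fun s' T' => ∃ (w z m : ℕ) (deg ns sz pres : ℕ → ℕ) (U' : Finset (Fin s.n)),
      s' = { s with w := w, z := z, m := m, deg := deg, ns := ns, sz := sz, pres := pres } ∧
      PeelInv G U' deg ns sz pres ∧ (∀ u : Fin s.n, (u : ℕ) < i + 1 → deg u ≠ 1) ∧
      T' + 100 * U'.card ≤ T + 100 * U.card + 6) s T := by
  subst hw
  -- Removing a leaf can create a new leaf only at its neighbour, so among the scanned vertices only
  -- the current `w` can be a leaf. The term `100 * U'.card` is a potential that pays for the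
  -- removals, each of at most `100` steps.
  refine WP.loop (I := fun s' T' =>
    ∃ (w : Fin s.n) (z m : ℕ) (deg ns sz pres : ℕ → ℕ) (U' : Finset (Fin s.n)),
      s' = { s with w := w, z := z, m := m, deg := deg, ns := ns, sz := sz, pres := pres } ∧
      PeelInv G U' deg ns sz pres ∧ (∀ u : Fin s.n, (u : ℕ) < s.w + 1 → u ≠ w → deg u ≠ 1) ∧
      T' + 100 * U'.card ≤ T + 100 * U.card) (T + 100 * U.card) ?_ ?_ ?_ ?_
  · refine ⟨⟨s.w, hi⟩, s.z, s.m, s.deg, s.ns, s.sz, s.pres, U, rfl, hp, fun u hu hne => ?_,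
      le_rfl⟩
    refine hdone u ?_
    have : (u : ℕ) ≠ s.w := fun h => hne (Fin.ext h)
    omega
  · rintro s' T' ⟨w, z, m, deg, ns, sz, pres, U', -, -, -, h⟩
    omega
  · rintro s' T' ⟨w, z, m, deg, ns, sz, pres, U', rfl, hp', hd, hT⟩ hb
    simp only [Test.Holds, Expr.eval, eval_evar, St.mem_deg, St.mem_w, cells_zero] at hb
    obtain ⟨p, e1, hwU, hpw, hsz, hszp, hnsp, hdegp, hstep⟩ := hp'.step hG hb
    have hpn := p.2
    have hwn := w.2
    have hassoc : 4 * s.n * s.n = 4 * (s.n * s.n) := by ring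
    refine .seq (.write_z ?_ (.seq (.write_m ?_ (.seq (.write_pres ?_ ?_ (.seq (.write_pres ?_ ?_
      (.seq (.write_sz ?_ ?_ (.seq (.write_deg ?_ ?_ (.seq (.write_deg ?_ ?_ (.seq (.write_ns ?_ ?_
      (.write_w ?_ ?_))))))))))))))))
    all_goals simp only [Expr.eval, Expr.cost, Test.cost, eval_evar, cost_evar, St.mem_in,
      St.mem_w, St.mem_z, St.mem_m, St.mem_sz, St.mem_deg, St.mem_ns, cells_zero, e1,
      Function.update_of_ne hpw]
    iterate 15 omega
    refine ⟨p, _, _, _, _, _, _, U'.erase w, rfl, hstep, fun u hu hup => ?_, ?_⟩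
    · rw [Function.update_of_ne fun h => hup (Fin.ext h)]
      rcases eq_or_ne u w with rfl | huw
      · rw [Function.update_self]; omega
      · rw [Function.update_of_ne fun h => huw (Fin.ext h)]
        exact hd u hu huw
    · have := Finset.card_erase_add_one hwU
      omega
  · rintro s' T' ⟨w, z, m, deg, ns, sz, pres, U', rfl, hp', hd, hT⟩ hb
    simp only [Test.Holds, Expr.eval, eval_evar, St.mem_deg, St.mem_w, cells_zero] at hb
    refine ⟨w, z, m, deg, ns, sz, pres, U', rfl, hp', fun u hu => ?_, ?_⟩
    · rcases eq_or_ne u w with rfl | huw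
      · exact hb
      · exact hd u hu huw
    · simp only [Expr.cost, Test.cost, cost_evar]
      omega

open Classical in
theorem wp_peelProg {W : ℕ} (s : St) (T : ℕ) {G : SimpleGraph (Fin s.n)} (hG : G.IsTree)
    (hW : 4 * s.n * s.n + 4 * s.n + s.k + 4 ≤ W)
    (hu : ∀ u : Fin s.n, s.deg u = (G.neighborFinset u).card ∧
        s.ns u = ∑ w ∈ G.neighborFinset u, (w : ℕ))
    (hsz : s.sz = fun _ => 0) (hpres : s.pres = fun _ => 0) :
    WP W peelProg (fun s' T' => (∃ (v w z m : ℕ) (deg ns sz pres : ℕ → ℕ),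
      s' = { s with v := v, w := w, z := z, m := m, deg := deg, ns := ns, sz := sz, pres := pres } ∧
      ∀ l, pres l = 1 ↔ l ∈ sideSet G) ∧ T' ≤ T + 200 * s.n + 10) s T := by
  refine .seq (.write_v ?_ ?_)
  · simp [Expr.eval]
  -- A single scan may remove many leaves, but the potential bounds all removals together by `100
  -- n`; the scan itself takes another `100 n`.
  refine (WP.loop (I := fun s' T' =>
    ∃ (i : ℕ) (w z m : ℕ) (deg ns sz pres : ℕ → ℕ) (U : Finset (Fin s.n)), i ≤ s.n ∧
      s' = { s with
        v := i, w := w, z := z, m := m, deg := deg, ns := ns, sz := sz, pres := pres } ∧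
      PeelInv G U deg ns sz pres ∧ (∀ u : Fin s.n, (u : ℕ) < i → deg u ≠ 1) ∧
      T' + 100 * U.card + 100 * (s.n - i) ≤ T + 200 * s.n + 3) (T + 200 * s.n + 3) ?_ ?_ ?_ ?_)
  · refine ⟨0, s.w, s.z, s.m, s.deg, s.ns, s.sz, s.pres, Finset.univ, Nat.zero_le _, rfl,
      ⟨?_, ?_, ?_, ?_, ?_⟩, fun u hu => absurd hu (Nat.not_lt_zero _), ?_⟩
    · intro u _
      rw [Finset.inter_univ]; convert (hu u).1
    · intro u _
      rw [Finset.inter_univ]; convert (hu u).2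
    · intro u _
      have h0 : s.sz u = 0 := by rw [hsz]
      rw [Finset.inter_univ, h0]
      have := sum_sideCard hG u
      rw [Fintype.card_fin] at this
      omega
    · intro u hu
      exact absurd (Finset.mem_univ u) hu
    · intro l
      rw [hpres]
      simp
    · rw [Finset.card_univ, Fintype.card_fin]
      simp only [Expr.cost]
      omega
  · rintro s' T' ⟨i, w, z, m, deg, ns, sz, pres, U, -, -, -, -, h⟩
    omega
  · rintro s' T' ⟨i, w, z, m, deg, ns, sz, pres, U, hi, rfl, hp, hd, hT⟩ hb
    simp only [Test.Holds, eval_evar, St.mem_v, St.mem_in, cells_zero] at hb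
    refine .seq (.write_w ?_ (.seq (WP.mono (wp_peelFromProg { s with
        v := i, w := i, z := z, m := m, deg := deg, ns := ns, sz := sz, pres := pres }
        _ hG hW hb hp rfl hd) ?_)))
    · simp only [eval_evar, St.mem_v, cells_zero]; omega
    · rintro s' T' ⟨w', z', m', deg', ns', sz', pres', U', rfl, hp', hd', hT'⟩
      refine .write_v ?_ ⟨i + 1, w', z', m', deg', ns', sz', pres', U', hb, rfl, hp', hd', ?_⟩
      · simp only [Expr.eval, eval_evar, St.mem_v, cells_zero]; omega
      · simp only [Expr.cost, Test.cost, cost_evar] at hT' ⊢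
        omega
  · rintro s' T' ⟨i, w, z, m, deg, ns, sz, pres, U, hi, rfl, hp, hd, hT⟩ hb
    simp only [Test.Holds, eval_evar, St.mem_v, St.mem_in, cells_zero] at hb
    refine ⟨⟨i, w, z, m, deg, ns, sz, pres, rfl,
      hp.pres_iff_of_done hG fun u => hd u (by omega)⟩, ?_⟩
    simp only [Test.cost, cost_evar]
    omega

/-! ### Lists in arrays -/

/-- The first `t` entries of `f` list the elements of `S`, without repetition. -/
structure Enumerates {α : Type*} [DecidableEq α] (f : ℕ → α) (t : ℕ) (S : Finset α) : Prop where
  image_eq : (Finset.range t).image f = S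
  card_eq : S.card = t

namespace Enumerates

variable {α : Type*} [DecidableEq α] {f : ℕ → α} {t : ℕ} {S : Finset α}

theorem zero (f : ℕ → α) : Enumerates f 0 ∅ := ⟨by simp, by simp⟩

theorem mem (h : Enumerates f t S) {a : ℕ} (ha : a < t) : f a ∈ S := by
  rw [← h.image_eq]
  exact Finset.mem_image_of_mem _ (Finset.mem_range.2 ha)

theorem exists_eq (h : Enumerates f t S) {y : α} (hy : y ∈ S) : ∃ a < t, f a = y := by
  rw [← h.image_eq] at hy
  simpa using hy

theorem injOn (h : Enumerates f t S) : Set.InjOn f (Finset.range t) := by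
  refine Finset.card_image_iff.1 ?_
  rw [h.image_eq, h.card_eq, Finset.card_range]

theorem congr (h : Enumerates f t S) {g : ℕ → α} (hg : ∀ a < t, g a = f a) : Enumerates g t S := by
  refine ⟨?_, h.card_eq⟩
  rw [← h.image_eq]
  exact Finset.image_congr fun a ha => hg a (by simpa using ha)

theorem push (h : Enumerates f t S) {y : α} (hy : y ∉ S) {g : ℕ → α} (hg : ∀ a < t, g a = f a)
    (hgt : g t = y) : Enumerates g (t + 1) (insert y S) := by
  refine ⟨?_, ?_⟩
  · rw [Finset.range_add_one, Finset.image_insert, (h.congr hg).image_eq, hgt]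
  · rw [Finset.card_insert_of_notMem hy, h.card_eq]

end Enumerates

/-- Lists the marked numbers. -/
def listProg : Prog :=
  .seq (.write 14 (.lit 0) (.lit 0))
    (.loop (.lt (evar 14) (evar 0))
      (.seq
        (.branch (.eq (.read 7 (evar 14)) (.lit 1))
          (.seq (.write 8 (evar 16) (evar 14))
            (.write 16 (.lit 0) (.add (evar 16) (.lit 1))))
          .skip)
        (.write 14 (.lit 0) (.add (evar 14) (.lit 1)))))

theorem wp_listProg {W : ℕ} (s : St) (T : ℕ) (hW : 4 * s.n * s.n + 4 * s.n + s.k + 4 ≤ W)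
    {L : Finset ℕ} (hpres : ∀ l, s.pres l = 1 ↔ l ∈ L) (hL : ∀ l ∈ L, l < s.n) (ht : s.t = 0) :
    WP W listProg (fun s' T' => (∃ v lst, s' = { s with v := v, lst := lst, t := L.card } ∧
      Enumerates lst L.card L) ∧ T' ≤ T + 100 * s.n + 10) s T := by
  refine .seq (.write_v ?_ ?_)
  · simp [Expr.eval]
  refine (WP.loop_count s.n 50 (fun i s' => ∃ lst t,
    s' = { s with v := i, lst := lst, t := t } ∧ t ≤ i ∧ Enumerates lst t (L.filter (· < i)))
    ?_ ?_ ?_).mono ?_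
  · refine ⟨s.lst, 0, by rw [← ht]; rfl, le_rfl, ?_⟩
    simpa using Enumerates.zero s.lst
  · rintro i s' hi ⟨lst, t, rfl, -⟩
    simp only [Test.Holds, eval_evar, St.mem_v, St.mem_in, cells_zero]
  · rintro i s' T hi ⟨lst, t, rfl, hti, hen⟩
    have hfil : L.filter (· < i + 1) = if i ∈ L then insert i (L.filter (· < i))
        else L.filter (· < i) := by
      ext l
      split_ifs with h
      · simp only [Finset.mem_filter, Finset.mem_insert]
        constructor
        · rintro ⟨h1, h2⟩
          rcases Nat.lt_succ_iff_lt_or_eq.1 h2 with h3 | h3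
          · exact Or.inr ⟨h1, h3⟩
          · exact Or.inl h3
        · rintro (rfl | ⟨h1, h2⟩)
          · exact ⟨h, by omega⟩
          · exact ⟨h1, by omega⟩
      · simp only [Finset.mem_filter]
        constructor
        · rintro ⟨h1, h2⟩
          have : l ≠ i := fun e => h (e ▸ h1)
          exact ⟨h1, by omega⟩
        · rintro ⟨h1, h2⟩
          exact ⟨h1, by omega⟩
    refine .seq (.branch (fun hb => ?_) fun hb => ?_)
    · simp only [Test.Holds, Expr.eval, eval_evar, St.mem_v, St.mem_pres, cells_zero,
        hpres] at hb
      refine .seq (.write_lst ?_ ?_ (.write_t ?_ (.write_v ?_ ⟨⟨_, t + 1, rfl, ?_, ?_⟩, ?_⟩)))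
      all_goals try simp only [Expr.eval, Expr.cost, Test.cost, eval_evar, cost_evar, St.mem_v,
        St.mem_t, cells_zero]
      iterate 5 omega
      · rw [hfil, if_pos hb]
        refine hen.push (by simp) (fun a ha => ?_) ?_
        · rw [Function.update_of_ne (by omega)]
        · rw [Function.update_self]
      · omega
    · simp only [Test.Holds, Expr.eval, eval_evar, St.mem_v, St.mem_pres, cells_zero,
        hpres] at hb
      refine .skip (.write_v ?_ ⟨⟨lst, t, rfl, ?_, ?_⟩, ?_⟩)
      all_goals try simp only [Expr.eval, Expr.cost, Test.cost, eval_evar, cost_evar, St.mem_v,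
        cells_zero]
      iterate 2 omega
      · rw [hfil, if_neg hb]
        exact hen
      · omega
  · rintro s' T' ⟨⟨lst, t, rfl, -, hen⟩, hT⟩
    rw [Finset.filter_true_of_mem hL] at hen
    obtain rfl := hen.card_eq
    refine ⟨⟨_, lst, rfl, hen⟩, ?_⟩
    simp only [Expr.cost, Test.cost, cost_evar] at hT
    omega

/-! ### Candidates for the resilience -/

section Candidates

variable {n : ℕ} {L : Finset ℕ} {K : Finset (ZMod n)}

theorem natCast_injOn (n : ℕ) : Set.InjOn (fun a : ℕ => (a : ZMod n)) {a | a < n} := by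
  intro a ha b hb h
  have := (ZMod.natCast_eq_natCast_iff' a b n).1 h
  rwa [Nat.mod_eq_of_lt ha, Nat.mod_eq_of_lt hb] at this

theorem nbhd_insert (z : ZMod n) : nbhd L (insert z K) = nbhd L K ∪ nbhd L {z} := by
  ext y
  simp only [mem_nbhd, Finset.mem_insert, Finset.mem_union, Finset.mem_singleton]
  constructor
  · rintro ⟨x, rfl | hx, h⟩
    · exact Or.inr ⟨x, rfl, h⟩
    · exact Or.inl ⟨x, hx, h⟩
  · rintro (⟨x, hx, h⟩ | ⟨x, rfl, h⟩)
    · exact ⟨x, Or.inr hx, h⟩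
    · exact ⟨x, Or.inl rfl, h⟩

theorem nbhd_singleton (z : ZMod n) : nbhd L {z} = L.image fun l : ℕ => z + (l : ZMod n) := by
  ext y; simp only [mem_nbhd, Finset.mem_singleton, exists_eq_left, Finset.mem_image]

/-- `L` is a set of nonzero residues modulo `n` that is closed under negation. -/
def IsSymmetric (n : ℕ) (L : Finset ℕ) : Prop := ∀ l ∈ L, 0 < l ∧ l < n ∧ n - l ∈ L

theorem card_nbhd_singleton (hL : IsSymmetric n L) (z : ZMod n) : (nbhd L {z}).card = L.card := by
  rw [nbhd_singleton, Finset.card_image_of_injOn]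
  intro a ha b hb h
  exact natCast_injOn n (hL a ha).2.1 (hL b hb).2.1 (add_left_cancel h)

theorem mem_nbhd_singleton_comm (hL : IsSymmetric n L) {y z : ZMod n} (h : y ∈ nbhd L {z}) :
    z ∈ nbhd L {y} := by
  simp only [mem_nbhd, Finset.mem_singleton, exists_eq_left] at *
  obtain ⟨l, hl, rfl⟩ := h
  refine ⟨n - l, (hL l hl).2.2, ?_⟩
  rw [Nat.cast_sub (hL l hl).2.1.le, ZMod.natCast_self]
  ring

theorem notMem_nbhd_singleton (hL : IsSymmetric n L) (z : ZMod n) : z ∉ nbhd L {z} := by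
  simp only [mem_nbhd, Finset.mem_singleton, exists_eq_left]
  rintro ⟨l, hl, h⟩
  rw [add_eq_left, ZMod.natCast_eq_zero_iff] at h
  have := hL l hl
  exact absurd (Nat.le_of_dvd this.1 h) (by omega)

theorem card_nbhd_le (K : Finset (ZMod n)) : (nbhd L K).card ≤ K.card * L.card :=
  Finset.card_image₂_le _ _ _

/-- Meeting is symmetric and no token meets itself, so independence of the enlarged set only
requires that `z` avoid the tokens met by `K`. -/
theorem disjoint_insert_nbhd_iff (hL : IsSymmetric n L) {z : ZMod n} :
    Disjoint (insert z K) (nbhd L (insert z K)) ↔ Disjoint K (nbhd L K) ∧ z ∉ nbhd L K := by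
  have key : ∀ {x}, x ∈ K → x ∈ nbhd L {z} → z ∈ nbhd L K := by
    intro x hx h
    obtain ⟨y, hy, l, hl, rfl⟩ := mem_nbhd.1 (mem_nbhd_singleton_comm hL h)
    rw [Finset.mem_singleton] at hy
    exact mem_nbhd.2 ⟨x, hx, l, hl, by rw [hy]⟩
  rw [nbhd_insert, Finset.disjoint_insert_left, Finset.disjoint_union_right, Finset.mem_union]
  constructor
  · rintro ⟨h1, h2, -⟩
    exact ⟨h2, fun h => h1 (Or.inl h)⟩
  · rintro ⟨h1, h2⟩
    refine ⟨fun h => h.elim h2 (notMem_nbhd_singleton hL z), h1, ?_⟩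
    exact Finset.disjoint_left.2 fun x hx h => h2 (key hx h)

/-- The numbers of robots to be removed so that the tokens of `K` and one more token starve, if `K`
is a set of `m` tokens that do not meet. -/
def candidates (L : Finset ℕ) (m : ℕ) (K : Finset (ZMod n)) : Set ℕ :=
  {c | K.card = m ∧ Disjoint K (nbhd L K) ∧
    ∃ z, z ∉ K ∧ z ∉ nbhd L K ∧ c = (nbhd L (insert z K)).card}

/-- By inclusion and exclusion, the best additional token is one that shares the most neighbours
with `K`. -/
theorem card_nbhd_insert (hL : IsSymmetric n L) (z : ZMod n) :
    (nbhd L (insert z K)).card =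
      (nbhd L K).card + L.card - (nbhd L K ∩ nbhd L {z}).card := by
  rw [nbhd_insert, Finset.card_union, card_nbhd_singleton hL]

/-- The number of representations of `z` as the sum of an element of `N` and an element of `L`. -/
theorem sum_ite_eq_card_inter (hL : IsSymmetric n L) (N : Finset (ZMod n)) (z : ZMod n) :
    (∑ y ∈ N, ∑ l ∈ L, if y + (l : ZMod n) = z then 1 else 0) = (N ∩ nbhd L {z}).card := by
  classical
  -- At most one `l ∈ L` leads from `y` to `z`, because elements of `L` are distinct modulo `n`.
  have h : ∀ y, (∑ l ∈ L, if y + (l : ZMod n) = z then 1 else 0) =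
      if y ∈ nbhd L {z} then 1 else 0 := by
    intro y
    split_ifs with hy
    · have hz := mem_nbhd_singleton_comm hL hy
      obtain ⟨x, hx, l, hl, hxl⟩ := mem_nbhd.1 hz
      rw [Finset.mem_singleton] at hx
      subst hx
      rw [Finset.sum_eq_single_of_mem l hl, if_pos hxl]
      intro b hb hbl
      refine if_neg fun h => hbl ?_
      exact natCast_injOn n (hL b hb).2.1 (hL l hl).2.1 (add_left_cancel (h.trans hxl.symm))
    · refine Finset.sum_eq_zero fun l hl => if_neg fun h => hy ?_
      exact mem_nbhd_singleton_comm hL (mem_nbhd.2 ⟨y, Finset.mem_singleton_self y, l, hl, h⟩)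
  simp only [h]
  rw [Finset.sum_ite_mem, Finset.card_eq_sum_ones]

/-- The best choice of one more token. -/
theorem isLeast_candidates [NeZero n] (hL : IsSymmetric n L) {m mx : ℕ} (hK : K.card = m)
    (hd : Disjoint K (nbhd L K)) (hlt : m + (nbhd L K).card < n)
    (hle : ∀ z, z ∉ K → z ∉ nbhd L K → (nbhd L K ∩ nbhd L {z}).card ≤ mx)
    (hmx : mx = 0 ∨ ∃ z, z ∉ K ∧ z ∉ nbhd L K ∧ (nbhd L K ∩ nbhd L {z}).card = mx) :
    IsLeast (candidates L m K) ((nbhd L K).card + L.card - mx) := by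
  constructor
  · obtain ⟨z, hz1, hz2, hz3⟩ : ∃ z, z ∉ K ∧ z ∉ nbhd L K ∧
        (nbhd L K ∩ nbhd L {z}).card = mx := by
      -- A maximum `0` may mean that no token was counted at all. Then the cardinality condition
      -- provides an admissible token, and its overlap is `0`.
      rcases hmx with h | h
      · have hcard : (K ∪ nbhd L K).card < (Finset.univ : Finset (ZMod n)).card := by
          rw [Finset.card_univ, ZMod.card]
          exact (Finset.card_union_le _ _).trans_lt (hK ▸ hlt)
        obtain ⟨z, -, hz⟩ := Finset.exists_mem_notMem_of_card_lt_card hcard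
        rw [Finset.mem_union, not_or] at hz
        have := hle z hz.1 hz.2
        exact ⟨z, hz.1, hz.2, by omega⟩
      · exact h
    exact ⟨hK, hd, z, hz1, hz2, by rw [card_nbhd_insert hL, hz3]⟩
  · rintro _ ⟨-, -, z, hz1, hz2, rfl⟩
    rw [card_nbhd_insert hL]
    have := hle z hz1 hz2
    omega

theorem candidates_eq_empty [NeZero n] {m : ℕ}
    (h : ¬ ((K.card = m ∧ Disjoint K (nbhd L K)) ∧ m + (nbhd L K).card < n)) :
    candidates L m K = ∅ := by
  refine Set.eq_empty_of_forall_notMem ?_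
  rintro c ⟨hK, hd, z, hz1, hz2, -⟩
  refine h ⟨⟨hK, hd⟩, ?_⟩
  have hz : z ∉ K ∪ nbhd L K := by simp [hz1, hz2]
  have := Finset.card_lt_univ_of_notMem hz
  rwa [Finset.card_union_of_disjoint hd, ZMod.card, hK] at this

/-! ### Reduction to sets that contain `0`, and the running minimum -/

/-- The set that consists of `0` and of the entries of a tuple. -/
def tupleSet {r : ℕ} (f : Fin r → Fin n) : Finset (ZMod n) :=
  insert 0 (Finset.univ.image fun i => ((f i : ℕ) : ZMod n))

theorem image_range_eq_tupleSet {r : ℕ} {f : Fin r → Fin n} {x : ℕ → ℕ} (h0 : x 0 = 0)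
    (hx : ∀ i : Fin r, x (i + 1) = f i) :
    (Finset.range (r + 1)).image (fun q => (x q : ZMod n)) = tupleSet f := by
  ext y
  simp only [tupleSet, Finset.mem_image, Finset.mem_range, Finset.mem_insert, Finset.mem_univ,
    true_and]
  constructor
  · rintro ⟨q, hq, rfl⟩
    rcases q with _ | q
    · left; rw [h0, Nat.cast_zero]
    · right; exact ⟨⟨q, by omega⟩, by rw [← hx]⟩
  · rintro (rfl | ⟨i, rfl⟩)
    · exact ⟨0, by omega, by rw [h0, Nat.cast_zero]⟩
    · exact ⟨i + 1, by omega, by rw [hx]⟩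

theorem exists_tupleSet_eq [NeZero n] {r : ℕ} (hK : K.card = r + 1) (h0 : 0 ∈ K) :
    ∃ f : Fin r → Fin n, tupleSet f = K := by
  have hc : (K.erase 0).card = r := by rw [Finset.card_erase_of_mem h0, hK]; rfl
  let e := (K.erase 0).equivFinOfCardEq hc
  refine ⟨fun i => ⟨(e.symm i : ZMod n).val, ZMod.val_lt _⟩, ?_⟩
  refine Eq.trans ?_ (Finset.insert_erase h0)
  rw [tupleSet]
  congr 1
  ext y
  simp only [Finset.mem_image, Finset.mem_univ, true_and, ZMod.natCast_zmod_val]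
  constructor
  · rintro ⟨i, rfl⟩
    exact (e.symm i).2
  · intro hy
    exact ⟨e ⟨y, hy⟩, by simp⟩

theorem nbhd_image_add (c : ZMod n) :
    nbhd L (K.image (· + c)) = (nbhd L K).image (· + c) := by
  ext y
  simp only [mem_nbhd, Finset.mem_image]
  constructor
  · rintro ⟨_, ⟨x, hx, rfl⟩, l, hl, rfl⟩
    exact ⟨x + l, ⟨x, hx, l, hl, rfl⟩, by ring⟩
  · rintro ⟨_, ⟨x, hx, l, hl, rfl⟩, rfl⟩
    exact ⟨x + c, ⟨x, hx, rfl⟩, l, hl, by ring⟩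

/-- Translations preserve independence and the size of the neighbourhood, so `0` may be assumed to
be an element. Another element is left to the optimal choice in `candidates`, and `r = k - 2`
entries remain. Tuples with repeated or zero entries are harmless, since `candidates` demands the
right cardinality. -/
theorem sInf_eq_sInf_candidates [NeZero n] (hL : IsSymmetric n L) (r : ℕ) :
    sInf {m : ℕ∞ | ∃ K : Finset (ZMod n), K.card = r + 2 ∧ Disjoint K (nbhd L K) ∧
      m = (nbhd L K).card} =
    sInf ((fun c : ℕ => (c : ℕ∞)) '' {c | ∃ f : Fin r → Fin n,
      c ∈ candidates L (r + 1) (tupleSet f)}) := by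
  congr 1
  ext m
  constructor
  · rintro ⟨K, hK, hd, rfl⟩
    obtain ⟨x, hx⟩ : K.Nonempty := Finset.card_pos.1 (by omega)
    have hinj : Function.Injective (· + (-x) : ZMod n → ZMod n) := add_left_injective _
    set K₀ := K.image (· + (-x)) with hK₀
    have hc0 : K₀.card = r + 2 := by rw [hK₀, Finset.card_image_of_injective _ hinj, hK]
    have h0 : 0 ∈ K₀ := Finset.mem_image.2 ⟨x, hx, by ring⟩
    have hn0 : (nbhd L K₀).card = (nbhd L K).card := by
      rw [hK₀, nbhd_image_add, Finset.card_image_of_injective _ hinj]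
    have hd0 : Disjoint K₀ (nbhd L K₀) := by
      rw [hK₀, nbhd_image_add, Finset.disjoint_image hinj]
      exact hd
    -- The element split off must not be `0`, which has to stay in the tuple set.
    obtain ⟨z, hz, hz0⟩ := Finset.exists_mem_ne (by omega : 1 < K₀.card) 0
    have hins : insert z (K₀.erase z) = K₀ := Finset.insert_erase hz
    obtain ⟨f, hf⟩ := exists_tupleSet_eq (r := r) (K := K₀.erase z)
      (by rw [Finset.card_erase_of_mem hz, hc0]; rfl) (Finset.mem_erase.2 ⟨hz0.symm, h0⟩)
    rw [← hins, disjoint_insert_nbhd_iff hL] at hd0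
    refine ⟨_, ⟨f, ?_, ?_, z, ?_, ?_, rfl⟩, ?_⟩ <;> rw [hf]
    · rw [Finset.card_erase_of_mem hz, hc0]; rfl
    · exact hd0.1
    · exact Finset.notMem_erase z K₀
    · exact hd0.2
    · simp only [hins, hn0]
  · rintro ⟨_, ⟨f, hc, hd, z, hz1, hz2, rfl⟩, rfl⟩
    exact ⟨_, by rw [Finset.card_insert_of_notMem hz1, hc],
      (disjoint_insert_nbhd_iff hL).2 ⟨hd, hz2⟩, rfl⟩

/-- The output cells `flag` and `val` describe the minimum of `Z`. -/
def IsBest (Z : Set ℕ) (flag val : ℕ) : Prop := flag = 0 ∧ Z = ∅ ∨ flag = 1 ∧ IsLeast Z val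

theorem IsBest.eq_sInf {Z : Set ℕ} {flag val : ℕ} (h : IsBest Z flag val) :
    (if flag = 0 then ⊤ else (val : ℕ∞)) = sInf ((fun c : ℕ => (c : ℕ∞)) '' Z) := by
  rcases h with ⟨rfl, rfl⟩ | ⟨rfl, h⟩
  · simp
  · rw [if_neg one_ne_zero]
    refine le_antisymm (le_sInf ?_) (sInf_le ⟨val, h.1, rfl⟩)
    rintro _ ⟨c, hc, rfl⟩
    exact Nat.cast_le.2 (h.2 hc)

theorem IsBest.update {Z Z' : Set ℕ} {flag val c : ℕ} (h : IsBest Z flag val)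
    (hc : IsLeast Z' c) : IsBest (Z ∪ Z') 1 (if flag ≠ 0 ∧ val ≤ c then val else c) := by
  rcases h with ⟨rfl, rfl⟩ | ⟨rfl, h⟩
  · right
    simpa using hc
  · right
    refine ⟨rfl, ?_⟩
    have := h.union hc
    rcases le_total val c with hvc | hvc
    · simpa [hvc] using this
    · rw [min_eq_right hvc] at this
      split_ifs with h'
      · rwa [le_antisymm h'.2 hvc]
      · exact this

end Candidates

/-! ### Loops over lists -/

/-- Executes `P` for all `a < t`. -/
def forA (P : Prog) : Prog :=
  .seq (.write 21 (.lit 0) (.lit 0)) (.loop (.lt (evar 21) (evar 16))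
    (.seq P (.write 21 (.lit 0) (.add (evar 21) (.lit 1)))))

/-- Executes `P` for `q = 0, 1, 2, …` as long as `b` holds. -/
def forQ (b : Test) (P : Prog) : Prog :=
  .seq (.write 20 (.lit 0) (.lit 0)) (.loop b
    (.seq P (.write 20 (.lit 0) (.add (evar 20) (.lit 1)))))

theorem wp_forA {W : ℕ} {P : Prog} {s : St} {T : ℕ} (t B : ℕ) (J : ℕ → St → Prop)
    (hJ : ∀ i s', J i s' → s'.t = t ∧ s'.a = i) (htW : t ≤ W) (h0 : J 0 { s with a := 0 })
    (hstep : ∀ i s' T, i < t → J i s' →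
      WP W P (fun s'' T' => J (i + 1) { s'' with a := s''.a + 1 } ∧ T' ≤ T + B) s' T) :
    WP W (forA P) (fun s' T' => J t s' ∧ T' ≤ T + t * (B + 20) + 20) s T := by
  refine .seq (.write_a (by simp [Expr.eval]) ((WP.loop_count t (B + 6) J h0 ?_ ?_).mono ?_))
  · intro i s' hi hs
    obtain ⟨h1, h2⟩ := hJ i s' hs
    simp only [Test.Holds, eval_evar, St.mem_a, St.mem_t, cells_zero, h1, h2]
  · intro i s' T hi hs
    refine .seq ((hstep i s' T hi hs).mono ?_)
    rintro s'' T' ⟨h1, h2⟩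
    have h3 := (hJ _ _ h1).2
    simp only at h3
    refine .write_a ?_ ⟨?_, ?_⟩
    · simp only [Expr.eval, eval_evar, St.mem_a, cells_zero]; omega
    · simpa only [Expr.eval, eval_evar, St.mem_a, cells_zero] using h1
    · simp only [Expr.cost, cost_evar]; omega
  · rintro s' T' ⟨h1, h2⟩
    refine ⟨h1, h2.trans ?_⟩
    simp only [Expr.cost, Test.cost, cost_evar]
    have := Nat.mul_le_mul_left t (show B + 6 + (2 + 2 + 1 + 1) ≤ B + 20 by omega)
    omega

theorem wp_forQ {W : ℕ} {P : Prog} {s : St} {T : ℕ} {b : Test} (N B : ℕ) (J : ℕ → St → Prop)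
    (hJ : ∀ i s', i ≤ N → J i s' → (b.Holds s'.mem ↔ i < N) ∧ s'.q = i) (hNW : N ≤ W)
    (hb : b.cost ≤ 10) (h0 : J 0 { s with q := 0 })
    (hstep : ∀ i s' T, i < N → J i s' →
      WP W P (fun s'' T' => J (i + 1) { s'' with q := s''.q + 1 } ∧ T' ≤ T + B) s' T) :
    WP W (forQ b P) (fun s' T' => J N s' ∧ T' ≤ T + N * (B + 20) + 20) s T := by
  refine .seq (.write_q (by simp [Expr.eval]) ((WP.loop_count N (B + 6) J h0 ?_ ?_).mono ?_))
  · intro i s' hi hs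
    exact (hJ i s' hi hs).1
  · intro i s' T hi hs
    refine .seq ((hstep i s' T hi hs).mono ?_)
    rintro s'' T' ⟨h1, h2⟩
    have h3 := (hJ _ _ hi h1).2
    simp only at h3
    refine .write_q ?_ ⟨?_, ?_⟩
    · simp only [Expr.eval, eval_evar, St.mem_q, cells_zero]; omega
    · simpa only [Expr.eval, eval_evar, St.mem_q, cells_zero] using h1
    · simp only [Expr.cost, cost_evar]; omega
  · rintro s' T' ⟨h1, h2⟩
    refine ⟨h1, h2.trans ?_⟩
    simp only [Expr.cost]
    have := Nat.mul_le_mul_left N (show B + 6 + (b.cost + 1) ≤ B + 20 by omega)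
    omega

/-- Sets `z` to the sum, modulo `n`, of `e` and of entry `a` of the list. -/
def addModProg (e : Expr) : Prog :=
  .seq (.write 23 (.lit 0) (.add e (.read 8 (evar 21))))
    (.branch (.lt (evar 23) (evar 0)) .skip (.write 23 (.lit 0) (.sub (evar 23) (evar 0))))

/-- Both summands are below `n`, so a single conditional subtraction reduces the sum. -/
theorem wp_addModProg {W : ℕ} {Q : St → ℕ → Prop} {s : St} {T : ℕ} {e : Expr} {y l : ℕ}
    (hW : 4 * s.n * s.n + 4 * s.n + s.k + 4 ≤ W) (he : e.eval s.mem = y) (hy : y < s.n)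
    (hl : s.lst s.a = l) (hln : l < s.n)
    (hQ : ∀ z T', z < s.n → (z : ZMod s.n) = y + l → T' ≤ T + (e.cost + 20) →
      Q { s with z := z } T') : WP W (addModProg e) Q s T := by
  refine .seq (.write_z ?_ (.branch (fun hb => .skip ?_) fun hb => .write_z ?_ ?_))
  all_goals try simp only [Test.Holds, Expr.eval, eval_evar, St.mem_z, St.mem_in, cells_zero,
    St.mem_a, St.mem_lst, he, hl] at hb
  all_goals simp only [Expr.eval, eval_evar, St.mem_z, St.mem_in, cells_zero,
    St.mem_a, St.mem_lst, he, hl]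
  · omega
  · refine hQ _ _ hb (by push_cast; rfl) ?_
    simp only [Expr.cost, Test.cost, cost_evar]; omega
  · omega
  · refine hQ _ _ (by omega) ?_ ?_
    · rw [Nat.cast_sub (by omega), ZMod.natCast_self]
      push_cast; ring
    · simp only [Expr.cost, Test.cost, cost_evar]; omega

/-! ### Marking the tokens that are met -/

/-- `mark` is the indicator function of `N`, and `nb` is the list of its elements. -/
structure MarkInv (n : ℕ) (N : Finset (ZMod n)) (mark nb : ℕ → ℕ) (m : ℕ) : Prop where
  mark_eq : ∀ y < n, mark y = if (y : ZMod n) ∈ N then 1 else 0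
  enum : Enumerates (fun q => (nb q : ZMod n)) m N
  lt : ∀ q < m, nb q < n

theorem MarkInv.push {n : ℕ} {N : Finset (ZMod n)} {mark nb : ℕ → ℕ} {m z : ℕ}
    (h : MarkInv n N mark nb m) (hz : z < n) (hN : (z : ZMod n) ∉ N) :
    MarkInv n (insert (z : ZMod n) N) (Function.update mark z 1) (Function.update nb m z)
      (m + 1) := by
  refine ⟨fun y hy => ?_, h.enum.push hN (fun a ha => ?_) ?_, fun q hq => ?_⟩
  · rcases eq_or_ne y z with rfl | hyz
    · simp
    · have : (y : ZMod n) ≠ z := fun h => hyz (natCast_injOn n hy hz h)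
      rw [Function.update_of_ne hyz, h.mark_eq y hy]
      simp [this]
  · simp only [Function.update_of_ne ha.ne]
  · simp only [Function.update_self]
  · rcases eq_or_ne q m with rfl | hqm
    · rwa [Function.update_self]
    · rw [Function.update_of_ne hqm]
      exact h.lt q (by omega)

theorem MarkInv.le {n : ℕ} [NeZero n] {N : Finset (ZMod n)} {mark nb : ℕ → ℕ} {m : ℕ}
    (h : MarkInv n N mark nb m) : m ≤ n := by
  rw [← h.enum.card_eq]
  exact (Finset.card_le_univ N).trans_eq (ZMod.card n)

/-- Marks the tokens that meet token `x[q]`. -/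
def markTokenProg : Prog :=
  forA (.seq (addModProg (.read 9 (evar 20)))
    (.branch (.eq (.read 10 (evar 23)) (.lit 0))
      (.seq (.write 10 (evar 23) (.lit 1))
      (.seq (.write 12 (evar 17) (evar 23))
      (.write 17 (.lit 0) (.add (evar 17) (.lit 1)))))
      .skip))


/-- The test that runs through the tokens `x[0], …, x[k - 2]`. -/
def tokenTest : Test := .lt (.add (evar 20) (.lit 1)) (.read 0 (.lit 1))

theorem tokenTest_holds (s : St) : tokenTest.Holds s.mem ↔ s.q + 1 < s.k := Iff.rfl

theorem tokenTest_cost : tokenTest.cost = 7 := rfl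

/-- The set of the first `q` tokens. -/
def tokens (n : ℕ) (x : ℕ → ℕ) (q : ℕ) : Finset (ZMod n) :=
  (Finset.range q).image fun i => (x i : ZMod n)

theorem tokens_succ (n : ℕ) (x : ℕ → ℕ) (q : ℕ) :
    tokens n x (q + 1) = insert (x q : ZMod n) (tokens n x q) := by
  rw [tokens, Finset.range_add_one, Finset.image_insert, tokens]

/-- Marks the tokens that meet one of the tokens `x[0], …, x[k - 2]`. -/
def markProg : Prog := .seq (.write 17 (.lit 0) (.lit 0)) (forQ tokenTest markTokenProg)

section

variable {W : ℕ} {s : St} [NeZero s.n] {T : ℕ} {L : Finset ℕ}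
  (hW : 4 * s.n * s.n + 4 * s.n + s.k + 4 ≤ W) (hlst : Enumerates s.lst s.t L)
  (hL : ∀ l ∈ L, l < s.n)

omit [NeZero s.n] in
include hlst hL in
theorem length_le : s.t ≤ s.n := by
  rw [← hlst.card_eq, ← Finset.card_range s.n]
  exact Finset.card_le_card fun l hl => Finset.mem_range.2 (hL l hl)

include hW hlst hL in
theorem wp_markTokenProg (hx : s.x s.q < s.n) {N : Finset (ZMod s.n)}
    (hN : MarkInv s.n N s.mark s.nb s.m) :
    WP W markTokenProg (fun s' T' => (∃ z a m mark nb,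
      s' = { s with z := z, a := a, m := m, mark := mark, nb := nb } ∧
      MarkInv s.n (N ∪ nbhd L {(s.x s.q : ZMod s.n)}) mark nb m) ∧
      T' ≤ T + s.t * 70 + 20) s T := by
  have hle := length_le hlst hL
  refine (wp_forA s.t 50 (fun i s' => ∃ z m mark nb,
    s' = { s with a := i, z := z, m := m, mark := mark, nb := nb } ∧
    MarkInv s.n (N ∪ (Finset.range i).image fun b => (s.x s.q : ZMod s.n) + (s.lst b : ZMod s.n))
      mark nb m) ?_ (by omega) ?_ ?_).mono ?_
  · rintro i s' ⟨z, m, mark, nb, rfl, -⟩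
    exact ⟨rfl, rfl⟩
  · exact ⟨s.z, s.m, s.mark, s.nb, rfl, by simpa using hN⟩
  · rintro i s' T hi ⟨z, m, mark, nb, rfl, hm⟩
    have hmn := hm.le
    refine .seq (wp_addModProg (y := s.x s.q) (l := s.lst i) hW rfl hx rfl (hL _ (hlst.mem hi)) ?_)
    intro z T' hz hzc hT'
    change z < s.n at hz
    simp only [Expr.cost, cost_evar] at hT'
    rw [Finset.range_add_one, Finset.image_insert, Finset.union_insert, ← hzc]
    refine .branch (fun hb => .seq (.write_mark ?_ ?_ (.seq (.write_nb ?_ ?_ (.write_m ?_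
      ⟨⟨z, m + 1, _, _, rfl, hm.push hz ?_⟩, ?_⟩)))))
      fun hb => .skip ⟨⟨z, m, mark, nb, rfl, ?_⟩, ?_⟩
    all_goals try simp only [Test.Holds, Expr.eval, eval_evar, St.mem_z, cells_zero, St.mem_mark,
      hm.mark_eq z hz] at hb
    all_goals try simp only [Expr.eval, Expr.cost, Test.cost, cost_evar, eval_evar, St.mem_z,
      St.mem_m, cells_zero]
    iterate 5 omega
    · intro h
      rw [if_pos h] at hb
      omega
    · omega
    · rw [Finset.insert_eq_of_mem]
      · exact hm
      · by_contra h
        rw [if_neg h] at hb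
        exact hb rfl
    · omega
  · rintro s' T' ⟨⟨z, m, mark, nb, rfl, hm⟩, hT⟩
    refine ⟨⟨z, _, m, mark, nb, rfl, ?_⟩, hT⟩
    rw [nbhd_singleton, ← hlst.image_eq, Finset.image_image]
    exact hm

-- Besides the marks, a list of the marked tokens without repetition is kept. It allows later loops
-- to run over the `m` neighbours instead of all `n` tokens.
include hW hlst hL in
theorem wp_markProg (hk : 1 ≤ s.k) (hx : ∀ q, q + 1 < s.k → s.x q < s.n)
    (hmark : ∀ y < s.n, s.mark y = 0) :
    WP W markProg (fun s' T' => (∃ z a q m mark nb,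
      s' = { s with z := z, a := a, q := q, m := m, mark := mark, nb := nb } ∧
      MarkInv s.n (nbhd L (tokens s.n s.x (s.k - 1))) mark nb m) ∧
      T' ≤ T + (s.k - 1) * (s.t * 70 + 40) + 30) s T := by
  refine .seq (.write_m (by simp [Expr.eval]) ?_)
  refine (wp_forQ (s.k - 1) (s.t * 70 + 20) (fun i s' => ∃ z a m mark nb,
    s' = { s with z := z, a := a, q := i, m := m, mark := mark, nb := nb } ∧
    MarkInv s.n (nbhd L (tokens s.n s.x i)) mark nb m) ?_ (by omega) (by rw [tokenTest_cost]; omega)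
    ?_ ?_).mono ?_
  · rintro i s' hi ⟨z, a, m, mark, nb, rfl, -⟩
    refine ⟨?_, rfl⟩
    rw [tokenTest_holds]
    simp only
    omega
  · refine ⟨s.z, s.a, 0, s.mark, s.nb, rfl, ⟨fun y hy => ?_, ?_, fun q hq => ?_⟩⟩
    · rw [hmark y hy]; simp [tokens, nbhd]
    · exact Enumerates.zero _
    · omega
  · rintro i s' T hi ⟨z, a, m, mark, nb, rfl, hm⟩
    have : NeZero ({ s with z := z, a := a, q := i, m := m, mark := mark, nb := nb } : St).n :=
      ‹NeZero s.n›
    refine WP.mono (wp_markTokenProg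
      (s := { s with z := z, a := a, q := i, m := m, mark := mark, nb := nb })
      hW hlst hL (hx i (by omega)) hm) ?_
    rintro s' T' ⟨⟨z, a, m, mark, nb, rfl, hm⟩, hT⟩
    refine ⟨⟨z, a, m, mark, nb, rfl, ?_⟩, by simp only at hT; omega⟩
    rw [tokens_succ, nbhd_insert]
    exact hm
  · rintro s' T' ⟨⟨z, a, m, mark, nb, rfl, hm⟩, hT⟩
    refine ⟨⟨z, a, _, m, mark, nb, rfl, hm⟩, ?_⟩
    simp only [Expr.cost] at hT
    rw [show s.t * 70 + 20 + 20 = s.t * 70 + 40 by omega] at hT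
    omega

end

/-! ### Testing whether the tokens meet each other -/

/-- Sets `bad` to `0` if the tokens `x[0], …, x[k - 2]` are distinct and unmarked. -/
def checkProg : Prog :=
  .seq (.write 18 (.lit 0) (.lit 0)) (forQ tokenTest
    (.seq (.branch (.and (.eq (.read 10 (.read 9 (evar 20))) (.lit 0))
      (.eq (.read 11 (.read 9 (evar 20))) (.lit 0))) .skip (.write 18 (.lit 0) (.lit 1)))
    (.write 11 (.read 9 (evar 20)) (.lit 1))))

/-- The array `inK` serves twice: it detects repeated tokens, and afterwards it excludes the tokens
of `K` from the counting. -/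
theorem wp_checkProg {W : ℕ} {s : St} {T : ℕ} (hW : 4 * s.n * s.n + 4 * s.n + s.k + 4 ≤ W)
    (hk : 1 ≤ s.k) (hx : ∀ q, q + 1 < s.k → s.x q < s.n) {N : Finset (ZMod s.n)}
    (hmark : ∀ y < s.n, s.mark y = if (y : ZMod s.n) ∈ N then 1 else 0)
    (hinK : ∀ y < s.n, s.inK y = 0) :
    WP W checkProg (fun s' T' => (∃ q bad inK, s' = { s with q := q, bad := bad, inK := inK } ∧
      (∀ y < s.n, inK y = if (y : ZMod s.n) ∈ tokens s.n s.x (s.k - 1) then 1 else 0) ∧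
      (bad = 0 ↔ Disjoint (tokens s.n s.x (s.k - 1)) N ∧
        (tokens s.n s.x (s.k - 1)).card = s.k - 1)) ∧
      T' ≤ T + (s.k - 1) * 60 + 30) s T := by
  refine .seq (.write_bad (by simp [Expr.eval]) ?_)
  refine (wp_forQ (s.k - 1) 40 (fun i s' => ∃ bad inK,
    s' = { s with q := i, bad := bad, inK := inK } ∧
      (∀ y < s.n, inK y = if (y : ZMod s.n) ∈ tokens s.n s.x i then 1 else 0) ∧
      (bad = 0 ↔ Disjoint (tokens s.n s.x i) N ∧ (tokens s.n s.x i).card = i)) ?_ (by omega)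
    (by rw [tokenTest_cost]; omega) ?_ ?_).mono ?_
  · rintro i s' hi ⟨bad, inK, rfl, -⟩
    refine ⟨?_, rfl⟩
    rw [tokenTest_holds]
    simp only
    omega
  · exact ⟨0, s.inK, rfl, fun y hy => by simp [hinK y hy, tokens], by simp [tokens]⟩
  · rintro i s' T hi ⟨bad, inK, rfl, h1, h2⟩
    have hxi := hx i (by omega)
    have hinK' : ∀ y < s.n, Function.update inK (s.x i) 1 y =
        if (y : ZMod s.n) ∈ tokens s.n s.x (i + 1) then 1 else 0 := by
      intro y hy
      rw [tokens_succ]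
      rcases eq_or_ne y (s.x i) with rfl | hyx
      · simp
      · have : (y : ZMod s.n) ≠ s.x i := fun h => hyx (natCast_injOn s.n hy hxi h)
        rw [Function.update_of_ne hyx, h1 y hy]
        simp [this]
    -- Once a repetition makes the cardinality fall behind `i`, it can never catch up.
    have hle : (tokens s.n s.x i).card ≤ i :=
      Finset.card_image_le.trans_eq (Finset.card_range i)
    refine .seq (.branch (fun hb => .skip (.write_inK ?_ ?_ ⟨⟨bad, _, rfl, hinK', ?_⟩, ?_⟩))
      fun hb => .write_bad ?_ (.write_inK ?_ ?_ ⟨⟨1, _, rfl, hinK', ?_⟩, ?_⟩))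
    all_goals simp only [Test.Holds, Expr.eval, eval_evar, St.mem_q, cells_zero, St.mem_mark,
      St.mem_inK, St.mem_x, hmark _ hxi, h1 _ hxi, ite_eq_right_iff, one_ne_zero, imp_false] at hb
    all_goals simp only [Expr.eval, Expr.cost, Test.cost, cost_evar, eval_evar, St.mem_x, St.mem_q,
      cells_zero, tokens_succ]
    · omega
    · omega
    · rw [h2, Finset.card_insert_of_notMem hb.2, Finset.disjoint_insert_left]
      constructor
      · rintro ⟨h3, h4⟩
        exact ⟨⟨hb.1, h3⟩, by omega⟩
      · rintro ⟨⟨_, h3⟩, h4⟩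
        exact ⟨h3, by omega⟩
    · omega
    · omega
    · omega
    · omega
    · refine iff_of_false one_ne_zero ?_
      rintro ⟨h3, h4⟩
      rw [Finset.disjoint_insert_left] at h3
      refine hb ⟨h3.1, fun h => ?_⟩
      rw [Finset.insert_eq_of_mem h] at h4
      omega
    · omega
  · rintro s' T' ⟨⟨bad, inK, rfl, h⟩, hT⟩
    refine ⟨⟨_, bad, inK, rfl, h⟩, ?_⟩
    simp only [Expr.cost] at hT
    omega

/-! ### Counting common neighbours -/

/-- `cnt` agrees with `c` outside of `B` and is `0` on `B`; `mx` is its maximum. -/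
structure CountInv (n : ℕ) (B : Finset (ZMod n)) (c : ZMod n → ℕ) (cnt : ℕ → ℕ) (mx : ℕ) :
    Prop where
  cnt_eq : ∀ z < n, cnt z = if (z : ZMod n) ∈ B then 0 else c z
  le : ∀ z < n, cnt z ≤ mx
  max : mx = 0 ∨ ∃ z < n, (z : ZMod n) ∉ B ∧ cnt z = mx

namespace CountInv

variable {n : ℕ} {B : Finset (ZMod n)} {c : ZMod n → ℕ} {cnt : ℕ → ℕ} {mx z : ℕ}

theorem add_of_mem (h : CountInv n B c cnt mx) (hB : (z : ZMod n) ∈ B) :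
    CountInv n B (fun y => c y + if (z : ZMod n) = y then 1 else 0) cnt mx := by
  refine ⟨fun y hy => ?_, h.le, h.max⟩
  rw [h.cnt_eq y hy]
  split_ifs with h1 h2
  · rfl
  · exact absurd (h2 ▸ hB) h1
  · rfl

theorem add_of_notMem (h : CountInv n B c cnt mx) (hz : z < n) (hB : (z : ZMod n) ∉ B) :
    CountInv n B (fun y => c y + if (z : ZMod n) = y then 1 else 0)
      (Function.update cnt z (cnt z + 1)) (if mx < cnt z + 1 then cnt z + 1 else mx) := by
  refine ⟨fun y hy => ?_, fun y hy => ?_, ?_⟩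
  · rcases eq_or_ne y z with rfl | hyz
    · rw [Function.update_self, h.cnt_eq y hy, if_neg hB, if_neg hB, if_pos rfl]
    · have : (z : ZMod n) ≠ y := fun h => hyz (natCast_injOn n hz hy h).symm
      rw [Function.update_of_ne hyz, h.cnt_eq y hy, if_neg this, add_zero]
  · have := h.le y hy
    rcases eq_or_ne y z with rfl | hyz
    · rw [Function.update_self]
      split_ifs <;> omega
    · rw [Function.update_of_ne hyz]
      split_ifs <;> omega
  · right
    by_cases hlt : mx < cnt z + 1
    · exact ⟨z, hz, hB, by rw [Function.update_self, if_pos hlt]⟩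
    · rw [if_neg hlt]
      rcases h.max with h0 | ⟨y, hy, hyB, hym⟩
      · omega
      · refine ⟨y, hy, hyB, ?_⟩
        have := h.le z hz
        rw [Function.update_of_ne, hym]
        rintro rfl
        omega

end CountInv

/-- Counts the tokens that meet token `nb[q]`. -/
def countTokenProg : Prog :=
  forA (.seq (addModProg (.read 12 (evar 20)))
    (.branch (.and (.eq (.read 10 (evar 23)) (.lit 0)) (.eq (.read 11 (evar 23)) (.lit 0)))
      (.seq (.write 13 (evar 23) (.add (.read 13 (evar 23)) (.lit 1)))
        (.branch (.lt (evar 19) (.read 13 (evar 23)))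
          (.write 19 (.lit 0) (.read 13 (evar 23))) .skip))
      .skip))

/-- The test that runs through the marked tokens. -/
def markedTest : Test := .lt (evar 20) (evar 17)

theorem markedTest_holds (s : St) : markedTest.Holds s.mem ↔ s.q < s.m := Iff.rfl

theorem markedTest_cost : markedTest.cost = 5 := rfl

/-- Counts, for each token, the marked tokens that it meets. -/
def countProg : Prog := .seq (.write 19 (.lit 0) (.lit 0)) (forQ markedTest countTokenProg)

section

variable {W : ℕ} {s : St} {T : ℕ} {L : Finset ℕ}
  (hW : 4 * s.n * s.n + 4 * s.n + s.k + 4 ≤ W) (hlst : Enumerates s.lst s.t L)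
  (hL : ∀ l ∈ L, l < s.n)

include hW hlst hL in
theorem wp_countTokenProg (hq : s.nb s.q < s.n) {B : Finset (ZMod s.n)}
    (hB : ∀ y < s.n, (y : ZMod s.n) ∉ B ↔ s.mark y = 0 ∧ s.inK y = 0)
    {c : ZMod s.n → ℕ} (hc : CountInv s.n B c s.cnt s.mx) (hcW : ∀ z, c z ≤ s.n * s.n) :
    WP W countTokenProg (fun s' T' => (∃ z a mx cnt,
      s' = { s with z := z, a := a, mx := mx, cnt := cnt } ∧
      CountInv s.n B
        (fun z => c z + ∑ l ∈ L, if (s.nb s.q : ZMod s.n) + (l : ZMod s.n) = z then 1 else 0)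
        cnt mx) ∧ T' ≤ T + s.t * 100 + 20) s T := by
  have hle := length_le hlst hL
  have hassoc : 4 * s.n * s.n = 4 * (s.n * s.n) := by ring
  refine (wp_forA s.t 80 (fun i s' => ∃ z mx cnt,
    s' = { s with a := i, z := z, mx := mx, cnt := cnt } ∧
    CountInv s.n B (fun z => c z + ∑ b ∈ Finset.range i,
      if (s.nb s.q : ZMod s.n) + (s.lst b : ZMod s.n) = z then 1 else 0) cnt mx)
    ?_ (by omega) ?_ ?_).mono ?_
  · rintro i s' ⟨z, mx, cnt, rfl, -⟩
    exact ⟨rfl, rfl⟩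
  · exact ⟨s.z, s.mx, s.cnt, rfl, by simpa using hc⟩
  · rintro i s' T hi ⟨z, mx, cnt, rfl, hm⟩
    refine .seq (wp_addModProg (y := s.nb s.q) (l := s.lst i) hW rfl hq rfl (hL _ (hlst.mem hi)) ?_)
    intro z T' hz hzc hT'
    change z < s.n at hz
    change (z : ZMod s.n) = _ at hzc
    simp only [Expr.cost, cost_evar] at hT'
    -- Needed only to keep the counts below the word bound.
    have hbound : cnt z ≤ s.n * s.n + i := by
      rw [hm.cnt_eq z hz]
      split_ifs
      · omega
      · refine Nat.add_le_add (hcW _) ?_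
        rw [Finset.sum_boole]
        exact (Finset.card_filter_le _ _).trans_eq (Finset.card_range i)
    have hsum : (fun z => c z + ∑ b ∈ Finset.range (i + 1),
        if (s.nb s.q : ZMod s.n) + (s.lst b : ZMod s.n) = z then 1 else 0) =
        fun y => (c y + ∑ b ∈ Finset.range i,
          if (s.nb s.q : ZMod s.n) + (s.lst b : ZMod s.n) = y then 1 else 0) +
            if (z : ZMod s.n) = y then 1 else 0 := by
      funext y
      rw [Finset.sum_range_succ, hzc, add_assoc]
    have hmem := hm.add_of_mem (z := z)
    have hnot := hm.add_of_notMem hz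
    rw [hsum]
    refine .branch (fun hb => .seq (.write_cnt ?_ ?_ (.branch (fun hb' => .write_mx ?_
      ⟨⟨z, _, _, rfl, ?_⟩, ?_⟩) fun hb' => .skip ⟨⟨z, _, _, rfl, ?_⟩, ?_⟩)))
      fun hb => .skip ⟨⟨z, mx, cnt, rfl, hmem ?_⟩, ?_⟩
    all_goals try simp only [Test.Holds, Expr.eval, eval_evar, St.mem_z, cells_zero, St.mem_cnt,
      St.mem_mx, Function.update_self] at hb'
    all_goals try simp only [Test.Holds, Expr.eval, eval_evar, St.mem_z, cells_zero, St.mem_mark,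
      St.mem_inK, ← hB z hz] at hb
    all_goals try simp only [Expr.eval, Expr.cost, Test.cost, cost_evar, eval_evar, St.mem_z,
      St.mem_cnt, cells_zero, Function.update_self]
    · omega
    · omega
    · omega
    · simpa only [if_pos hb'] using hnot hb
    · omega
    · simpa only [if_neg hb'] using hnot hb
    · omega
    · exact not_not.1 hb
    · omega
  · rintro s' T' ⟨⟨z, mx, cnt, rfl, hm⟩, hT⟩
    refine ⟨⟨z, _, mx, cnt, rfl, ?_⟩, hT⟩
    have : ∀ z, (∑ l ∈ L, if (s.nb s.q : ZMod s.n) + (l : ZMod s.n) = z then 1 else 0) =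
        ∑ b ∈ Finset.range s.t,
          if (s.nb s.q : ZMod s.n) + (s.lst b : ZMod s.n) = z then 1 else 0 := by
      intro z
      rw [← hlst.image_eq, Finset.sum_image hlst.injOn]
    simp only [this]
    exact hm

-- The overlaps of all admissible tokens are obtained together by visiting the `m * t` sums of a
-- marked token and an element of `L`. This is the dominant cost per tuple.
include hW hlst hL in
theorem wp_countProg [NeZero s.n] {N : Finset (ZMod s.n)}
    (hN : Enumerates (fun q => (s.nb q : ZMod s.n)) s.m N) (hnb : ∀ q < s.m, s.nb q < s.n)
    {B : Finset (ZMod s.n)}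
    (hB : ∀ y < s.n, (y : ZMod s.n) ∉ B ↔ s.mark y = 0 ∧ s.inK y = 0)
    (hcnt : ∀ y < s.n, s.cnt y = 0) :
    WP W countProg (fun s' T' => (∃ z a q mx cnt,
      s' = { s with z := z, a := a, q := q, mx := mx, cnt := cnt } ∧
      CountInv s.n B
        (fun z => ∑ y ∈ N, ∑ l ∈ L, if y + (l : ZMod s.n) = z then 1 else 0)
        cnt mx) ∧ T' ≤ T + s.m * (s.t * 100 + 40) + 30) s T := by
  have hle := length_le hlst hL
  have hmn : s.m ≤ s.n := by
    rw [← hN.card_eq]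
    exact (Finset.card_le_univ N).trans_eq (ZMod.card s.n)
  refine .seq (.write_mx (by simp [Expr.eval]) ?_)
  refine (wp_forQ s.m (s.t * 100 + 20) (fun i s' => ∃ z a mx cnt,
    s' = { s with z := z, a := a, q := i, mx := mx, cnt := cnt } ∧
      CountInv s.n B (fun z => ∑ p ∈ Finset.range i, ∑ l ∈ L,
        if (s.nb p : ZMod s.n) + (l : ZMod s.n) = z then 1 else 0) cnt mx)
    ?_ (by omega) (by rw [markedTest_cost]; omega) ?_ ?_).mono ?_
  · rintro i s' hi ⟨z, a, mx, cnt, rfl, -⟩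
    exact ⟨markedTest_holds _, rfl⟩
  · refine ⟨s.z, s.a, 0, s.cnt, rfl, ⟨fun y hy => ?_, fun y hy => ?_, Or.inl rfl⟩⟩
    · rw [hcnt y hy]; simp
    · rw [hcnt y hy]
  · rintro i s' T hi ⟨z, a, mx, cnt, rfl, hm⟩
    refine WP.mono (wp_countTokenProg
      (s := { s with z := z, a := a, q := i, mx := mx, cnt := cnt })
      hW hlst hL (hnb i hi) hB hm fun z => ?_) ?_
    · calc _ ≤ ∑ p ∈ Finset.range i, s.n := Finset.sum_le_sum fun p _ => by
            rw [Finset.sum_boole]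
            exact (Finset.card_filter_le _ _).trans (by rw [hlst.card_eq]; exact hle)
        _ ≤ s.n * s.n := by
            rw [Finset.sum_const, Finset.card_range, smul_eq_mul]
            exact Nat.mul_le_mul_right _ (by omega)
    · rintro s' T' ⟨⟨z, a, mx, cnt, rfl, hm⟩, hT⟩
      refine ⟨⟨z, a, mx, cnt, rfl, ?_⟩, by simp only at hT; omega⟩
      simp only [Finset.sum_range_succ]
      exact hm
  · rintro s' T' ⟨⟨z, a, mx, cnt, rfl, hm⟩, hT⟩
    refine ⟨⟨z, a, _, mx, cnt, rfl, ?_⟩, ?_⟩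
    · have : ∀ z, (∑ y ∈ N, ∑ l ∈ L, if y + (l : ZMod s.n) = z then 1 else 0) =
          ∑ p ∈ Finset.range s.m, ∑ l ∈ L,
            if (s.nb p : ZMod s.n) + (l : ZMod s.n) = z then 1 else 0 := by
        intro z
        rw [← hN.image_eq, Finset.sum_image hN.injOn]
      simp only [this]
      exact hm
    · simp only [Expr.cost] at hT
      rw [show s.t * 100 + 20 + 20 = s.t * 100 + 40 by omega] at hT
      omega

/-! ### Clearing the arrays -/

/-- Clears the counts of the tokens that meet token `nb[q]`. -/
def clearTokenProg : Prog :=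
  forA (.seq (addModProg (.read 12 (evar 20))) (.write 13 (evar 23) (.lit 0)))

/-- Clears all counts and marks. -/
def clearProg : Prog :=
  .seq (forQ markedTest (.seq clearTokenProg (.write 10 (.read 12 (evar 20)) (.lit 0))))
    (forQ tokenTest (.write 11 (.read 9 (evar 20)) (.lit 0)))

theorem update_zero_ne_zero {f : ℕ → ℕ} {i y : ℕ} (h : Function.update f i 0 y ≠ 0) :
    y ≠ i ∧ f y ≠ 0 := by
  rcases eq_or_ne y i with rfl | hyi
  · simp at h
  · rw [Function.update_of_ne hyi] at h
    exact ⟨hyi, h⟩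

-- Resetting whole arrays would cost `n` steps per tuple, which may exceed the allowed time.
-- Repeating the loops of the counting reaches all cells that were changed.
include hW hlst hL in
theorem wp_clearTokenProg (hq : s.nb s.q < s.n) :
    WP W clearTokenProg (fun s' T' => (∃ z a cnt, s' = { s with z := z, a := a, cnt := cnt } ∧
      ∀ y < s.n, cnt y ≠ 0 → s.cnt y ≠ 0 ∧ (y : ZMod s.n) ∉ nbhd L {(s.nb s.q : ZMod s.n)}) ∧
      T' ≤ T + s.t * 60 + 20) s T := by
  have hle := length_le hlst hL
  refine (wp_forA s.t 40 (fun i s' => ∃ z cnt, s' = { s with a := i, z := z, cnt := cnt } ∧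
    ∀ y < s.n, cnt y ≠ 0 → s.cnt y ≠ 0 ∧
      ∀ b < i, (s.nb s.q : ZMod s.n) + (s.lst b : ZMod s.n) ≠ y) ?_ (by omega) ?_ ?_).mono ?_
  · rintro i s' ⟨z, cnt, rfl, -⟩
    exact ⟨rfl, rfl⟩
  · exact ⟨s.z, s.cnt, rfl, fun y _ h => ⟨h, fun b hb => absurd hb (Nat.not_lt_zero b)⟩⟩
  · rintro i s' T hi ⟨z, cnt, rfl, hm⟩
    refine .seq (wp_addModProg (y := s.nb s.q) (l := s.lst i) hW rfl hq rfl (hL _ (hlst.mem hi)) ?_)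
    intro z T' hz hzc hT'
    change z < s.n at hz
    change (z : ZMod s.n) = _ at hzc
    simp only [Expr.cost, cost_evar] at hT'
    refine .write_cnt ?_ ?_ ⟨⟨z, _, rfl, fun y hy h => ?_⟩, ?_⟩
    all_goals try simp only [Expr.eval, Expr.cost, cost_evar, eval_evar, St.mem_z, cells_zero]
    · omega
    · omega
    · simp only [Expr.eval, eval_evar, St.mem_z, cells_zero] at h
      obtain ⟨h1, h2⟩ := update_zero_ne_zero h
      refine ⟨(hm y hy h2).1, fun b hb => ?_⟩
      rcases Nat.lt_succ_iff_lt_or_eq.1 hb with hb | rfl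
      · exact (hm y hy h2).2 b hb
      · rw [← hzc]
        exact fun h => h1 (natCast_injOn s.n hz hy h).symm
    · omega
  · rintro s' T' ⟨⟨z, cnt, rfl, hm⟩, hT⟩
    refine ⟨⟨z, _, cnt, rfl, fun y hy h => ⟨(hm y hy h).1, ?_⟩⟩, hT⟩
    rw [nbhd_singleton, Finset.mem_image]
    rintro ⟨l, hl, hly⟩
    obtain ⟨b, hb, rfl⟩ := hlst.exists_eq hl
    exact (hm y hy h).2 b hb hly

include hW hlst hL in
theorem wp_clearProg (hk : 1 ≤ s.k) (hx : ∀ q, q + 1 < s.k → s.x q < s.n) (hmn : s.m ≤ s.n)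
    (hnb : ∀ q < s.m, s.nb q < s.n)
    (hcnt : ∀ y < s.n, s.cnt y ≠ 0 → ∃ q < s.m, (y : ZMod s.n) ∈ nbhd L {(s.nb q : ZMod s.n)})
    (hmark : ∀ y < s.n, s.mark y ≠ 0 → ∃ q < s.m, y = s.nb q)
    (hinK : ∀ y < s.n, s.inK y ≠ 0 → ∃ q, q + 1 < s.k ∧ y = s.x q) :
    WP W clearProg (fun s' T' => (∃ z a q mark inK cnt,
      s' = { s with z := z, a := a, q := q, mark := mark, inK := inK, cnt := cnt } ∧
      ∀ y < s.n, mark y = 0 ∧ inK y = 0 ∧ cnt y = 0) ∧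
      T' ≤ T + s.m * (s.t * 60 + 60) + (s.k - 1) * 40 + 40) s T := by
  have hle := length_le hlst hL
  -- The invariant says that a cell which is still nonzero was nonzero at the start and is not
  -- covered by the indices processed so far. At the end no such cell is left.
  refine .seq ((wp_forQ s.m (s.t * 60 + 40) (fun i s' => ∃ z a mark cnt,
    s' = { s with z := z, a := a, q := i, mark := mark, cnt := cnt } ∧
    (∀ y < s.n, cnt y ≠ 0 → s.cnt y ≠ 0 ∧
      ∀ p < i, (y : ZMod s.n) ∉ nbhd L {(s.nb p : ZMod s.n)}) ∧
    ∀ y < s.n, mark y ≠ 0 → s.mark y ≠ 0 ∧ ∀ p < i, y ≠ s.nb p)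
    ?_ (by omega) (by rw [markedTest_cost]; omega) ?_ ?_).mono ?_)
  · rintro i s' hi ⟨z, a, mark, cnt, rfl, -⟩
    exact ⟨markedTest_holds _, rfl⟩
  · exact ⟨s.z, s.a, s.mark, s.cnt, rfl,
      fun y _ h => ⟨h, fun b hb => absurd hb (Nat.not_lt_zero b)⟩,
      fun y _ h => ⟨h, fun b hb => absurd hb (Nat.not_lt_zero b)⟩⟩
  · rintro i s' T hi ⟨z, a, mark, cnt, rfl, hc, hm⟩
    have hi' := hnb i hi
    refine .seq (WP.mono (wp_clearTokenProg
      (s := { s with z := z, a := a, q := i, mark := mark, cnt := cnt }) hW hlst hL hi') ?_)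
    rintro s' T' ⟨⟨z, a, cnt', rfl, hc'⟩, hT⟩
    refine .write_mark ?_ ?_ ⟨⟨z, a, _, cnt', rfl, fun y hy h => ?_, fun y hy h => ?_⟩, ?_⟩
    all_goals try simp only [Expr.eval, Expr.cost, cost_evar, eval_evar, St.mem_q, St.mem_nb,
      cells_zero]
    · omega
    · omega
    · obtain ⟨h1, h2⟩ := hc' y hy h
      refine ⟨(hc y hy h1).1, fun p hp => ?_⟩
      rcases Nat.lt_succ_iff_lt_or_eq.1 hp with hp | rfl
      · exact (hc y hy h1).2 p hp
      · exact h2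
    · simp only [Expr.eval, eval_evar, St.mem_q, St.mem_nb, cells_zero] at h
      obtain ⟨h1, h2⟩ := update_zero_ne_zero h
      refine ⟨(hm y hy h2).1, fun p hp => ?_⟩
      rcases Nat.lt_succ_iff_lt_or_eq.1 hp with hp | rfl
      · exact (hm y hy h2).2 p hp
      · exact h1
    · simp only at hT
      omega
  · rintro s' T' ⟨⟨z, a, mark, cnt, rfl, hc, hm⟩, hT⟩
    refine (wp_forQ (s.k - 1) 20 (fun i s' => ∃ inK,
      s' = { s with z := z, a := a, q := i, mark := mark, inK := inK, cnt := cnt } ∧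
      ∀ y < s.n, inK y ≠ 0 → s.inK y ≠ 0 ∧ ∀ p < i, y ≠ s.x p)
      ?_ (by omega) (by rw [tokenTest_cost]; omega) ?_ ?_).mono ?_
    · rintro i s' hi ⟨inK, rfl, -⟩
      refine ⟨?_, rfl⟩
      rw [tokenTest_holds]
      simp only
      omega
    · exact ⟨s.inK, rfl, fun y _ h => ⟨h, fun b hb => absurd hb (Nat.not_lt_zero b)⟩⟩
    · rintro i s' T hi ⟨inK, rfl, hi2⟩
      have hxi := hx i (by omega)
      refine .write_inK ?_ ?_ ⟨⟨_, rfl, fun y hy h => ?_⟩, ?_⟩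
      all_goals try simp only [Expr.eval, Expr.cost, cost_evar, eval_evar, St.mem_q, St.mem_x,
        cells_zero]
      · omega
      · omega
      · simp only [Expr.eval, eval_evar, St.mem_q, St.mem_x, cells_zero] at h
        obtain ⟨h1, h2⟩ := update_zero_ne_zero h
        refine ⟨(hi2 y hy h2).1, fun p hp => ?_⟩
        rcases Nat.lt_succ_iff_lt_or_eq.1 hp with hp | rfl
        · exact (hi2 y hy h2).2 p hp
        · exact h1
      · omega
    · rintro s' T' ⟨⟨inK, rfl, hi2⟩, hT'⟩
      refine ⟨⟨z, a, _, mark, inK, cnt, rfl, fun y hy => ⟨?_, ?_, ?_⟩⟩, ?_⟩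
      · by_contra h
        obtain ⟨h1, h2⟩ := hm y hy h
        obtain ⟨q, hq, hyq⟩ := hmark y hy h1
        exact h2 q hq hyq
      · by_contra h
        obtain ⟨h1, h2⟩ := hi2 y hy h
        obtain ⟨q, hq, hyq⟩ := hinK y hy h1
        exact h2 q (by omega) hyq
      · by_contra h
        obtain ⟨h1, h2⟩ := hc y hy h
        obtain ⟨q, hq, hyq⟩ := hcnt y hy h1
        exact h2 q hq hyq
      · rw [show s.t * 60 + 40 + 20 = s.t * 60 + 60 by omega] at hT
        omega

end

/-! ### One tuple of tokens -/

/-- Updates the minimum. -/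
def updateProg : Prog :=
  .branch (.and (.eq (evar 18) (.lit 0)) (.not (.lt (evar 0) (.add (.read 0 (.lit 1)) (evar 17)))))
    (.seq (.write 23 (.lit 0) (.sub (.add (evar 17) (evar 16)) (evar 19)))
      (.branch (.and (.not (.eq (evar 3) (.lit 0))) (.not (.lt (evar 23) (.read 3 (.lit 1)))))
        .skip
        (.seq (.write 3 (.lit 0) (.lit 1)) (.write 3 (.lit 1) (evar 23)))))
    .skip

theorem wp_updateProg {W : ℕ} {s : St} {T : ℕ} [NeZero s.n] {L : Finset ℕ} {Z : Set ℕ}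
    (hW : 4 * s.n * s.n + 4 * s.n + s.k + 4 ≤ W) (hk : 1 ≤ s.k) (hL : IsSymmetric s.n L)
    {K : Finset (ZMod s.n)} (ht : L.card = s.t) (hm : (nbhd L K).card = s.m)
    (htn : s.t ≤ s.n)
    (hbad : s.bad = 0 ↔ Disjoint K (nbhd L K) ∧ K.card = s.k - 1)
    {cnt : ℕ → ℕ} (hc : CountInv s.n (K ∪ nbhd L K)
        (fun z => ∑ y ∈ nbhd L K, ∑ l ∈ L, if y + (l : ZMod s.n) = z then 1 else 0) cnt s.mx)
    (hZ : IsBest Z s.flag s.val) :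
    WP W updateProg (fun s' T' => (∃ z flag val, s' = { s with z := z, flag := flag, val := val } ∧
      IsBest (Z ∪ candidates L (s.k - 1) K) flag val) ∧ T' ≤ T + 60) s T := by
  -- With `k - 1` tokens in `K` and `m` neighbours, `k + m ≤ n` says that a further token is
  -- available.
  have hcand : s.bad = 0 → s.k + s.m ≤ s.n →
      IsLeast (candidates L (s.k - 1) K) (s.m + s.t - s.mx) := by
    intro h0 hkm
    obtain ⟨hd, hK⟩ := hbad.1 h0
    rw [← hm, ← ht]
    refine isLeast_candidates hL hK hd (by omega) (fun z hzK hzN => ?_) (hc.max.imp id ?_)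
    · have h1 := hc.le z.val (ZMod.val_lt z)
      rw [hc.cnt_eq _ (ZMod.val_lt z), ZMod.natCast_zmod_val, if_neg (by simp [hzK, hzN]),
        sum_ite_eq_card_inter hL] at h1
      exact h1
    · rintro ⟨z, hz, hzB, hzmx⟩
      rw [hc.cnt_eq _ hz, if_neg hzB, sum_ite_eq_card_inter hL] at hzmx
      rw [Finset.mem_union, not_or] at hzB
      exact ⟨z, hzB.1, hzB.2, hzmx⟩
  have hempty : ¬ (s.bad = 0 ∧ s.k + s.m ≤ s.n) → candidates L (s.k - 1) K = ∅ := by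
    intro h
    refine candidates_eq_empty ?_
    rintro ⟨⟨h1, h2⟩, h3⟩
    exact h ⟨hbad.2 ⟨h2, h1⟩, by omega⟩
  refine .branch (fun hb => .seq (.write_z ?_ (.branch (fun hb' => .skip ⟨⟨_, _, _, rfl, ?_⟩, ?_⟩)
    fun hb' => .seq (.write_flag ?_ ?_ (.write_val ?_ ?_ ⟨⟨_, _, _, rfl, ?_⟩, ?_⟩)))))
    fun hb => .skip ⟨⟨_, _, _, rfl, ?_⟩, ?_⟩
  all_goals try simp only [Test.Holds, Expr.eval, eval_evar, St.mem_z, St.mem_m, St.mem_t,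
    St.mem_mx, St.mem_out, cells_zero, cells_one, not_lt] at hb'
  all_goals try simp only [Test.Holds, Expr.eval, eval_evar, St.mem_bad, St.mem_in, St.mem_m,
    cells_zero, cells_one, not_lt] at hb
  all_goals try simp only [Expr.eval, Expr.cost, Test.cost, cost_evar, eval_evar, St.mem_z,
    St.mem_m, St.mem_t, St.mem_mx, cells_zero]
  · omega
  · have := hZ.update (hcand hb.1 hb.2)
    have hf : s.flag = 1 := hZ.elim (fun h => absurd h.1 hb'.1) fun h => h.1
    rw [if_pos hb'] at this
    rwa [hf]
  · omega
  · omega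
  · omega
  · omega
  · omega
  · have := hZ.update (hcand hb.1 hb.2)
    rwa [if_neg hb'] at this
  · omega
  · rw [hempty hb, Set.union_empty]
    exact hZ
  · omega

/-- Processes the tuple `x[0], …, x[k - 2]`. -/
def tupleProg : Prog :=
  .seq markProg (.seq checkProg (.seq countProg (.seq updateProg clearProg)))

theorem wp_tupleProg {W : ℕ} {s : St} {T : ℕ} [NeZero s.n] {L : Finset ℕ} {Z : Set ℕ}
    (hW : 4 * s.n * s.n + 4 * s.n + s.k + 4 ≤ W) (hk : 1 ≤ s.k) (hL : IsSymmetric s.n L)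
    (hlst : Enumerates s.lst s.t L) (hx : ∀ q, q + 1 < s.k → s.x q < s.n)
    (hclear : ∀ y < s.n, s.mark y = 0 ∧ s.inK y = 0 ∧ s.cnt y = 0)
    (hZ : IsBest Z s.flag s.val) :
    WP W tupleProg (fun s' T' => (∃ z a q m bad mx mark inK nb cnt flag val,
      s' = { s with
        z := z, a := a, q := q, m := m, bad := bad, mx := mx, mark := mark, inK := inK, nb := nb, cnt := cnt, flag := flag, val := val } ∧
      (∀ y < s.n, mark y = 0 ∧ inK y = 0 ∧ cnt y = 0) ∧
      IsBest (Z ∪ candidates L (s.k - 1) (tokens s.n s.x (s.k - 1))) flag val) ∧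
      T' ≤ T + s.k * (70 * s.t + 140) +
        (nbhd L (tokens s.n s.x (s.k - 1))).card * (160 * s.t + 100) + 200) s T := by
  have hLn : ∀ l ∈ L, l < s.n := fun l hl => (hL l hl).2.1
  have htn := length_le hlst hLn
  set K := tokens s.n s.x (s.k - 1) with hKdef
  refine .seq ((wp_markProg hW hlst hLn hk hx fun y hy => (hclear y hy).1).mono ?_)
  rintro s₁ T₁ ⟨⟨z, a, q, m, mark, nb, rfl, hm⟩, hT₁⟩
  have hmn : m ≤ s.n := hm.le
  refine .seq (WP.mono (wp_checkProg (s := { s with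
    z := z, a := a, q := q, m := m, mark := mark, nb := nb }) (N := nbhd L K) hW hk hx hm.mark_eq
    fun y hy => (hclear y hy).2.1) ?_)
  rintro s₂ T₂ ⟨⟨q, bad, inK, rfl, hinK, hbad⟩, hT₂⟩
  have hB : ∀ y < s.n, (y : ZMod s.n) ∉ K ∪ nbhd L K ↔ mark y = 0 ∧ inK y = 0 := by
    intro y hy
    rw [hm.mark_eq y hy, hinK y hy]
    simp only [Finset.mem_union, not_or, ite_eq_right_iff, one_ne_zero, imp_false]
    exact and_comm
  refine .seq (WP.mono (wp_countProg (s := { s with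
    z := z, a := a, q := q, m := m, mark := mark, nb := nb, bad := bad, inK := inK })
    hW hlst hLn hm.enum hm.lt hB fun y hy => (hclear y hy).2.2) ?_)
  rintro s₃ T₃ ⟨⟨z, a, q, mx, cnt, rfl, hc⟩, hT₃⟩
  refine .seq (WP.mono (wp_updateProg (s := { s with
    z := z, a := a, q := q, m := m, mark := mark, nb := nb, bad := bad, inK := inK, mx := mx,
    cnt := cnt }) (K := K) hW hk hL hlst.card_eq hm.enum.card_eq htn hbad hc hZ) ?_)
  rintro s₄ T₄ ⟨⟨z, flag, val, rfl, hbest⟩, hT₄⟩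
  refine WP.mono (wp_clearProg (s := { s with
    z := z, a := a, q := q, m := m, mark := mark, nb := nb, bad := bad, inK := inK, mx := mx,
    cnt := cnt, flag := flag, val := val }) hW hlst hLn hk hx hmn hm.lt ?_ ?_ ?_) ?_
  -- A nonzero count at `y` comes from a marked token meeting `y`; hence the clearing loop over the
  -- marked tokens visits `y`.
  · intro y hy h
    change cnt y ≠ 0 at h
    rw [hc.cnt_eq y hy] at h
    split_ifs at h
    · exact absurd rfl h
    · rw [sum_ite_eq_card_inter hL] at h
      obtain ⟨w, hw⟩ := Finset.card_pos.1 (Nat.pos_of_ne_zero h)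
      rw [Finset.mem_inter] at hw
      obtain ⟨q, hq, rfl⟩ := hm.enum.exists_eq hw.1
      exact ⟨q, hq, mem_nbhd_singleton_comm hL hw.2⟩
  · intro y hy h
    change mark y ≠ 0 at h
    rw [hm.mark_eq y hy] at h
    split_ifs at h with hyN
    · obtain ⟨q, hq, hqy⟩ := hm.enum.exists_eq hyN
      exact ⟨q, hq, natCast_injOn s.n hy (hm.lt q hq) hqy.symm⟩
    · exact absurd rfl h
  · intro y hy h
    change inK y ≠ 0 at h
    rw [hinK y hy] at h
    split_ifs at h with hyK
    · obtain ⟨q, hq, hqy⟩ := Finset.mem_image.1 hyK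
      have hq' : q < s.k - 1 := Finset.mem_range.1 hq
      have hqk : q + 1 < s.k := by omega
      exact ⟨q, hqk, natCast_injOn s.n hy (hx q hqk) hqy.symm⟩
    · exact absurd rfl h
  · rintro s₅ T₅ ⟨⟨z, a, q, mark, inK, cnt, rfl, hclear'⟩, hT₅⟩
    refine ⟨⟨z, a, q, m, bad, mx, mark, inK, nb, cnt, flag, val, rfl, hclear', hbest⟩, ?_⟩
    rw [hm.enum.card_eq]
    simp only at hT₂ hT₃ hT₄ hT₅
    obtain ⟨r, hr⟩ : ∃ r, s.k = r + 1 := ⟨s.k - 1, by omega⟩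
    rw [hr, Nat.add_sub_cancel] at hT₁ hT₂ hT₅
    rw [hr]
    calc T₅ ≤ T + r * (s.t * 70 + 40) + 30 + r * 60 + 30 + (m * (s.t * 100 + 40) + 30) + 60 +
          (m * (s.t * 60 + 60) + r * 40 + 40) := by omega
      _ = T + r * (70 * s.t + 140) + m * (160 * s.t + 100) + 190 := by ring
      _ ≤ _ := by
        have := Nat.mul_le_mul_right (70 * s.t + 140) (Nat.le_add_right r 1)
        omega

/-! ### Enumerating the tuples -/

/-- The number of a tuple. -/
def tupleIndex {n r : ℕ} (f : Fin r → Fin n) : ℕ := (finFunctionFinEquiv f : ℕ)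

theorem tupleIndex_lt {n r : ℕ} (f : Fin r → Fin n) : tupleIndex f < n ^ r :=
  (finFunctionFinEquiv f).2

theorem tupleIndex_injective {n r : ℕ} :
    Function.Injective (tupleIndex : (Fin r → Fin n) → ℕ) :=
  fun _ _ h => finFunctionFinEquiv.injective (Fin.ext h)

theorem tupleIndex_update {n r : ℕ} (f : Fin r → Fin n) (i : Fin r) (v : Fin n) :
    tupleIndex (Function.update f i v) + f i * n ^ (i : ℕ) = tupleIndex f + v * n ^ (i : ℕ) := by
  rw [tupleIndex, tupleIndex, finFunctionFinEquiv_apply, finFunctionFinEquiv_apply,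
    ← Finset.add_sum_erase _ _ (Finset.mem_univ i),
    ← Finset.add_sum_erase Finset.univ (fun i => (f i : ℕ) * n ^ (i : ℕ)) (Finset.mem_univ i),
    Function.update_self]
  have : ∀ j ∈ Finset.univ.erase i, ((Function.update f i v j : Fin n) : ℕ) * n ^ (j : ℕ) =
      f j * n ^ (j : ℕ) := by
    intro j hj
    rw [Function.update_of_ne (Finset.ne_of_mem_erase hj)]
  rw [Finset.sum_congr rfl this]
  ring

/-- Proceeds to the next tuple, or sets `fin` if there is none. -/
def nextProg : Prog :=
  .seq (.write 20 (.lit 0) (.lit 1))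
  (.seq (.loop (.and tokenTest (.eq (.add (.read 9 (evar 20)) (.lit 1)) (evar 0)))
      (.seq (.write 9 (evar 20) (.lit 0)) (.write 20 (.lit 0) (.add (evar 20) (.lit 1)))))
    (.branch tokenTest (.write 9 (evar 20) (.add (.read 9 (evar 20)) (.lit 1)))
      (.write 22 (.lit 0) (.lit 1))))

/-- The tuple `f` is stored in the array `x`. -/
def Stores {n r : ℕ} (x : ℕ → ℕ) (f : Fin r → Fin n) : Prop :=
  x 0 = 0 ∧ ∀ i : Fin r, x (i + 1) = f i

theorem Stores.update {n r : ℕ} {x : ℕ → ℕ} {f : Fin r → Fin n} (h : Stores x f) (i : Fin r)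
    (v : Fin n) : Stores (Function.update x (i + 1) v) (Function.update f i v) := by
  refine ⟨by rw [Function.update_of_ne (by omega), h.1], fun j => ?_⟩
  rcases eq_or_ne j i with rfl | hji
  · rw [Function.update_self, Function.update_self]
  · have : (j : ℕ) ≠ i := fun h => hji (Fin.ext h)
    rw [Function.update_of_ne (by omega), Function.update_of_ne hji, h.2]

/-- The tuple is a number in base `n`, least significant digit first, and is increased by one with
carries. Digit `j` is stored in `x[j + 1]`, since `x[0] = 0` is fixed. -/
theorem wp_nextProg {W : ℕ} {s : St} {T r : ℕ} [NeZero s.n]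
    (hW : 4 * s.n * s.n + 4 * s.n + s.k + 4 ≤ W) (hk : s.k = r + 2) {f : Fin r → Fin s.n}
    (hf : Stores s.x f) (hfin : s.fin = 0) :
    WP W nextProg (fun s' T' => (∃ q x fin, s' = { s with q := q, x := x, fin := fin } ∧
      (fin = 0 ∧ (∃ f' : Fin r → Fin s.n, Stores x f' ∧ tupleIndex f' = tupleIndex f + 1) ∨
        fin = 1 ∧ s.n ^ r ≤ tupleIndex f + 1)) ∧ T' ≤ T + s.k * 60) s T := by
  have hn : 0 < s.n := Nat.pos_of_ne_zero (NeZero.ne _)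
  refine .seq (.write_q (by simp only [Expr.eval]; omega) (.seq ?_))
  -- After `j` digits have been reset, a carry of `n ^ j` is pending. If it runs past the last
  -- digit, the index plus one has reached `n ^ r` and the enumeration is complete.
  refine WP.loop (I := fun s' T' => ∃ (j : ℕ) (x : ℕ → ℕ) (g : Fin r → Fin s.n), j ≤ r ∧
    s' = { s with q := j + 1, x := x } ∧ Stores x g ∧ tupleIndex g + s.n ^ j = tupleIndex f + 1 ∧
    T' ≤ T + 3 + j * 40) (T + 3 + r * 40) ?_ ?_ ?_ ?_
  · exact ⟨0, s.x, f, Nat.zero_le _, rfl, hf, by simp, by simp [Expr.cost]⟩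
  · rintro s' T' ⟨j, x, g, hj, -, -, -, hT⟩
    have := Nat.mul_le_mul_right 40 hj
    omega
  · rintro s' T' ⟨j, x, g, hj, rfl, hg, hidx, hT⟩ hb
    simp only [Test.Holds, tokenTest_holds, Expr.eval, eval_evar, St.mem_q, St.mem_x, St.mem_in,
      cells_zero] at hb
    obtain ⟨hb1, hb2⟩ := hb
    have hjr : j < r := by omega
    have hv := hg.2 ⟨j, hjr⟩
    have hup := tupleIndex_update g ⟨j, hjr⟩ ⟨0, hn⟩
    simp only at hv hup
    have hsucc : (g ⟨j, hjr⟩ : ℕ) + 1 = s.n := by rw [← hv]; exact hb2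
    refine .seq (.write_x ?_ ?_ (.write_q ?_
      ⟨j + 1, _, Function.update g ⟨j, hjr⟩ ⟨0, hn⟩, hjr, rfl, ?_, ?_, ?_⟩))
    all_goals try simp only [Expr.eval, Expr.cost, Test.cost, tokenTest_cost, cost_evar, eval_evar,
      St.mem_q, cells_zero]
    · omega
    · omega
    · omega
    · exact hg.update ⟨j, hjr⟩ ⟨0, hn⟩
    · have : s.n ^ (j + 1) = g ⟨j, hjr⟩ * s.n ^ j + s.n ^ j := by
        rw [pow_succ, ← Nat.succ_mul, Nat.succ_eq_add_one, hsucc, mul_comm]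
      omega
    · omega
  · rintro s' T' ⟨j, x, g, hj, rfl, hg, hidx, hT⟩ hb
    simp only [Test.Holds, tokenTest_holds, Expr.eval, eval_evar, St.mem_q, St.mem_x, St.mem_in,
      cells_zero] at hb
    have hcost : (Test.and tokenTest (.eq (.add (.read 9 (evar 20)) (.lit 1)) (evar 0))).cost = 16 :=
      rfl
    refine .branch (fun hb' => .write_x ?_ ?_ ⟨⟨_, _, _, rfl, Or.inl ⟨hfin, ?_⟩⟩, ?_⟩)
      fun hb' => .write_fin ?_ ⟨⟨_, _, _, rfl, Or.inr ⟨rfl, ?_⟩⟩, ?_⟩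
    all_goals rw [tokenTest_holds] at hb'
    all_goals try simp only [Expr.eval, Expr.cost, hcost, tokenTest_cost, cost_evar, eval_evar,
      St.mem_q, St.mem_x, cells_zero]
    all_goals simp only at hb'
    · omega
    · have hjr : j < r := by omega
      have hv := hg.2 ⟨j, hjr⟩
      have := (g ⟨j, hjr⟩).2
      simp only at hv
      omega
    · have hjr : j < r := by omega
      have hv := hg.2 ⟨j, hjr⟩
      have hlt := (g ⟨j, hjr⟩).2
      simp only at hv
      have hlt' : (g ⟨j, hjr⟩ : ℕ) + 1 < s.n :=
        lt_of_le_of_ne hlt fun h => hb ⟨hb', by rw [hv]; exact h⟩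
      refine ⟨Function.update g ⟨j, hjr⟩ ⟨g ⟨j, hjr⟩ + 1, hlt'⟩, ?_, ?_⟩
      · have := hg.update ⟨j, hjr⟩ ⟨g ⟨j, hjr⟩ + 1, hlt'⟩
        simp only at this
        rwa [hv]
      · have hup := tupleIndex_update g ⟨j, hjr⟩ ⟨g ⟨j, hjr⟩ + 1, hlt'⟩
        simp only at hup
        rw [Nat.succ_mul] at hup
        omega
    · omega
    · omega
    · have : j = r := by omega
      subst this
      omega
    · omega

/-- Processes all tuples. -/
def enumProg : Prog := .loop (.eq (evar 22) (.lit 0)) (.seq tupleProg nextProg)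

theorem wp_enumProg {W : ℕ} {s : St} {T r : ℕ} [NeZero s.n] {L : Finset ℕ}
    (hW : 4 * s.n * s.n + 4 * s.n + s.k + 4 ≤ W) (hk : s.k = r + 2) (hL : IsSymmetric s.n L)
    (hlst : Enumerates s.lst s.t L) (hx : ∀ q, s.x q = 0)
    (hclear : ∀ y < s.n, s.mark y = 0 ∧ s.inK y = 0 ∧ s.cnt y = 0) (hflag : s.flag = 0)
    (hfin : s.fin = 0) :
    WP W enumProg (fun s' T' => IsBest {c | ∃ f : Fin r → Fin s.n,
        c ∈ candidates L (r + 1) (tupleSet f)} s'.flag s'.val ∧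
      T' ≤ T + s.n ^ r * (s.k * (70 * s.t + 200) +
        min s.n (s.k * s.t) * (160 * s.t + 100) + 300) + 10) s T := by
  have hn : 0 < s.n := Nat.pos_of_ne_zero (NeZero.ne _)
  set B := s.k * (70 * s.t + 200) + min s.n (s.k * s.t) * (160 * s.t + 100) + 300 with hB
  -- `Z i` collects the candidates of the tuples with index below `i`; the output cells hold its
  -- minimum.
  let Z : ℕ → Set ℕ := fun i => {c | ∃ f : Fin r → Fin s.n, tupleIndex f < i ∧
    c ∈ candidates L (r + 1) (tupleSet f)}
  have hZend : ∀ i, s.n ^ r ≤ i → Z i = {c | ∃ f : Fin r → Fin s.n,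
      c ∈ candidates L (r + 1) (tupleSet f)} := by
    intro i hi
    ext c
    exact ⟨fun ⟨f, _, h⟩ => ⟨f, h⟩, fun ⟨f, h⟩ => ⟨f, (tupleIndex_lt f).trans_le hi, h⟩⟩
  have hZsucc : ∀ f : Fin r → Fin s.n,
      Z (tupleIndex f + 1) = Z (tupleIndex f) ∪ candidates L (r + 1) (tupleSet f) := by
    intro f
    ext c
    constructor
    · rintro ⟨g, hg, hc⟩
      rcases Nat.lt_succ_iff_lt_or_eq.1 hg with h | h
      · exact Or.inl ⟨g, h, hc⟩
      · rw [tupleIndex_injective h] at hc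
        exact Or.inr hc
    · rintro (⟨g, hg, hc⟩ | hc)
      · exact ⟨g, by omega, hc⟩
      · exact ⟨f, by omega, hc⟩
  refine WP.loop (I := fun s' T' => ∃ z a q m bad mx mark inK nb cnt flag val x fin,
    s' = { s with
        z := z, a := a, q := q, m := m, bad := bad, mx := mx, mark := mark, inK := inK, nb := nb, cnt := cnt, flag := flag, val := val, x := x, fin := fin } ∧
      (∀ y < s.n, mark y = 0 ∧ inK y = 0 ∧ cnt y = 0) ∧
      ((fin = 0 ∧ ∃ f : Fin r → Fin s.n, Stores x f ∧ IsBest (Z (tupleIndex f)) flag val ∧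
          T' ≤ T + tupleIndex f * B) ∨
        (fin = 1 ∧ IsBest (Z (s.n ^ r)) flag val ∧ T' ≤ T + s.n ^ r * B)))
    (T + s.n ^ r * B) ?_ ?_ ?_ ?_
  · refine ⟨s.z, s.a, s.q, s.m, s.bad, s.mx, s.mark, s.inK, s.nb, s.cnt, s.flag, s.val, s.x, s.fin,
      rfl, hclear, Or.inl ⟨hfin, fun _ => ⟨0, hn⟩, ⟨hx 0, fun i => hx _⟩, Or.inl ⟨hflag, ?_⟩,
      by omega⟩⟩
    have h0 : tupleIndex (fun _ : Fin r => (⟨0, hn⟩ : Fin s.n)) = 0 := by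
      simp [tupleIndex]
    rw [h0]
    refine Set.eq_empty_of_forall_notMem ?_
    rintro c ⟨f, hf, -⟩
    omega
  · rintro s' T' ⟨z, a, q, m, bad, mx, mark, inK, nb, cnt, flag, val, x, fin, -, -, h⟩
    rcases h with ⟨-, f, -, -, h⟩ | ⟨-, -, h⟩
    · exact h.trans (Nat.add_le_add_left (Nat.mul_le_mul_right B (tupleIndex_lt f).le) T)
    · exact h
  · rintro s' T' ⟨z, a, q, m, bad, mx, mark, inK, nb, cnt, flag, val, x, fin, rfl, hcl, h⟩ hb
    simp only [Test.Holds, Expr.eval, eval_evar, St.mem_fin, cells_zero] at hb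
    obtain ⟨f, hf, hbest, hT⟩ : ∃ f : Fin r → Fin s.n, Stores x f ∧
        IsBest (Z (tupleIndex f)) flag val ∧ T' ≤ T + tupleIndex f * B := by
      rcases h with h | h
      · exact h.2
      · exact absurd (hb.symm.trans h.1) zero_ne_one
    have hxlt : ∀ q, q + 1 < s.k → x q < s.n := by
      intro q hq
      rcases q with _ | q
      · rw [hf.1]; exact hn
      · have := hf.2 ⟨q, by omega⟩
        simp only at this
        rw [this]; exact (f _).2
    have htok : tokens s.n x (s.k - 1) = tupleSet f := by
      rw [hk]
      exact image_range_eq_tupleSet hf.1 hf.2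
    refine .seq (WP.mono (wp_tupleProg (s := { s with
      z := z, a := a, q := q, m := m, bad := bad, mx := mx, mark := mark, inK := inK, nb := nb, cnt := cnt, flag := flag, val := val, x := x,
      fin := fin }) hW (by simp only; omega) hL hlst hxlt hcl hbest) ?_)
    rintro s' T₁ ⟨⟨z, a, q, m, bad, mx, mark, inK, nb, cnt, flag, val, rfl, hcl, hbest⟩, hT₁⟩
    refine WP.mono (wp_nextProg (s := { s with
      z := z, a := a, q := q, m := m, bad := bad, mx := mx, mark := mark, inK := inK, nb := nb, cnt := cnt, flag := flag, val := val, x := x,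
      fin := fin }) hW hk hf hb) ?_
    rintro s' T₂ ⟨⟨q, x', fin, rfl, hnext⟩, hT₂⟩
    simp only [hk, show r + 2 - 1 = r + 1 from rfl] at htok
    simp only [hk, show r + 2 - 1 = r + 1 from rfl, htok] at hbest hT₁ hT₂ hnext
    -- Here the factor `min(n, kt)` of the running time arises: at most `k - 1` tokens have at most
    -- `t` neighbours each, out of `n` in all.
    have hcard : (nbhd L (tupleSet f)).card ≤ min s.n (s.k * s.t) := by
      refine le_min ?_ ?_
      · exact (Finset.card_le_univ _).trans_eq (ZMod.card s.n)
      · refine (card_nbhd_le _).trans ?_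
        rw [hlst.card_eq, ← htok]
        refine Nat.mul_le_mul_right _ ?_
        refine (Finset.card_image_le.trans_eq (Finset.card_range _)).trans (by omega)
    have hTB : T₂ ≤ T + (tupleIndex f + 1) * B := by
      have h1 := Nat.mul_le_mul_right (160 * s.t + 100) hcard
      have h2 : B = (r + 2) * (70 * s.t + 140) + (r + 2) * 60 +
          min s.n (s.k * s.t) * (160 * s.t + 100) + 300 := by
        rw [hB, hk]; ring
      rw [Nat.succ_mul]
      simp only [Test.cost, Expr.cost, cost_evar] at hT₁
      have h3 : (nbhd L (tupleSet f)).card * (160 * s.t + 100) ≤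
          min s.n (s.k * s.t) * (160 * s.t + 100) := h1
      omega
    have hbest' : IsBest (Z (tupleIndex f + 1)) flag val := by
      rw [hZsucc]
      exact hbest
    refine ⟨z, a, q, m, bad, mx, mark, inK, nb, cnt, flag, val, x', fin, rfl, hcl, ?_⟩
    rcases hnext with ⟨h0, f', hf', hidx⟩ | ⟨h1, hidx⟩
    · exact Or.inl ⟨h0, f', hf', by rw [hidx]; exact hbest', by rw [hidx]; exact hTB⟩
    · have : tupleIndex f + 1 = s.n ^ r := le_antisymm (tupleIndex_lt f) hidx
      rw [this] at hbest' hTB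
      exact Or.inr ⟨h1, hbest', hTB⟩
  · rintro s' T' ⟨z, a, q, m, bad, mx, mark, inK, nb, cnt, flag, val, x, fin, rfl, hcl, h⟩ hb
    simp only [Test.Holds, Expr.eval, eval_evar, St.mem_fin, cells_zero] at hb
    rcases h with h | ⟨-, hbest, hT⟩
    · exact absurd h.1 hb
    · rw [hZend _ le_rfl] at hbest
      refine ⟨hbest, ?_⟩
      simp only [Test.cost, Expr.cost, cost_evar]
      omega

/-! ### The main program -/

/-- Computes the `k`-resilience. -/
def resilienceProg : Prog :=
  -- For `k > n` the untouched output flag `0` already says that the result is infinite. Otherwise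
  -- `k ≤ n`, which the estimate of the running time needs.
  .branch (.lt (evar 0) (.read 0 (.lit 1))) .skip
    (.seq degreeProg (.seq peelProg (.seq listProg enumProg)))

/-- Negation modulo `n` corresponds to exchanging the two sides of an edge. -/
theorem isSymmetric_sideSet {n : ℕ} {G : SimpleGraph (Fin n)} (hG : G.IsTree) :
    IsSymmetric n (sideSet G) := by
  intro l hl
  obtain ⟨i, j, hij, rfl⟩ := mem_sideSet.1 hl
  have h := sideCard_add hG hij
  rw [Fintype.card_fin] at h
  have := sideCard_pos hij
  have := sideCard_pos hij.symm
  exact ⟨by omega, by omega, mem_sideSet.2 ⟨j, i, hij.symm, by omega⟩⟩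

theorem card_sideSet_pos {n : ℕ} {G : SimpleGraph (Fin n)} (hG : G.Connected) (hn : 2 ≤ n) :
    1 ≤ (sideSet G).card := by
  have : Nontrivial (Fin n) := Fin.nontrivial_iff_two_le.2 hn
  obtain ⟨j, hj⟩ := hG.preconnected.exists_adj_of_nontrivial ⟨0, by omega⟩
  exact Finset.card_pos.2 ⟨_, mem_sideSet.2 ⟨_, j, hj, rfl⟩⟩

/-- The initial contents. -/
def inputSt {n : ℕ} (k : ℕ) (es : List (Fin n × Fin n)) : St where
  n := n
  k := k
  flag := 0
  val := 0
  ea := fun i => (es.map fun e => (e.1 : ℕ)).getD i 0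
  eb := fun i => (es.map fun e => (e.2 : ℕ)).getD i 0
  deg := fun _ => 0
  ns := fun _ => 0
  sz := fun _ => 0
  pres := fun _ => 0
  lst := fun _ => 0
  x := fun _ => 0
  mark := fun _ => 0
  inK := fun _ => 0
  nb := fun _ => 0
  cnt := fun _ => 0
  v := 0
  w := 0
  t := 0
  m := 0
  bad := 0
  mx := 0
  q := 0
  a := 0
  fin := 0
  z := 0

theorem inputMem_eq {n : ℕ} (k : ℕ) (es : List (Fin n × Fin n)) :
    inputMem k es = (inputSt k es).mem := by
  have h : ∀ i, cells 0 0 i = 0 := by rintro (_ | _ | i) <;> rfl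
  funext a i
  by_cases ha : a < 24
  · interval_cases a <;> first | rfl | exact (h i).symm | rcases i with _ | _ | i <;> rfl
  · obtain ⟨a, rfl⟩ := Nat.exists_eq_add_of_le (not_lt.1 ha)
    rw [Nat.add_comm]
    rfl

open Classical in
theorem wp_resilienceProg {W n k : ℕ} {G : SimpleGraph (Fin n)} (hG : G.IsTree)
    {es : List (Fin n × Fin n)} (hes : ListsEdges G es) (hW : 4 * n * n + 4 * n + k + 4 ≤ W)
    (hk : 2 ≤ k) (hkn : k ≤ n) :
    WP W resilienceProg (fun s' T' =>
      IsBest {c | ∃ f : Fin (k - 2) → Fin n,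
        c ∈ candidates (sideSet G) (k - 2 + 1) (tupleSet f)} s'.flag s'.val ∧
      T' ≤ n ^ (k - 2) * (k * (70 * (sideSet G).card + 200) +
        min n (k * (sideSet G).card) * (160 * (sideSet G).card + 100) + 300) + 400 * n + 40)
      (inputSt k es) 0 := by
  have : NeZero (inputSt k es).n := ⟨by change n ≠ 0; omega⟩
  refine .branch (fun hb => ?_) (fun _ => ?_)
  · exact absurd hb (not_lt.2 hkn)
  refine .seq (WP.mono (wp_degreeProg (inputSt k es) _ hG hes hW rfl rfl rfl rfl rfl) ?_)
  rintro _ T₁ ⟨⟨v, deg, ns, rfl, hu⟩, hT₁⟩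
  refine .seq (WP.mono (wp_peelProg (s := { inputSt k es with v := v, deg := deg, ns := ns })
    (T := T₁) hG hW hu rfl rfl) ?_)
  rintro _ T₂ ⟨⟨v, w, z, m, deg, ns, sz, pres, rfl, hpres⟩, hT₂⟩
  refine .seq (WP.mono (wp_listProg (s := { inputSt k es with
    v := v, w := w, z := z, m := m, deg := deg, ns := ns, sz := sz, pres := pres })
    (T := T₂) hW hpres (fun l hl => (isSymmetric_sideSet hG l hl).2.1) rfl) ?_)
  rintro _ T₃ ⟨⟨v, lst, rfl, hlst⟩, hT₃⟩
  refine WP.mono (wp_enumProg (r := k - 2) (s := { inputSt k es with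
    v := v, w := w, z := z, m := m, deg := deg, ns := ns, sz := sz, pres := pres, lst := lst,
    t := (sideSet G).card }) (T := T₃) hW (by change k = _; omega) (isSymmetric_sideSet hG) hlst
    (fun _ => rfl) (fun _ _ => ⟨rfl, rfl, rfl⟩) rfl rfl) ?_
  rintro s' T' ⟨hbest, hT'⟩
  refine ⟨hbest, hT'.trans ?_⟩
  change T₁ ≤ _ + 100 * n at hT₁
  change T₂ ≤ T₁ + 200 * n + 10 at hT₂
  change T₃ ≤ T₂ + 100 * n + 10 at hT₃
  simp only [Test.cost, Expr.cost, cost_evar] at hT₁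
  change T₃ + n ^ (k - 2) * (k * (70 * (sideSet G).card + 200) +
        min n (k * (sideSet G).card) * (160 * (sideSet G).card + 100) + 300) + 10 ≤ _
  generalize n ^ (k - 2) * _ = X
  omega

/-! ### Estimate of the running time and conclusion -/

/-- From `k ≤ n` and `t ≥ 1` one gets `k ≤ min n (k * t)`, so marking and carrying cost no more than
counting. From `k ≥ 3` one gets `n ≤ n ^ (k - 2)`, which absorbs the linear preprocessing. -/
theorem time_le {n k t : ℕ} (hk : 3 ≤ k) (hkn : k ≤ n) (ht : 1 ≤ t) :
    n ^ (k - 2) * (k * (70 * t + 200) + min n (k * t) * (160 * t + 100) + 300) + 400 * n + 40 ≤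
      2000 * (n ^ (k - 2) * t * min n (k * t)) := by
  have hm : k ≤ min n (k * t) := le_min hkn (Nat.le_mul_of_pos_right k ht)
  have hp : n ≤ n ^ (k - 2) := Nat.le_self_pow (by omega) n
  generalize min n (k * t) = m at hm ⊢
  generalize n ^ (k - 2) = p at hp ⊢
  have h1 : k * (70 * t + 200) ≤ m * (270 * t) := Nat.mul_le_mul hm (by omega)
  have h2 : m * (160 * t + 100) ≤ m * (260 * t) := Nat.mul_le_mul le_rfl (by omega)
  have h3 : 1 ≤ t * m := Nat.mul_pos (by omega) (by omega)
  have h4 : k * (70 * t + 200) + m * (160 * t + 100) + 300 ≤ 830 * (t * m) := by nlinarith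
  have h5 := Nat.mul_le_mul (le_refl p) h4
  have h6 : p ≤ p * (t * m) := Nat.le_mul_of_pos_right p h3
  have h7 : p * (830 * (t * m)) = 830 * (p * (t * m)) := by ring
  rw [mul_assoc p t m]
  linarith

theorem resilience_eq_top {n k : ℕ} (S : SCS n) (hG : S.graph.IsTree) (h : n < k) :
    S.resilience k = ⊤ := by
  have : NeZero n := ⟨by
    have ⟨i⟩ := hG.connected.nonempty
    have := i.2
    omega⟩
  rw [S.resilience_eq hG, sInf_eq_top]
  rintro m ⟨K, hK, -⟩
  have := K.card_le_univ
  rw [ZMod.card] at this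
  omega

end MultiRobot

theorem mainTheorem8 :
    ∃ (P : MultiRobot.Prog) (C c : ℕ),
      ∀ (n k : ℕ) (S : MultiRobot.SCS n) (es : List (Fin n × Fin n)),
        3 ≤ k → S.graph.IsTree → MultiRobot.ListsEdges S.graph es →
        ∃ (M : MultiRobot.Mem) (T : ℕ),
          MultiRobot.Run ((n + k + 2) ^ c) P (MultiRobot.inputMem k es) M T ∧
          MultiRobot.outputOf M = S.resilience k ∧
          (2 ≤ n →
            T ≤ C * (n ^ (k - 2) * S.numTieLengths * min n (k * S.numTieLengths)) ∧
            T ≤ C * (S.numTieLengths * n ^ (k - 1))) := by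
  open MultiRobot in
  -- The exponent `3` makes the word bound exceed `4n² + 4n + k + 4` for all `n` and `k` without a
  -- further constant.
  refine ⟨resilienceProg, 2000, 3, fun n k S es hk hG hes => ?_⟩
  rw [S.numTieLengths_eq hG, inputMem_eq]
  -- The second time bound follows from the first by `min n (k * t) ≤ n`.
  have hsnd : n ^ (k - 2) * (sideSet S.graph).card * min n (k * (sideSet S.graph).card) ≤
      (sideSet S.graph).card * n ^ (k - 1) := by
    rw [show k - 1 = k - 2 + 1 by omega, pow_succ, mul_comm (n ^ (k - 2)), mul_assoc]
    gcongr
    exact min_le_left _ _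
  suffices h : ∃ (M : Mem) (T : ℕ), Run ((n + k + 2) ^ 3) resilienceProg (inputSt k es).mem M T ∧
      outputOf M = S.resilience k ∧ (2 ≤ n → T ≤ 2000 *
        (n ^ (k - 2) * (sideSet S.graph).card * min n (k * (sideSet S.graph).card))) by
    obtain ⟨M, T, hrun, hout, hT⟩ := h
    exact ⟨M, T, hrun, hout, fun hn => ⟨hT hn, (hT hn).trans (Nat.mul_le_mul_left _ hsnd)⟩⟩
  rcases lt_or_ge n k with hlt | hle
  -- For `n < k` only the initial test is executed. Its constant cost is covered because the bound
  -- is positive, as `n ≥ 2` guarantees an edge and hence a tie length.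
  · refine ⟨_, _, .branchTrue hlt (.skip _), ?_, fun hn => ?_⟩
    · rw [resilience_eq_top S hG hlt]
      rfl
    · have ht := card_sideSet_pos hG.connected hn
      have : 1 ≤ n ^ (k - 2) * (sideSet S.graph).card * min n (k * (sideSet S.graph).card) :=
        Nat.mul_pos (Nat.mul_pos (Nat.pow_pos (by omega)) ht)
          (lt_min (by omega) (Nat.mul_pos (by omega) ht))
      simp only [Test.cost, Expr.cost, cost_evar]
      omega
  · have hW : 4 * n * n + 4 * n + k + 4 ≤ (n + k + 2) ^ 3 := by
      have h : 8 * (n + k + 2) ^ 2 ≤ (n + k + 2) ^ 3 := by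
        rw [pow_succ (n + k + 2) 2, mul_comm 8]
        exact Nat.mul_le_mul_left _ (by omega)
      nlinarith
    obtain ⟨s, T, hrun, hbest, hT⟩ := wp_resilienceProg hG hes hW (by omega) hle
    have : NeZero n := ⟨by omega⟩
    refine ⟨s.mem, T, hrun, ?_, fun hn => ?_⟩
    · rw [S.resilience_eq hG, show k = k - 2 + 2 by omega,
        sInf_eq_sInf_candidates (isSymmetric_sideSet hG), ← hbest.eq_sInf]
      rfl
    · exact (Nat.zero_add T ▸ hT).trans (time_le hk hle (card_sideSet_pos hG.connected hn))
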